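/- Let $C$ be a finite set of candidates, $L$ a finite set of labels, $\lambda\colon C\to 2^L$ a labeling, and $C_\ell=\{c\in C:\ell\in\lambda(c)\}$. Let $b_1,b_2\colon L\to\mathbb N$ be lower and upper bounds; a committee $W\subseteq C$ is called *diverse* if $b_1(\ell)\le|W\cap C_\ell|\le b_2(\ell)$ for every $\ell\in L$ (interval constraints). Suppose that $\lambda$ is *2-laminar*, that is, $L$ is partitioned into two (possibly empty) sets $L_1,L_2$, the partition being part of the input, such that for each $i\in\{1,2\}$ and all distinct $x,y\in L_i$ one has $C_x\cap C_y=\emptyset$, $C_x\subseteq C_y$ or $C_y\subseteq C_x$. Let $k\in\mathbb N$, and let $f(W)=\sum_{c\in W}w_c$ be the separable objective function given by a weight vector $w\in\mathbb R^C$. The problem DCF (Diverse Committee Feasibility) asks whether there is a diverse committee of size $k$. The problem DCWD (Diverse Committee Winner Determination) asks for a diverse committee of size $k$ of maximum value $f(W)$ among all diverse committees of size $k$, or for the report that no diverse committee of size $k$ exists. Then, on a random access machine with unit-cost addition, subtraction and comparison of natural numbers and of real numbers, where $\lambda$ is given as a $|C|\times|L|$ incidence matrix, there are: 1. an algorithm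 that solves DCF on all such inputs, in $O(k^2|C|^3|L|)$ time; 2. an algorithm that solves DCWD on all such inputs, in $O(k|C|^3+k^3|C|^2|L|)$ time. The algorithms are correct and terminate on all inputs. The implied constants are absolute; the time bound in (1) is for inputs with $k,|C|,|L|\ge1$, and the one in (2) for inputs with $k,|C|\ge1$. -/

import Mathlib

/-! ### Labelings, diversity constraints and committees -/

namespace DiverseCommittee

section Model

variable {C L : Type*} [Fintype C] [DecidableEq C] [DecidableEq L]

/-- The set `C_ℓ` of all candidates that have label `ℓ` under the labeling `lab : C → 2^L`. -/
def labelClass (lab : C → Finset L) (l : L) : Finset C :=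
  Finset.univ.filter (fun c => l ∈ lab c)

/-- The labeling restricted to the labels in `S` is 1-laminar: for any two distinct labels of `S`,
the label classes are disjoint or one contains the other. -/
def OneLaminarOn (lab : C → Finset L) (S : Set L) : Prop :=
  ∀ x ∈ S, ∀ y ∈ S, x ≠ y →
    labelClass lab x ∩ labelClass lab y = ∅ ∨
      labelClass lab x ⊆ labelClass lab y ∨ labelClass lab y ⊆ labelClass lab x

/-- The map `part` partitions the labels into `t` (possibly empty) parts such that the labeling
restricted to each of the parts is 1-laminar. -/
def IsLaminarPartition (t : ℕ) (lab : C → Finset L) (part : L → Fin t) : Prop :=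
  ∀ i : Fin t, OneLaminarOn lab {l | part l = i}

/-- The diversity specification of interval constraints with lower bounds `lo` and upper
bounds `hi`. -/
def IntervalDiverse (lab : C → Finset L) (lo hi : L → ℕ) (W : Finset C) : Prop :=
  ∀ l : L, lo l ≤ (W ∩ labelClass lab l).card ∧ (W ∩ labelClass lab l).card ≤ hi l

/-- The separable objective function given by the weights `w`. -/
def separable (w : C → ℝ) (W : Finset C) : ℝ := ∑ c ∈ W, w c

/-- For a diversity specification `D`: some `D`-diverse committee of size `k` exists. -/
def Feasible (D : Finset C → Prop) (k : ℕ) : Prop :=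
  ∃ W : Finset C, W.card = k ∧ D W

/-- `W` is a `D`-diverse committee of size `k` of maximum value of the objective function `f`
among all such committees. -/
def IsWinning (D : Finset C → Prop) (k : ℕ) (f : Finset C → ℝ) (W : Finset C) : Prop :=
  W.card = k ∧ D W ∧ ∀ W' : Finset C, W'.card = k → D W' → f W' ≤ f W

end Model

/-! ### A random access machine with unit costs

The memory has banks of cells for natural numbers and banks of cells for real numbers; each bank is
indexed by natural numbers. The bank accessed by an instruction is fixed in the program, the index
is computed at run time (indirect addressing). The available arithmetic is addition and
(on natural numbers, truncated) subtraction; there is no multiplication, and information passes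
from real cells to natural cells only through comparisons. Programs are structured (sequences,
conditionals, loops). Every memory access, constant, arithmetic operation, comparison, Boolean
operation, assignment and branching costs one time unit. -/

/-- Memory contents: `nat a i` is the natural number in cell `i` of bank `a`, and `real a i` the
real number in cell `i` of the real bank `a`. -/
structure Memory where
  nat : ℕ → ℕ → ℕ
  real : ℕ → ℕ → ℝ

/-- Overwrite one natural-number cell. -/
def Memory.writeNat (s : Memory) (a i v : ℕ) : Memory :=
  { s with nat := Function.update s.nat a (Function.update (s.nat a) i v) }

/-- Overwrite one real-number cell. -/
def Memory.writeReal (s : Memory) (a i : ℕ) (v : ℝ) : Memory :=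
  { s with real := Function.update s.real a (Function.update (s.real a) i v) }

/-- Expressions for natural numbers. -/
inductive NatExpr where
  | const (v : ℕ)
  | get (a : ℕ) (i : NatExpr)
  | plus (e₁ e₂ : NatExpr)
  | minus (e₁ e₂ : NatExpr)

def NatExpr.eval (s : Memory) : NatExpr → ℕ
  | .const v => v
  | .get a i => s.nat a (i.eval s)
  | .plus e₁ e₂ => e₁.eval s + e₂.eval s
  | .minus e₁ e₂ => e₁.eval s - e₂.eval s

/-- The number of operations performed when the expression is evaluated. -/
def NatExpr.cost : NatExpr → ℕ
  | .const _ => 1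
  | .get _ i => i.cost + 1
  | .plus e₁ e₂ => e₁.cost + e₂.cost + 1
  | .minus e₁ e₂ => e₁.cost + e₂.cost + 1

/-- Expressions for real numbers; the only constants are integers. -/
inductive RealExpr where
  | const (v : ℤ)
  | get (a : ℕ) (i : NatExpr)
  | plus (e₁ e₂ : RealExpr)
  | minus (e₁ e₂ : RealExpr)

noncomputable def RealExpr.eval (s : Memory) : RealExpr → ℝ
  | .const v => (v : ℝ)
  | .get a i => s.real a (i.eval s)
  | .plus e₁ e₂ => e₁.eval s + e₂.eval s
  | .minus e₁ e₂ => e₁.eval s - e₂.eval s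

def RealExpr.cost : RealExpr → ℕ
  | .const _ => 1
  | .get _ i => i.cost + 1
  | .plus e₁ e₂ => e₁.cost + e₂.cost + 1
  | .minus e₁ e₂ => e₁.cost + e₂.cost + 1

/-- Tests. -/
inductive Test where
  | natLe (e₁ e₂ : NatExpr)
  | realLe (e₁ e₂ : RealExpr)
  | neg (b : Test)
  | conj (b₁ b₂ : Test)

def Test.Holds (s : Memory) : Test → Prop
  | .natLe e₁ e₂ => e₁.eval s ≤ e₂.eval s
  | .realLe e₁ e₂ => e₁.eval s ≤ e₂.eval s
  | .neg b => ¬ b.Holds s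
  | .conj b₁ b₂ => b₁.Holds s ∧ b₂.Holds s

def Test.cost : Test → ℕ
  | .natLe e₁ e₂ => e₁.cost + e₂.cost + 1
  | .realLe e₁ e₂ => e₁.cost + e₂.cost + 1
  | .neg b => b.cost + 1
  | .conj b₁ b₂ => b₁.cost + b₂.cost + 1

/-- Programs. `setNat a i e` stores the value of `e` in the cell of bank `a` whose index is the
value of `i`, and `setReal` does so for real banks. -/
inductive Program where
  | skip
  | setNat (a : ℕ) (i e : NatExpr)
  | setReal (a : ℕ) (i : NatExpr) (e : RealExpr)
  | seq (p q : Program)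
  | branch (b : Test) (p q : Program)
  | loop (b : Test) (p : Program)

/-- `Exec p s s' t`: started in memory `s`, the program `p` halts after `t` time units in
memory `s'`. -/
inductive Exec : Program → Memory → Memory → ℕ → Prop where
  | skip (s : Memory) : Exec .skip s s 1
  | setNat (s : Memory) (a : ℕ) (i e : NatExpr) :
      Exec (.setNat a i e) s (s.writeNat a (i.eval s) (e.eval s)) (i.cost + e.cost + 1)
  | setReal (s : Memory) (a : ℕ) (i : NatExpr) (e : RealExpr) :
      Exec (.setReal a i e) s (s.writeReal a (i.eval s) (e.eval s)) (i.cost + e.cost + 1)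
  | seq {p q : Program} {s s₁ s₂ : Memory} {t₁ t₂ : ℕ} :
      Exec p s s₁ t₁ → Exec q s₁ s₂ t₂ → Exec (.seq p q) s s₂ (t₁ + t₂)
  | branchTrue {b : Test} {p q : Program} {s s₁ : Memory} {t : ℕ} :
      b.Holds s → Exec p s s₁ t → Exec (.branch b p q) s s₁ (b.cost + t + 1)
  | branchFalse {b : Test} {p q : Program} {s s₁ : Memory} {t : ℕ} :
      ¬ b.Holds s → Exec q s s₁ t → Exec (.branch b p q) s s₁ (b.cost + t + 1)
  | loopDone {b : Test} {p : Program} {s : Memory} :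
      ¬ b.Holds s → Exec (.loop b p) s s (b.cost + 1)
  | loopStep {b : Test} {p : Program} {s s₁ s₂ : Memory} {t₁ t₂ : ℕ} :
      b.Holds s → Exec p s s₁ t₁ → Exec (.loop b p) s₁ s₂ t₂ →
        Exec (.loop b p) s s₂ (b.cost + t₁ + t₂ + 1)

/-! ### Problem instances -/

/-- An instance with interval constraints and a separable objective function: candidates
`0, …, m - 1`, labels `0, …, n - 1`, a labeling, a division of the labels into two parts, lower and
upper bounds, the committee size, and the weights of the objective function. -/
structure Instance where
  m : ℕ
  n : ℕ
  lab : Fin m → Finset (Fin n)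
  part : Fin n → Fin 2
  lo : Fin n → ℕ
  hi : Fin n → ℕ
  k : ℕ
  w : Fin m → ℝ

namespace Instance

variable (I : Instance)

/-- The labeling is 2-laminar, as witnessed by the given partition of the labels. -/
def TwoLaminar : Prop := IsLaminarPartition 2 I.lab I.part

/-- The diversity specification of the instance. -/
def Diverse (W : Finset (Fin I.m)) : Prop := IntervalDiverse I.lab I.lo I.hi W

/-- The objective function of the instance. -/
noncomputable def objective (W : Finset (Fin I.m)) : ℝ := separable I.w W

/-- The natural-number banks at the start: bank 0 holds `m`, `n`, `k`; bank 1 holds the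
`m × n` incidence matrix of candidates and labels, row by row (the entry for candidate `c` and
label `l` is in cell `c * n + l`); banks 2, 3 and 4 hold the part, the lower bound and the upper
bound of each label. All other cells are 0. -/
def inputNat : ℕ → ℕ → ℕ
  | 0, 0 => I.m
  | 0, 1 => I.n
  | 0, 2 => I.k
  | 1, i => if h : i < I.m * I.n then
      (if Fin.modNat ⟨i, h⟩ ∈ I.lab (Fin.divNat ⟨i, h⟩) then 1 else 0) else 0
  | 2, i => if h : i < I.n then (I.part ⟨i, h⟩ : ℕ) else 0
  | 3, i => if h : i < I.n then I.lo ⟨i, h⟩ else 0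
  | 4, i => if h : i < I.n then I.hi ⟨i, h⟩ else 0
  | _, _ => 0

/-- The real banks at the start: bank 0 holds the weights of the candidates. -/
noncomputable def inputReal : ℕ → ℕ → ℝ
  | 0, i => if h : i < I.m then I.w ⟨i, h⟩ else 0
  | _, _ => 0

/-- The memory at the start. -/
noncomputable def input : Memory := ⟨I.inputNat, I.inputReal⟩

/-- The final memory `s` answers the feasibility problem: cell 0 of bank 5 holds 1 if there is a
diverse committee of size `k`, and 0 otherwise. -/
def AnswersDCF (s : Memory) : Prop :=
  (Feasible I.Diverse I.k → s.nat 5 0 = 1) ∧ (¬ Feasible I.Diverse I.k → s.nat 5 0 = 0)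

/-- The final memory `s` answers the winner determination problem: if there is a diverse committee
of size `k`, then cell 0 of bank 5 holds 1 and the first `m` cells of bank 6 hold the
characteristic vector of a winning committee; otherwise cell 0 of bank 5 holds 0. -/
def AnswersDCWD (s : Memory) : Prop :=
  (Feasible I.Diverse I.k → s.nat 5 0 = 1 ∧
    ∃ W : Finset (Fin I.m), IsWinning I.Diverse I.k I.objective W ∧
      ∀ c : Fin I.m, s.nat 6 c = if c ∈ W then 1 else 0) ∧
  (¬ Feasible I.Diverse I.k → s.nat 5 0 = 0)

end Instance

end DiverseCommittee

/-! The interval constraints are absorbed into the objective. A label with count `j` earns `M * (min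
j lo - max (j - hi) 0)`. This function of `j` has decreasing increments, equals its maximum `M * lo`
inside the interval and falls short by at least `M` outside. With `M = 1 + ∑ |w|` one violation
outweighs every difference in weight. Hence a committee of size `k` that maximizes reward plus
weight is a winning committee if any diverse committee exists (`diverse_of_isSizeOptimal`), and
otherwise a final check of the counts finds it not diverse.

For one laminar family, a sum of concave functions of the set sizes behaves like a valuated matroid,
so the two parts lead to a valuated matroid intersection. It is solved by successive augmentation.
Optimality of a set `W` of size `j` is certified by a splitting `w = q₁ + q₂` such that `W` is
optimal among sets of its size for each part with its own share of the weights. In the exchange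
graph an arc from `d` to `c` prices the entrance of `c` for `d` in part 0, and an arc from `c` to
`d` prices the same exchange in part 1. A dummy candidate without labels serves as source and sink.
A best closed walk through the dummy with fewest turns gives an optimal set of size `j + 1`
(`isSizeOptimal_of_bestWalk`).

Three facts carry this. Any set with one more element is bounded by the sum of single exchange gains
over a bijection that crosses no set in opposite directions (`exists_bijection_sizeValue_le`), so
potentials bound its value. Conversely, the gains along a walk add up exactly if no set is crossed
twice (`sizeValue_augment`). A double crossing is excluded because uncrossing it
(`swapGain_uncross`) would give a shortcut with the same value and fewer turns. The old splitting
rules out profitable closed walks among members, so `j + 1` rounds suffice and the best walk values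
form the new splitting.

The walks come from a Bellman–Ford table of `2 * (j + 1)` rows at quadratic cost each, and the arc
lengths cost `m² n` per augmentation. All `k` augmentations together take `O(k m³ + k m² n)` time,
which is within both claimed bounds, so one program serves both problems. -/

namespace DiverseCommittee

/-! ### Exchange gains and uncrossing in laminar families -/

section Exchange

variable {V ι : Type*} [DecidableEq V]

/-- A family of sets, indexed by `Λ`, any two of which are nested or disjoint. -/
def LaminarFamily (S : ι → Finset V) (Λ : Finset ι) : Prop :=
  ∀ x ∈ Λ, ∀ y ∈ Λ, Disjoint (S x) (S y) ∨ S x ⊆ S y ∨ S y ⊆ S x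

/-- The contribution of the set sizes to the objective. -/
def sizeValue (g : ι → ℤ → ℝ) (S : ι → Finset V) (Λ : Finset ι) (W : Finset V) : ℝ :=
  ∑ l ∈ Λ, g l ((W ∩ S l).card : ℤ)

/-- The gain at one set when `c` enters `W` and `d` leaves it. -/
def setGain (g : ι → ℤ → ℝ) (S : ι → Finset V) (W : Finset V) (d c : V) (l : ι) : ℝ :=
  if c ∈ S l then
    if d ∈ S l then 0 else g l ((W ∩ S l).card + 1) - g l ((W ∩ S l).card)
  else
    if d ∈ S l then g l ((W ∩ S l).card - 1) - g l ((W ∩ S l).card) else 0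

/-- The gain of the size contribution when `c` enters `W` and `d` leaves it. -/
def swapGain (g : ι → ℤ → ℝ) (S : ι → Finset V) (Λ : Finset ι) (W : Finset V) (d c : V) : ℝ :=
  ∑ l ∈ Λ, setGain g S W d c l

/-- Every function of the family has decreasing increments. -/
def DecreasingIncrements (g : ι → ℤ → ℝ) : Prop :=
  ∀ l, Antitone fun j : ℤ => g l (j + 1) - g l j

/-- Concavity puts the function below its tangent at `j`. Several entrances into one set thus gain
at most a multiple of what a single entrance gains. -/
theorem DecreasingIncrements.add_le {g : ι → ℤ → ℝ} (hg : DecreasingIncrements g) (l : ι)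
    (j : ℤ) (u : ℕ) : g l (j + u) ≤ g l j + u * (g l (j + 1) - g l j) := by
  induction u with
  | zero => simp
  | succ u ih =>
    have h := hg l (show j ≤ j + u by omega)
    simp only at h
    push_cast
    rw [← add_assoc]
    linarith

theorem DecreasingIncrements.sub_le {g : ι → ℤ → ℝ} (hg : DecreasingIncrements g) (l : ι)
    (j : ℤ) (u : ℕ) : g l (j - u) ≤ g l j + u * (g l (j - 1) - g l j) := by
  induction u with
  | zero => simp
  | succ u ih =>
    have h := hg l (show j - (u + 1) ≤ j - 1 by omega)
    simp only [sub_add_cancel] at h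
    rw [show j - ((u : ℤ) + 1) + 1 = j - u by ring] at h
    push_cast
    linarith

/-- If `S l` is disjoint from `S x` or contained in it, no pair crossing `S x` has both ends in `S
l`; if `S l` contains `S x`, none has both ends outside. Exchanging partners can therefore only make
an entrance cancel a departure, and by concavity the gains of these two have a sum of at most zero.
-/
theorem setGain_uncross {g : ι → ℤ → ℝ} (hg : DecreasingIncrements g) {S : ι → Finset V}
    {W : Finset V} {x l : ι} (hlam : Disjoint (S l) (S x) ∨ S l ⊆ S x ∨ S x ⊆ S l)
    {d c d' c' : V} (h : ¬ (d ∈ S x ↔ c ∈ S x)) (h' : ¬ (d' ∈ S x ↔ c' ∈ S x)) :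
    setGain g S W d c l + setGain g S W d' c' l ≤
      setGain g S W d c' l + setGain g S W d' c l := by
  have hc := hg l (show ((W ∩ S l).card : ℤ) - 1 ≤ (W ∩ S l).card by omega)
  simp only [sub_add_cancel] at hc
  unfold setGain
  rcases hlam with hl | hl | hl
  · have hl' : ∀ v, v ∈ S l → v ∉ S x := fun v hv hx => Finset.disjoint_left.1 hl hv hx
    have h1 := hl' d; have h2 := hl' c; have h3 := hl' d'; have h4 := hl' c'
    by_cases a1 : d ∈ S l <;> by_cases a2 : c ∈ S l <;> by_cases a3 : d' ∈ S l <;>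
      by_cases a4 : c' ∈ S l <;> simp only [a1, a2, a3, a4, if_true, if_false] <;>
      first | linarith | (exfalso; tauto)
  · have h1 := @hl d; have h2 := @hl c; have h3 := @hl d'; have h4 := @hl c'
    by_cases a1 : d ∈ S l <;> by_cases a2 : c ∈ S l <;> by_cases a3 : d' ∈ S l <;>
      by_cases a4 : c' ∈ S l <;> simp only [a1, a2, a3, a4, if_true, if_false] <;>
      first | linarith | (exfalso; tauto)
  · have h1 := @hl d; have h2 := @hl c; have h3 := @hl d'; have h4 := @hl c'
    by_cases a1 : d ∈ S l <;> by_cases a2 : c ∈ S l <;> by_cases a3 : d' ∈ S l <;>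
      by_cases a4 : c' ∈ S l <;> simp only [a1, a2, a3, a4, if_true, if_false] <;>
      first | linarith | (exfalso; tauto)

theorem swapGain_uncross {g : ι → ℤ → ℝ} (hg : DecreasingIncrements g) {S : ι → Finset V}
    {Λ : Finset ι} (hlam : LaminarFamily S Λ) {W : Finset V} {x : ι} (hx : x ∈ Λ)
    {d c d' c' : V} (h : ¬ (d ∈ S x ↔ c ∈ S x)) (h' : ¬ (d' ∈ S x ↔ c' ∈ S x)) :
    swapGain g S Λ W d c + swapGain g S Λ W d' c' ≤
      swapGain g S Λ W d c' + swapGain g S Λ W d' c := by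
  unfold swapGain
  rw [← Finset.sum_add_distrib, ← Finset.sum_add_distrib]
  exact Finset.sum_le_sum fun l hl => setGain_uncross hg (hlam l hl x hx) h h'

/-- Number of sets of the family that separate `d` from `c`. -/
def separation (S : ι → Finset V) (Λ : Finset ι) (d c : V) : ℕ :=
  ∑ l ∈ Λ, if (d ∈ S l ↔ c ∈ S l) then 0 else 1

/-- Laminarity keeps every other set from separating more pairs after the exchange of partners,
while `S x` separates both pairs before and neither after. -/
theorem separation_uncross {S : ι → Finset V} {Λ : Finset ι} (hlam : LaminarFamily S Λ) {x : ι}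
    (hx : x ∈ Λ) {d c d' c' : V} (hd : d ∈ S x) (hc : c ∉ S x) (hd' : d' ∉ S x)
    (hc' : c' ∈ S x) :
    separation S Λ d c' + separation S Λ d' c < separation S Λ d c + separation S Λ d' c' := by
  unfold separation
  rw [← Finset.sum_add_distrib, ← Finset.sum_add_distrib]
  apply Finset.sum_lt_sum
  · intro l hl
    rcases hlam l hl x hx with hl | hl | hl
    · have hl' : ∀ v, v ∈ S l → v ∉ S x := fun v hv hx => Finset.disjoint_left.1 hl hv hx
      have h1 := hl' d; have h4 := hl' c'
      by_cases a1 : d ∈ S l <;> by_cases a2 : c ∈ S l <;> by_cases a3 : d' ∈ S l <;>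
        by_cases a4 : c' ∈ S l <;> simp [a1, a2, a3, a4] <;> tauto
    · have h2 := @hl c; have h3 := @hl d'
      by_cases a1 : d ∈ S l <;> by_cases a2 : c ∈ S l <;> by_cases a3 : d' ∈ S l <;>
        by_cases a4 : c' ∈ S l <;> simp [a1, a2, a3, a4] <;> tauto
    · have h1 := hl hd; have h4 := hl hc'
      by_cases a2 : c ∈ S l <;> by_cases a3 : d' ∈ S l <;>
        simp [h1, a2, a3, h4]
  · exact ⟨x, hx, by simp [hd, hc, hd', hc']⟩

theorem sum_comp_swap {M : Type*} [AddCommMonoid M] {A : Finset V} {c c' : V} (hc : c ∈ A)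
    (hc' : c' ∈ A) (hne : c ≠ c') (σ : V → V) (f : V → V → M) :
    ∃ R, ∑ z ∈ A, f (σ z) z = f (σ c) c + f (σ c') c' + R ∧
      ∑ z ∈ A, f (σ (Equiv.swap c c' z)) z = f (σ c') c + f (σ c) c' + R := by
  have hc'e : c' ∈ A.erase c := Finset.mem_erase.2 ⟨hne.symm, hc'⟩
  refine ⟨∑ z ∈ (A.erase c).erase c', f (σ z) z, ?_, ?_⟩
  · rw [← Finset.add_sum_erase A _ hc, ← Finset.add_sum_erase _ _ hc'e, add_assoc]
  · rw [← Finset.add_sum_erase A _ hc, ← Finset.add_sum_erase _ _ hc'e, add_assoc]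
    simp only [Equiv.swap_apply_left, Equiv.swap_apply_right]
    congr 2
    refine Finset.sum_congr rfl fun z hz => ?_
    rw [Finset.mem_erase, Finset.mem_erase] at hz
    rw [Equiv.swap_apply_of_ne_of_ne hz.2.1 hz.1]

/-- A bijection between finite sets of the same size none of whose pairs cross a set of the
laminar family in opposite directions. -/
theorem exists_uncrossed_bijection {S : ι → Finset V} {Λ : Finset ι} (hlam : LaminarFamily S Λ)
    {A B : Finset V} (hAB : A.card = B.card) :
    ∃ σ : V → V, Set.BijOn σ A B ∧ ∀ x ∈ Λ, ∀ c ∈ A, ∀ c' ∈ A,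
      ¬ (σ c ∈ S x ∧ c ∉ S x ∧ σ c' ∉ S x ∧ c' ∈ S x) := by
  classical
  -- Among all bijections one of least total separation is chosen; an opposite crossing could be
  -- swapped away at a strict decrease.
  let P : Set ℕ := {N | ∃ σ : V → V, Set.BijOn σ A B ∧ ∑ z ∈ A, separation S Λ (σ z) z = N}
  have hne : P.Nonempty := by
    rcases A.eq_empty_or_nonempty with hA | ⟨a, ha⟩
    · subst hA
      have : B = ∅ := by simpa using hAB.symm
      subst this
      exact ⟨_, id, by simp, rfl⟩
    · have : Nonempty V := ⟨a⟩
      obtain ⟨f, hf⟩ := A.finite_toSet.exists_bijOn_of_encard_eq (t := (B : Set V))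
        (by simp [Set.encard_coe_eq_coe_finsetCard, hAB])
      exact ⟨_, f, hf, rfl⟩
  obtain ⟨σ, hσ, hN⟩ := Nat.sInf_mem hne
  refine ⟨σ, hσ, ?_⟩
  rintro x hx c hc c' hc' ⟨h1, h2, h3, h4⟩
  have hcc : c ≠ c' := by rintro rfl; exact h2 h4
  obtain ⟨R, hR, hR'⟩ := sum_comp_swap hc hc' hcc σ (separation S Λ)
  have hlt := separation_uncross hlam hx h1 h2 h3 h4
  have hsw : Set.BijOn (Equiv.swap c c') (A : Set V) A := by
    refine (Equiv.swap c c').bijOn fun z => ?_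
    by_cases h1 : z = c
    · subst h1; simp [hc, hc']
    · by_cases h2 : z = c'
      · subst h2; simp [hc, hc']
      · rw [Equiv.swap_apply_of_ne_of_ne h1 h2]
  have hle : sInf P ≤ ∑ z ∈ A, separation S Λ (σ (Equiv.swap c c' z)) z :=
    Nat.sInf_le ⟨fun z => σ (Equiv.swap c c' z), hσ.comp hsw, rfl⟩
  omega

/-- The pairs of a bijection that never cross a set in opposite directions account for the
change of the size contribution. -/
theorem exists_bijection_sizeValue_le {g : ι → ℤ → ℝ} (hg : DecreasingIncrements g)
    {S : ι → Finset V} {Λ : Finset ι} (hlam : LaminarFamily S Λ) {b : V} (hb : ∀ l, b ∉ S l)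
    {W W' : Finset V} (hbW : b ∉ W) (hcard : W'.card = W.card + 1) :
    ∃ σ : V → V, Set.BijOn σ (W' \ W : Finset V) (insert b (W \ W') : Finset V) ∧
      sizeValue g S Λ W' ≤ sizeValue g S Λ W + ∑ c ∈ W' \ W, swapGain g S Λ W (σ c) c := by
  -- The dummy `b` stands in for the missing departure, as `W'` is larger by one.
  have hAB : (W' \ W).card = (insert b (W \ W')).card := by
    rw [Finset.card_insert_of_notMem (by simp [hbW])]
    have h1 := Finset.card_sdiff_add_card_inter W' W
    have h2 := Finset.card_sdiff_add_card_inter W W'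
    rw [Finset.inter_comm] at h2
    omega
  obtain ⟨σ, hσ, hun⟩ := exists_uncrossed_bijection hlam hAB
  refine ⟨σ, hσ, ?_⟩
  unfold sizeValue swapGain
  rw [Finset.sum_comm, ← Finset.sum_add_distrib]
  refine Finset.sum_le_sum fun l hl => ?_
  set A := W' \ W with hA
  set j : ℤ := ((W ∩ S l).card : ℤ) with hj
  set E := A.filter fun c => c ∈ S l ∧ σ c ∉ S l with hE
  set D := A.filter fun c => c ∉ S l ∧ σ c ∈ S l with hD
  have hsum : ∑ c ∈ A, setGain g S W (σ c) c l =
      E.card * (g l (j + 1) - g l j) + D.card * (g l (j - 1) - g l j) := by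
    rw [← nsmul_eq_mul, ← nsmul_eq_mul, ← Finset.sum_const, ← Finset.sum_const, hE, hD,
      Finset.sum_filter, Finset.sum_filter, ← Finset.sum_add_distrib]
    refine Finset.sum_congr rfl fun c _ => ?_
    unfold setGain
    by_cases h1 : c ∈ S l <;> by_cases h2 : σ c ∈ S l <;> simp [h1, h2, hj]
  -- `E` collects the pairs that enter `S l` and `D` those that leave it. The dummy lies in no set,
  -- so it does not disturb the count.
  have hcnt : ((W' ∩ S l).card : ℤ) = j + E.card - D.card := by
    have h1 : (W' ∩ S l).card = (A ∩ S l).card + (W' ∩ W ∩ S l).card := by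
      rw [hA, ← Finset.card_union_of_disjoint]
      · congr 1; ext v; simp; tauto
      · rw [Finset.disjoint_left]; intro v; simp; tauto
    have h2 : (W ∩ S l).card = ((W \ W') ∩ S l).card + (W' ∩ W ∩ S l).card := by
      rw [← Finset.card_union_of_disjoint]
      · congr 1; ext v; simp; tauto
      · rw [Finset.disjoint_left]; intro v; simp; tauto
    have h3 : ((W \ W') ∩ S l).card = (A.filter fun c => σ c ∈ S l).card := by
      symm
      refine Finset.card_bij (fun c _ => σ c) ?_ ?_ ?_
      · intro c hc
        rw [Finset.mem_filter] at hc
        have := hσ.mapsTo hc.1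
        rw [Finset.mem_coe, Finset.mem_insert] at this
        rw [Finset.mem_inter]
        refine ⟨this.resolve_left ?_, hc.2⟩
        intro h; exact hb l (h ▸ hc.2)
      · intro c hc c' hc' h
        exact hσ.injOn (Finset.mem_filter.1 hc).1 (Finset.mem_filter.1 hc').1 h
      · intro v hv
        rw [Finset.mem_inter] at hv
        obtain ⟨c, hc, rfl⟩ := hσ.surjOn (Finset.mem_coe.2 (Finset.mem_insert_of_mem hv.1))
        exact ⟨c, Finset.mem_filter.2 ⟨hc, hv.2⟩, rfl⟩
    have h4 : (A ∩ S l).card = E.card + (A.filter fun c => c ∈ S l ∧ σ c ∈ S l).card := by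
      rw [hE, ← Finset.card_union_of_disjoint]
      · congr 1; ext v; simp; tauto
      · rw [Finset.disjoint_left]; intro v; simp; tauto
    have h5 : (A.filter fun c => σ c ∈ S l).card =
        D.card + (A.filter fun c => c ∈ S l ∧ σ c ∈ S l).card := by
      rw [hD, ← Finset.card_union_of_disjoint]
      · congr 1; ext v; simp; tauto
      · rw [Finset.disjoint_left]; intro v; simp; tauto
    omega
  rw [hsum, hcnt]
  -- Without opposite crossings one of the counts vanishes, so the change is one-sided and a tangent
  -- bound applies.
  have hor : E.card = 0 ∨ D.card = 0 := by
    by_contra! hcon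
    obtain ⟨c', hc'⟩ := Finset.card_pos.1 (Nat.pos_of_ne_zero hcon.1)
    obtain ⟨c, hc⟩ := Finset.card_pos.1 (Nat.pos_of_ne_zero hcon.2)
    rw [hE, Finset.mem_filter] at hc'
    rw [hD, Finset.mem_filter] at hc
    exact hun l hl c hc.1 c' hc'.1 ⟨hc.2.2, hc.2.1, hc'.2.2, hc'.2.1⟩
  rcases hor with h | h
  · rw [h]
    have := hg.sub_le l j D.card
    simpa using this
  · rw [h]
    have := hg.add_le l j E.card
    simpa using this

/-! ### Optimal sets, potentials and augmentation -/

/-- `W` has the largest value of size contribution plus weight `p` among the subsets of `U` of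
its size. -/
def IsSizeOptimal (g : ι → ℤ → ℝ) (S : ι → Finset V) (Λ : Finset ι) (U : Finset V) (p : V → ℝ)
    (W : Finset V) : Prop :=
  W ⊆ U ∧ ∀ W' ⊆ U, W'.card = W.card →
    sizeValue g S Λ W' + ∑ v ∈ W', p v ≤ sizeValue g S Λ W + ∑ v ∈ W, p v

theorem sizeValue_exchange {g : ι → ℤ → ℝ} {S : ι → Finset V} {Λ : Finset ι} {W : Finset V}
    {d c : V} (hd : d ∈ W) (hc : c ∉ W) :
    sizeValue g S Λ (insert c (W.erase d)) = sizeValue g S Λ W + swapGain g S Λ W d c := by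
  unfold sizeValue swapGain
  rw [← Finset.sum_add_distrib]
  refine Finset.sum_congr rfl fun l _ => ?_
  unfold setGain
  have h1 : (insert c (W.erase d) ∩ S l).card =
      ((W ∩ S l).erase d).card + if c ∈ S l then 1 else 0 := by
    split_ifs with h
    · rw [Finset.insert_inter_of_mem h, Finset.card_insert_of_notMem (by simp [hc]),
        Finset.erase_inter]
    · rw [Finset.insert_inter_of_notMem h, Finset.erase_inter, add_zero]
  by_cases h2 : d ∈ S l
  · have h3 : ((W ∩ S l).erase d).card + 1 = (W ∩ S l).card :=
      Finset.card_erase_add_one (Finset.mem_inter.2 ⟨hd, h2⟩)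
    have h4 : (((W ∩ S l).erase d).card : ℤ) = (W ∩ S l).card - 1 := by omega
    rw [h1]
    by_cases h5 : c ∈ S l <;> simp [h2, h5, h4]
  · have h3 : (W ∩ S l).erase d = W ∩ S l := Finset.erase_eq_of_notMem (by simp [h2])
    rw [h1, h3]
    by_cases h5 : c ∈ S l <;> simp [h2, h5]

/-- A single exchange yields a competitor of the same size, so the weights of an optimal set act as
potentials for the exchange gains. -/
theorem IsSizeOptimal.swapGain_le {g : ι → ℤ → ℝ} {S : ι → Finset V} {Λ : Finset ι}
    {U : Finset V} {p : V → ℝ} {W : Finset V} (h : IsSizeOptimal g S Λ U p W) {d c : V}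
    (hd : d ∈ W) (hc : c ∈ U \ W) : swapGain g S Λ W d c ≤ p d - p c := by
  rw [Finset.mem_sdiff] at hc
  have hce : c ∉ W.erase d := fun h => hc.2 (Finset.mem_of_mem_erase h)
  have h1 := h.2 (insert c (W.erase d)) (Finset.insert_subset hc.1
    ((Finset.erase_subset _ _).trans h.1))
    (by rw [Finset.card_insert_of_notMem hce, Finset.card_erase_add_one hd])
  rw [sizeValue_exchange hd hc.2, Finset.sum_insert hce] at h1
  have h2 := Finset.add_sum_erase W p hd
  linarith

/-- Potentials bound the value of every set with one more element. -/
theorem sizeValue_le_of_potential {g : ι → ℤ → ℝ} (hg : DecreasingIncrements g)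
    {S : ι → Finset V} {Λ : Finset ι} (hlam : LaminarFamily S Λ) {b : V} (hb : ∀ l, b ∉ S l)
    {U W : Finset V} (hbW : b ∉ W) {p : V → ℝ}
    (hp : ∀ d ∈ insert b W, ∀ c ∈ U \ W, swapGain g S Λ W d c ≤ p d - p c)
    {W' : Finset V} (hW' : W' ⊆ U) (hcard : W'.card = W.card + 1) :
    sizeValue g S Λ W' + ∑ v ∈ W', p v ≤ sizeValue g S Λ W + ∑ v ∈ W, p v + p b := by
  obtain ⟨σ, hσ, hle⟩ := exists_bijection_sizeValue_le hg hlam hb hbW hcard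
  have h1 : ∑ c ∈ W' \ W, swapGain g S Λ W (σ c) c ≤ ∑ c ∈ W' \ W, (p (σ c) - p c) := by
    refine Finset.sum_le_sum fun c hc => hp _ ?_ _ ?_
    · have := hσ.mapsTo hc
      rw [Finset.mem_coe] at this
      exact Finset.insert_subset_insert b Finset.sdiff_subset this
    · rw [Finset.mem_sdiff] at hc ⊢
      exact ⟨hW' hc.1, hc.2⟩
  -- Over a bijection the potential differences depend only on the two sets and on the term `p b` of
  -- the dummy.
  have h2 : ∑ c ∈ W' \ W, p (σ c) = ∑ d ∈ insert b (W \ W'), p d := by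
    refine Finset.sum_nbij σ (fun c hc => hσ.mapsTo hc) hσ.injOn hσ.surjOn fun _ _ => rfl
  rw [Finset.sum_sub_distrib, h2, Finset.sum_insert (by simp [hbW])] at h1
  have h3 := Finset.sum_sdiff_sub_sum_sdiff (s₁ := W) (s₂ := W') (f := p)
  linarith

/-- The effect of replacing the elements `d i` by the elements `c i` if every set of the family
is crossed at most once by the pairs `(e i, c i)`. -/
theorem sizeValue_augment {g : ι → ℤ → ℝ} {S : ι → Finset V} {Λ : Finset ι} {b : V}
    (hb : ∀ l, b ∉ S l) {W W' : Finset V} {r : ℕ} {c d e : ℕ → V}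
    (hW' : W' = (W \ (Finset.range r).image d) ∪ (Finset.range (r + 1)).image c)
    (hc : ∀ i ≤ r, c i ∉ W) (hd : ∀ i < r, d i ∈ W)
    (hci : Set.InjOn c (Finset.range (r + 1))) (hdi : Set.InjOn d (Finset.range r))
    (he : ∀ f : V → ℝ, ∑ i ∈ Finset.range (r + 1), f (e i) =
      f b + ∑ i ∈ Finset.range r, f (d i))
    (hun : ∀ x ∈ Λ, ∀ i l, i < l → l ≤ r → (e i ∈ S x ↔ c i ∈ S x) ∨ (e l ∈ S x ↔ c l ∈ S x)) :
    sizeValue g S Λ W' = sizeValue g S Λ W +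
      ∑ i ∈ Finset.range (r + 1), swapGain g S Λ W (e i) (c i) := by
  unfold sizeValue swapGain
  rw [Finset.sum_comm, ← Finset.sum_add_distrib]
  refine Finset.sum_congr rfl fun l hl => ?_
  have hsub : (Finset.range r).image d ⊆ W := by
    intro v hv
    obtain ⟨i, hi, rfl⟩ := Finset.mem_image.1 hv
    exact hd i (Finset.mem_range.1 hi)
  have hdis : Disjoint (W \ (Finset.range r).image d) ((Finset.range (r + 1)).image c) := by
    rw [Finset.disjoint_left]
    intro v hv hv'
    obtain ⟨i, hi, rfl⟩ := Finset.mem_image.1 hv'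
    exact hc i (Nat.lt_succ_iff.1 (Finset.mem_range.1 hi)) (Finset.mem_sdiff.1 hv).1
  let f : V → ℝ := fun v => if v ∈ S l then 1 else 0
  have hcard : ∀ X : Finset V, ((X ∩ S l).card : ℝ) = ∑ v ∈ X, f v := by
    intro X; simp [f, Finset.sum_ite_mem]
  have hcnt : ((W' ∩ S l).card : ℝ) = (W ∩ S l).card +
      ∑ i ∈ Finset.range (r + 1), (f (c i) - f (e i)) := by
    rw [hcard, hcard, Finset.sum_sub_distrib, he f, hW',
      Finset.sum_union hdis, Finset.sum_image hci]
    have := Finset.sum_sdiff (f := f) hsub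
    have hfb : f b = 0 := by simp [f, hb]
    rw [Finset.sum_image hdi] at this
    linarith
  -- At most one pair crosses `S l`, so the count moves by at most one and the gain computed at `W`
  -- is exact, not merely an estimate.
  by_cases hx : ∃ i ≤ r, ¬ (e i ∈ S l ↔ c i ∈ S l)
  · obtain ⟨i, hi, hne⟩ := hx
    have hother : ∀ z ∈ Finset.range (r + 1), z ≠ i → (e z ∈ S l ↔ c z ∈ S l) := by
      intro z hz hzi
      rw [Finset.mem_range] at hz
      rcases lt_or_gt_of_ne hzi with h | h
      · exact (hun l hl z i h hi).resolve_right hne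
      · exact (hun l hl i z h (by omega)).resolve_left hne
    have hir : i ∈ Finset.range (r + 1) := Finset.mem_range.2 (by omega)
    rw [Finset.sum_eq_single_of_mem i hir] at hcnt ⊢
    · unfold setGain
      by_cases h1 : c i ∈ S l <;> by_cases h2 : e i ∈ S l
      · exact absurd (iff_of_true h2 h1) hne
      · simp only [f, h1, h2, if_true, if_false] at hcnt ⊢
        have : ((W' ∩ S l).card : ℤ) = (W ∩ S l).card + 1 := by
          have : ((W' ∩ S l).card : ℝ) = (W ∩ S l).card + 1 := by linarith
          exact_mod_cast this
        rw [this]; ring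
      · simp only [f, h1, h2, if_true, if_false] at hcnt ⊢
        have : ((W' ∩ S l).card : ℤ) = (W ∩ S l).card - 1 := by
          have : ((W' ∩ S l).card : ℝ) + 1 = (W ∩ S l).card := by linarith
          have h3 : (W' ∩ S l).card + 1 = (W ∩ S l).card := by exact_mod_cast this
          omega
        rw [this]; ring
      · exact absurd (iff_of_false h2 h1) hne
    · intro z hz hzi
      have := hother z hz hzi
      unfold setGain
      by_cases h1 : c z ∈ S l <;> simp [this, h1]
    · intro z hz hzi
      have := hother z hz hzi
      simp [f, this]
  · push Not at hx
    rw [Finset.sum_eq_zero] at hcnt ⊢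
    · have : (W' ∩ S l).card = (W ∩ S l).card := by
        rw [add_zero] at hcnt; exact_mod_cast hcnt
      rw [this, add_zero]
    · intro z hz
      have := hx z (by rw [Finset.mem_range] at hz; omega)
      unfold setGain
      by_cases h1 : c z ∈ S l <;> simp [this, h1]
    · intro z hz
      have := hx z (by rw [Finset.mem_range] at hz; omega)
      simp [f, this]

/-- Augmenting along tight pairs that do not cross a set twice gives an optimal set again. -/
theorem isSizeOptimal_augment {g : ι → ℤ → ℝ} (hg : DecreasingIncrements g)
    {S : ι → Finset V} {Λ : Finset ι} (hlam : LaminarFamily S Λ) {b : V} (hb : ∀ l, b ∉ S l)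
    {U W W' : Finset V} (hbW : b ∉ W) (hWU : W ⊆ U) {p : V → ℝ}
    (hp : ∀ d ∈ insert b W, ∀ c ∈ U \ W, swapGain g S Λ W d c ≤ p d - p c)
    {r : ℕ} {c d e : ℕ → V}
    (hW' : W' = (W \ (Finset.range r).image d) ∪ (Finset.range (r + 1)).image c)
    (hc : ∀ i ≤ r, c i ∈ U \ W) (hd : ∀ i < r, d i ∈ W)
    (hci : Set.InjOn c (Finset.range (r + 1))) (hdi : Set.InjOn d (Finset.range r))
    (he : ∀ f : V → ℝ, ∑ i ∈ Finset.range (r + 1), f (e i) =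
      f b + ∑ i ∈ Finset.range r, f (d i))
    (htight : ∀ i ≤ r, swapGain g S Λ W (e i) (c i) = p (e i) - p (c i))
    (hun : ∀ x ∈ Λ, ∀ i l, i < l → l ≤ r → (e i ∈ S x ↔ c i ∈ S x) ∨ (e l ∈ S x ↔ c l ∈ S x))
    (hcard : W'.card = W.card + 1) :
    IsSizeOptimal g S Λ U p W' := by
  have hcW : ∀ i ≤ r, c i ∉ W := fun i hi => (Finset.mem_sdiff.1 (hc i hi)).2
  have hsub : (Finset.range r).image d ⊆ W := by
    intro v hv
    obtain ⟨i, hi, rfl⟩ := Finset.mem_image.1 hv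
    exact hd i (Finset.mem_range.1 hi)
  have hdis : Disjoint (W \ (Finset.range r).image d) ((Finset.range (r + 1)).image c) := by
    rw [Finset.disjoint_left]
    intro v hv hv'
    obtain ⟨i, hi, rfl⟩ := Finset.mem_image.1 hv'
    exact hcW i (Nat.lt_succ_iff.1 (Finset.mem_range.1 hi)) (Finset.mem_sdiff.1 hv).1
  refine ⟨?_, fun W'' hW'' hcard'' => ?_⟩
  · rw [hW']
    refine Finset.union_subset (Finset.sdiff_subset.trans hWU) fun v hv => ?_
    obtain ⟨i, hi, rfl⟩ := Finset.mem_image.1 hv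
    exact (Finset.mem_sdiff.1 (hc i (Nat.lt_succ_iff.1 (Finset.mem_range.1 hi)))).1
  · have h1 := sizeValue_le_of_potential hg hlam hb hbW hp hW'' (hcard''.trans hcard)
    have h2 := sizeValue_augment (g := g) hb hW' hcW hd hci hdi he hun
    rw [Finset.sum_congr rfl fun i hi => htight i (Nat.lt_succ_iff.1 (Finset.mem_range.1 hi)),
      Finset.sum_sub_distrib, he p] at h2
    have h3 : ∑ v ∈ W', p v = ∑ v ∈ W \ (Finset.range r).image d, p v +
        ∑ i ∈ Finset.range (r + 1), p (c i) := by
      rw [hW', Finset.sum_union hdis, Finset.sum_image hci]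
    have h4 := Finset.sum_sdiff (f := p) hsub
    rw [Finset.sum_image hdi] at h4
    linarith

/-! ### Tables of best alternating walks -/

/-- The values of best alternating walks, by number of turns: `D i c` for walks from `b` that end
with the entrance of `c`, and `E i d` for those that end with the departure of `d`; `a₁` and `a₂`
are the gains of exchanges and `w` the weights. -/
structure IsWalkTable (a₁ a₂ : V → V → ℝ) (w : V → ℝ) (b : V) (W X : Finset V) (j : ℕ)
    (D E : ℕ → V → ℝ) : Prop where
  start : ∀ c ∈ X, D 0 c = a₁ b c
  leave_ge : ∀ i ≤ j, ∀ d ∈ insert b W, ∀ c ∈ X, D i c + w c + a₂ d c ≤ E i d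
  leave_eq : ∀ i ≤ j, ∀ d ∈ insert b W, ∃ c ∈ X, E i d = D i c + w c + a₂ d c
  enter_ge : ∀ i < j, ∀ c ∈ X, ∀ d ∈ W, E i d - w d + a₁ d c ≤ D (i + 1) c
  enter_eq : ∀ i < j, ∀ c ∈ X, ∃ d ∈ W, D (i + 1) c = E i d - w d + a₁ d c

/-- A walk realizing the value `E r (d r)`. -/
structure IsBestWalk (a₁ a₂ : V → V → ℝ) (w : V → ℝ) (W X : Finset V) (D E : ℕ → V → ℝ)
    (r : ℕ) (c d : ℕ → V) : Prop where
  mem_enter : ∀ i ≤ r, c i ∈ X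
  mem_leave : ∀ i < r, d i ∈ W
  leave_eq : ∀ i ≤ r, E i (d i) = D i (c i) + w (c i) + a₂ (d i) (c i)
  enter_eq : ∀ i < r, D (i + 1) (c (i + 1)) = E i (d i) - w (d i) + a₁ (d i) (c (i + 1))

variable {a₁ a₂ : V → V → ℝ} {w : V → ℝ} {b : V} {W X : Finset V} {j : ℕ} {D E : ℕ → V → ℝ}

/-- Each table value is attained through the preceding round. The walk is traced back from its end,
and the last turn is appended to the walk found for the earlier rounds. -/
theorem IsWalkTable.exists_walk (h : IsWalkTable a₁ a₂ w b W X j D E) {r : ℕ} (hr : r ≤ j)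
    {v : V} (hv : v ∈ insert b W) : ∃ c d, d r = v ∧ IsBestWalk a₁ a₂ w W X D E r c d := by
  induction r generalizing v with
  | zero =>
    obtain ⟨c, hc, he⟩ := h.leave_eq 0 hr v hv
    refine ⟨fun _ => c, fun _ => v, rfl, fun _ _ => hc, fun i hi => by omega, fun i hi => ?_,
      fun i hi => by omega⟩
    obtain rfl : i = 0 := by omega
    exact he
  | succ r ih =>
    obtain ⟨z, hz, he⟩ := h.leave_eq (r + 1) hr v hv
    obtain ⟨u, hu, he'⟩ := h.enter_eq r (by omega) z hz
    obtain ⟨c, d, hd, hw⟩ := ih (by omega) (Finset.mem_insert_of_mem hu)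
    refine ⟨fun i => if i ≤ r then c i else z, fun i => if i ≤ r then d i else v, by simp,
      ⟨fun i hi => ?_, fun i hi => ?_, fun i hi => ?_, fun i hi => ?_⟩⟩
    · by_cases h1 : i ≤ r
      · simpa [h1] using hw.mem_enter i h1
      · simpa [h1] using hz
    · by_cases h1 : i < r
      · simpa [h1.le] using hw.mem_leave i h1
      · obtain rfl : i = r := by omega
        simpa [hd] using hu
    · by_cases h1 : i ≤ r
      · simpa [h1] using hw.leave_eq i h1
      · obtain rfl : i = r + 1 := by omega
        simpa [h1] using he
    · by_cases h1 : i < r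
      · simpa [h1, h1.le, Nat.succ_le_of_lt h1] using hw.enter_eq i h1
      · obtain rfl : i = r := by omega
        simpa [hd] using he'

/-- If potentials exclude profitable closed walks, the last round adds nothing new. -/
theorem IsWalkTable.exists_earlier (h : IsWalkTable a₁ a₂ w b W X j D E) (hj : W.card = j)
    {q₁ q₂ : V → ℝ} (hqX : ∀ v ∈ X, q₁ v + q₂ v = w v) (hqW : ∀ v ∈ W, q₁ v + q₂ v = w v)
    (h₁ : ∀ d ∈ W, ∀ c ∈ X, a₁ d c ≤ q₁ d - q₁ c) (h₂ : ∀ d ∈ W, ∀ c ∈ X, a₂ d c ≤ q₂ d - q₂ c)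
    {v : V} (hv : v ∈ W) : ∃ i < j, E j v ≤ E i v := by
  obtain ⟨c, d, hd, hw⟩ := h.exists_walk le_rfl (Finset.mem_insert_of_mem hv)
  have hdW : ∀ i ≤ j, d i ∈ W := by
    intro i hi
    rcases hi.lt_or_eq with hi | rfl
    · exact hw.mem_leave i hi
    · rwa [hd]
  -- The old splitting is a potential: corrected by `q₂`, the values along the walk cannot increase.
  have hstep : ∀ i < j, E (i + 1) (d (i + 1)) - q₂ (d (i + 1)) ≤ E i (d i) - q₂ (d i) := by
    intro i hi
    have e1 := hw.leave_eq (i + 1) hi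
    have e2 := hw.enter_eq i hi
    have e3 := h₁ _ (hdW i hi.le) _ (hw.mem_enter (i + 1) hi)
    have e4 := h₂ _ (hdW (i + 1) hi) _ (hw.mem_enter (i + 1) hi)
    have e5 := hqX _ (hw.mem_enter (i + 1) hi)
    have e6 := hqW _ (hdW i hi.le)
    linarith
  have hmono : ∀ i s, i + s ≤ j → E (i + s) (d (i + s)) - q₂ (d (i + s)) ≤ E i (d i) - q₂ (d i) := by
    intro i s
    induction s with
    | zero => simp
    | succ s ih => intro hs; exact (hstep (i + s) (by omega)).trans (ih (by omega))
  -- The `j + 1` departures lie in a set of `j` elements, so one repeats, and the closed piece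
  -- between the two visits is worth nothing.
  obtain ⟨x, hx, y, hy, hxy, hdxy⟩ := Finset.exists_ne_map_eq_of_card_lt_of_maps_to
    (s := Finset.range (j + 1)) (t := W) (f := d) (by simp [hj])
    (fun i hi => hdW i (Nat.lt_succ_iff.1 (Finset.mem_range.1 hi)))
  rw [Finset.mem_range] at hx hy
  wlog hlt : x < y generalizing x y
  · exact this y hy x hx hxy.symm hdxy.symm (by omega)
  -- Following the rest of the walk from the earlier visit gives values at least as large, `y - x`
  -- rounds sooner.
  have hup : ∀ s, y + s ≤ j → E (y + s) (d (y + s)) ≤ E (x + s) (d (y + s)) := by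
    intro s
    induction s with
    | zero =>
      intro _
      have := hmono x (y - x) (by omega)
      rw [Nat.add_sub_cancel' hlt.le, hdxy] at this
      simpa using this
    | succ s ih =>
      intro hs
      have e0 := ih (by omega)
      have e1 := hw.leave_eq (y + s + 1) (by omega)
      have e2 := hw.enter_eq (y + s) (by omega)
      have e3 := h.enter_ge (x + s) (by omega) _ (hw.mem_enter (y + s + 1) (by omega)) _
        (hdW (y + s) (by omega))
      have e4 := h.leave_ge (x + s + 1) (by omega) _
        (Finset.mem_insert_of_mem (hdW (y + s + 1) (by omega))) _
        (hw.mem_enter (y + s + 1) (by omega))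
      simp only [← add_assoc]
      linarith
  refine ⟨x + (j - y), by omega, ?_⟩
  have := hup (j - y) (by omega)
  rwa [Nat.add_sub_cancel' (by omega), hd] at this

theorem exists_max_upto {V : Type*} (f : ℕ → V → ℝ) (j : ℕ) :
    ∃ F : V → ℝ, ∀ v, (∀ i ≤ j, f i v ≤ F v) ∧ ∃ i ≤ j, F v = f i v := by
  have : ∀ v, ∃ i ≤ j, ∀ i' ≤ j, f i' v ≤ f i v := by
    intro v
    obtain ⟨i, hi, hmax⟩ := Finset.exists_max_image (Finset.range (j + 1)) (fun i => f i v)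
      ⟨0, by simp⟩
    exact ⟨i, by simpa [Nat.lt_succ_iff] using hi,
      fun i' hi' => hmax i' (by simpa [Nat.lt_succ_iff] using hi')⟩
  choose i hi hmax using this
  exact ⟨fun v => f (i v) v, fun v => ⟨hmax v, i v, hi v, rfl⟩⟩

end Exchange
-- Augmentation along a best walk with fewest turns
section Exchange

variable {V ι : Type*} [DecidableEq V]

/-- Augmenting an optimal set along a shortest best walk gives an optimal set. -/
theorem isSizeOptimal_of_bestWalk {g : ι → ℤ → ℝ} (hg : DecreasingIncrements g)
    {S : ι → Finset V} {Λ₁ Λ₂ : Finset ι} (hlam₁ : LaminarFamily S Λ₁)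
    (hlam₂ : LaminarFamily S Λ₂) {b : V} (hb : ∀ l, b ∉ S l) {U W : Finset V} (hbU : b ∉ U)
    {w q₁ q₂ : V → ℝ} (hq : ∀ v ∈ U, q₁ v + q₂ v = w v)
    (h₁ : IsSizeOptimal g S Λ₁ U q₁ W) (h₂ : IsSizeOptimal g S Λ₂ U q₂ W)
    {j : ℕ} (hj : W.card = j) {D E : ℕ → V → ℝ}
    (ht : IsWalkTable (swapGain g S Λ₁ W) (swapGain g S Λ₂ W) w b W (U \ W) j D E)
    {r : ℕ} (hr : r ≤ j) (hmax : ∀ i ≤ j, E i b ≤ E r b) (hfirst : ∀ i < r, E i b < E r b)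
    {c d : ℕ → V} (hdr : d r = b)
    (hw : IsBestWalk (swapGain g S Λ₁ W) (swapGain g S Λ₂ W) w W (U \ W) D E r c d)
    {W' : Finset V}
    (hW' : W' = (W \ (Finset.range r).image d) ∪ (Finset.range (r + 1)).image c) :
    W'.card = j + 1 ∧ ∃ p₁ p₂ : V → ℝ, (∀ v ∈ U, p₁ v + p₂ v = w v) ∧
      IsSizeOptimal g S Λ₁ U p₁ W' ∧ IsSizeOptimal g S Λ₂ U p₂ W' := by
  have hWU := h₁.1
  have hbW : b ∉ W := fun h => hbU (hWU h)
  set a₁ := swapGain g S Λ₁ W with ha₁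
  set a₂ := swapGain g S Λ₂ W with ha₂
  obtain ⟨DD, hDD⟩ := exists_max_upto D j
  obtain ⟨EE, hEE⟩ := exists_max_upto E j
  have hpot0 : ∀ c ∈ U \ W, a₁ b c ≤ DD c := fun c hc => by
    rw [← ht.start c hc]; exact (hDD c).1 0 (Nat.zero_le _)
  -- A maximum attained in the last round has no next row to compare with; an earlier round reaching
  -- at least the same value takes its place.
  have hpot1 : ∀ d ∈ W, ∀ c ∈ U \ W, EE d - w d + a₁ d c ≤ DD c := by
    intro d hd c hc
    obtain ⟨i, hi, he⟩ := (hEE d).2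
    have : ∃ i' < j, EE d ≤ E i' d := by
      rcases hi.lt_or_eq with hi | rfl
      · exact ⟨i, hi, he.le⟩
      · rw [he]
        exact ht.exists_earlier hj (fun v hv => hq v (Finset.mem_sdiff.1 hv).1)
          (fun v hv => hq v (hWU hv)) (fun d hd c hc => h₁.swapGain_le hd hc)
          (fun d hd c hc => h₂.swapGain_le hd hc) hd
    obtain ⟨i', hi', he'⟩ := this
    have e1 := ht.enter_ge i' hi' c hc d hd
    have e2 := (hDD c).1 (i' + 1) hi'
    linarith
  have hpot2 : ∀ d ∈ insert b W, ∀ c ∈ U \ W, DD c + w c + a₂ d c ≤ EE d := by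
    intro d hd c hc
    obtain ⟨i, hi, he⟩ := (hDD c).2
    rw [he]
    exact (ht.leave_ge i hi d hd c hc).trans ((hEE d).1 i hi)
  have hEb : EE b = E r b := by
    obtain ⟨i, hi, he⟩ := (hEE b).2
    exact le_antisymm (he ▸ hmax i hi) ((hEE b).1 r hr)
  have hdins : ∀ i ≤ r, d i ∈ insert b W := by
    intro i hi
    rcases hi.lt_or_eq with hi | rfl
    · exact Finset.mem_insert_of_mem (hw.mem_leave i hi)
    · simp [hdr]
  -- the walk attains the potentials, and at no earlier round
  have htightE : ∀ s ≤ r, EE (d (r - s)) = E (r - s) (d (r - s)) ∧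
      ∀ i < r - s, E i (d (r - s)) < EE (d (r - s)) := by
    intro s
    induction s with
    | zero =>
      intro _
      simp only [Nat.sub_zero, hdr]
      exact ⟨hEb, fun i hi => hEb ▸ hfirst i hi⟩
    | succ s ih =>
      intro hs
      obtain ⟨e1, e2⟩ := ih (by omega)
      obtain ⟨i, hi⟩ : ∃ i, r - s = i + 1 := ⟨r - s - 1, by omega⟩
      rw [hi] at e1 e2
      rw [show r - (s + 1) = i by omega]
      have hcX := hw.mem_enter (i + 1) (by omega)
      have f1 := hw.leave_eq (i + 1) (by omega)
      have f2 := hw.enter_eq i (by omega)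
      have f3 := hpot2 _ (hdins (i + 1) (by omega)) _ hcX
      have f4 := hpot1 _ (hw.mem_leave i (by omega)) _ hcX
      have f5 := (hDD (c (i + 1))).1 (i + 1) (by omega)
      have f6 := (hEE (d i)).1 i (by omega)
      refine ⟨by linarith, fun i' hi' => ?_⟩
      -- A tie at `d i` in an earlier round would move on along the walk to an earlier tie at `d (i
      -- + 1)`.
      by_contra hcon
      have f7 := ht.enter_ge i' (by omega) _ hcX _ (hw.mem_leave i (by omega))
      have f8 := ht.leave_ge (i' + 1) (by omega) _ (hdins (i + 1) (by omega)) _ hcX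
      have f9 := e2 (i' + 1) (by omega)
      linarith
  have hE : ∀ i ≤ r, EE (d i) = E i (d i) ∧ ∀ i' < i, E i' (d i) < EE (d i) := by
    intro i hi
    have := htightE (r - i) (by omega)
    rwa [show r - (r - i) = i by omega] at this
  have hD : ∀ i ≤ r, DD (c i) = D i (c i) ∧ ∀ i' < i, D i' (c i) < DD (c i) := by
    intro i hi
    have hcX := hw.mem_enter i hi
    have f1 := hw.leave_eq i hi
    have f3 := hpot2 _ (hdins i hi) _ hcX
    have f5 := (hDD (c i)).1 i (by omega)
    have f6 := (hE i hi).1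
    have f7 : DD (c i) = D i (c i) := by linarith
    refine ⟨f7, fun i' hi' => ?_⟩
    have f8 := ht.leave_ge i' (by omega) _ (hdins i hi) _ hcX
    have f9 := (hE i hi).2 i' hi'
    linarith
  -- Different positions of the walk attain their maxima for the first time in different rounds, so
  -- no candidate occurs twice.
  have hci : Set.InjOn c (Finset.range (r + 1)) := by
    intro x hx y hy hxy
    rw [Finset.mem_coe, Finset.mem_range] at hx hy
    by_contra hne
    rcases lt_or_gt_of_ne hne with h | h
    · have f1 := (hD y (by omega)).2 x h
      have f2 := (hD x (by omega)).1
      rw [← hxy] at f1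
      linarith
    · have f1 := (hD x (by omega)).2 y h
      have f2 := (hD y (by omega)).1
      rw [hxy] at f1
      linarith
  have hdi : Set.InjOn d (Finset.range r) := by
    intro x hx y hy hxy
    rw [Finset.mem_coe, Finset.mem_range] at hx hy
    by_contra hne
    rcases lt_or_gt_of_ne hne with h | h
    · have f1 := (hE y (by omega)).2 x h
      have f2 := (hE x (by omega)).1
      rw [← hxy] at f1
      linarith
    · have f1 := (hE x (by omega)).2 y h
      have f2 := (hE y (by omega)).1
      rw [hxy] at f1
      linarith
  have hcard : W'.card = W.card + 1 := by
    have hsub : (Finset.range r).image d ⊆ W := by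
      intro v hv
      obtain ⟨i, hi, rfl⟩ := Finset.mem_image.1 hv
      exact hw.mem_leave i (Finset.mem_range.1 hi)
    have hdis : Disjoint (W \ (Finset.range r).image d) ((Finset.range (r + 1)).image c) := by
      rw [Finset.disjoint_left]
      intro v hv hv'
      obtain ⟨i, hi, rfl⟩ := Finset.mem_image.1 hv'
      exact (Finset.mem_sdiff.1 (hw.mem_enter i (Nat.lt_succ_iff.1 (Finset.mem_range.1 hi)))).2
        (Finset.mem_sdiff.1 hv).1
    have hle := Finset.card_le_card hsub
    rw [hW', Finset.card_union_of_disjoint hdis, Finset.card_sdiff_of_subset hsub,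
      Finset.card_image_of_injOn hci, Finset.card_image_of_injOn hdi, Finset.card_range,
      Finset.card_range]
    rw [Finset.card_image_of_injOn hdi, Finset.card_range] at hle
    omega
  refine ⟨hcard.trans (by rw [hj]), ?_⟩
  -- The new splitting is read off the walk values: the signs turn the inequalities of the table
  -- into exchange inequalities. The dummy has potential `0` in the first share and the whole gain
  -- `EE b` in the second.
  set p₁ : V → ℝ := fun v => if v = b then 0 else if v ∈ W then w v - EE v else -DD v with hp₁
  set p₂ : V → ℝ := fun v => if v = b then EE b else w v - p₁ v with hp₂
  have hWne : ∀ v ∈ W, v ≠ b := fun v hv h => hbW (h ▸ hv)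
  have hXne : ∀ v ∈ U \ W, v ≠ b := fun v hv h => hbU (h ▸ (Finset.mem_sdiff.1 hv).1)
  have p1b : p₁ b = 0 := by simp [p₁]
  have p2b : p₂ b = EE b := by simp [p₂]
  have p1W : ∀ v ∈ W, p₁ v = w v - EE v := fun v hv => by simp [p₁, hWne v hv, hv]
  have p1X : ∀ v ∈ U \ W, p₁ v = -DD v := fun v hv => by
    simp [p₁, hXne v hv, (Finset.mem_sdiff.1 hv).2]
  have p2W : ∀ v ∈ W, p₂ v = EE v := fun v hv => by
    simp only [p₂, if_neg (hWne v hv), p1W v hv]; ring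
  have p2ins : ∀ v ∈ insert b W, p₂ v = EE v := fun v hv => by
    rcases Finset.mem_insert.1 hv with rfl | hv
    · exact p2b
    · exact p2W v hv
  have p2X : ∀ v ∈ U \ W, p₂ v = w v + DD v := fun v hv => by
    simp only [p₂, if_neg (hXne v hv), p1X v hv]; ring
  have hpp₁ : ∀ d ∈ insert b W, ∀ c ∈ U \ W, a₁ d c ≤ p₁ d - p₁ c := by
    intro d hd c hc
    rw [p1X c hc]
    rcases Finset.mem_insert.1 hd with rfl | hd
    · rw [p1b]; linarith [hpot0 c hc]
    · rw [p1W d hd]; linarith [hpot1 d hd c hc]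
  have hpp₂ : ∀ d ∈ insert b W, ∀ c ∈ U \ W, a₂ d c ≤ p₂ d - p₂ c := by
    intro d hd c hc
    rw [p2X c hc, p2ins d hd]; linarith [hpot2 d hd c hc]
  -- In the first family `c i` is paired with the departure before it, starting with the dummy; in
  -- the second it is paired with the departure `d i` after it, ending with the dummy.
  set e : ℕ → V := fun i => if i = 0 then b else d (i - 1) with he
  have heins : ∀ i ≤ r, e i ∈ insert b W := by
    intro i hi
    rcases Nat.eq_zero_or_pos i with rfl | h
    · simp [e]
    · simp only [e, if_neg h.ne']
      exact Finset.mem_insert_of_mem (hw.mem_leave _ (by omega))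
  have htight₁ : ∀ i ≤ r, a₁ (e i) (c i) = p₁ (e i) - p₁ (c i) := by
    intro i hi
    have hcX := hw.mem_enter i hi
    rw [p1X _ hcX, (hD i hi).1]
    rcases i with _ | i
    · simp [e, p1b, ht.start _ hcX]
    · simp only [e, if_neg (Nat.succ_ne_zero i), Nat.add_sub_cancel]
      rw [p1W _ (hw.mem_leave i (by omega)), (hE i (by omega)).1]
      linarith [hw.enter_eq i (by omega)]
  have htight₂ : ∀ i ≤ r, a₂ (d i) (c i) = p₂ (d i) - p₂ (c i) := by
    intro i hi
    have hcX := hw.mem_enter i hi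
    rw [p2X _ hcX, (hD i hi).1, p2ins _ (hdins i hi), (hE i hi).1]
    linarith [hw.leave_eq i hi]
  refine ⟨p₁, p₂, fun v hv => ?_, ?_, ?_⟩
  · have : v ≠ b := fun h => hbU (h ▸ hv)
    simp only [p₂, if_neg this]; ring
  · refine isSizeOptimal_augment hg hlam₁ hb hbW hWU hpp₁ hW' hw.mem_enter hw.mem_leave hci hdi
      (e := e) (fun f => ?_) htight₁ ?_ hcard
    · rw [Finset.sum_range_succ']
      simp [e, add_comm]
    · intro x hx i l hil hl
      -- If two pairs cross the same set, uncrossing makes `(e i, c l)` tight. This shortcut reaches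
      -- `c l` with its maximal value already in round `i < l`.
      by_contra hcon
      push Not at hcon
      have f0 := swapGain_uncross hg hlam₁ (W := W) hx (d := e i) (c := c i) (d' := e l)
        (c' := c l) (by tauto) (by tauto)
      simp only [← ha₁] at f0
      have hcX := hw.mem_enter l hl
      have f1 := htight₁ i (by omega)
      have f2 := htight₁ l hl
      have f3 := hpp₁ _ (heins l hl) _ (hw.mem_enter i (by omega))
      have f4 : p₁ (e i) - p₁ (c l) ≤ a₁ (e i) (c l) := by linarith
      have f5 := (hD l hl).2 i hil
      rw [p1X _ hcX] at f4
      rcases i with _ | i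
      · simp only [e, if_true, p1b] at f4
        have := ht.start _ hcX
        linarith
      · simp only [e, if_neg (Nat.succ_ne_zero i), Nat.add_sub_cancel] at f4
        have hdW := hw.mem_leave i (by omega)
        have := ht.enter_ge i (by omega) _ hcX _ hdW
        rw [p1W _ hdW, (hE i (by omega)).1] at f4
        linarith
  · refine isSizeOptimal_augment hg hlam₂ hb hbW hWU hpp₂ hW' hw.mem_enter hw.mem_leave hci hdi
      (e := d) (fun f => ?_) htight₂ ?_ hcard
    · rw [Finset.sum_range_succ, hdr, add_comm]
    · intro x hx i l hil hl
      -- In the second family the shortcut runs from `c i` to `d l` and attains the maximum at `d l`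
      -- in round `i < l`.
      by_contra hcon
      push Not at hcon
      have f0 := swapGain_uncross hg hlam₂ (W := W) hx (d := d i) (c := c i) (d' := d l)
        (c' := c l) (by tauto) (by tauto)
      simp only [← ha₂] at f0
      have hcX := hw.mem_enter i (by omega)
      have f1 := htight₂ i (by omega)
      have f2 := htight₂ l hl
      have f3 := hpp₂ _ (hdins i (by omega)) _ (hw.mem_enter l hl)
      have f4 : p₂ (d l) - p₂ (c i) ≤ a₂ (d l) (c i) := by linarith
      have f5 := (hE l hl).2 i hil
      rw [p2X _ hcX, p2ins _ (hdins l hl), (hD i (by omega)).1] at f4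
      have := ht.leave_ge i (by omega) _ (hdins l hl) _ hcX
      linarith

end Exchange
-- The reward that replaces the interval constraints
section Objective

/-- Reward `M` for each unit up to the lower bound, and penalty `M` for each unit above the upper
bound. -/
def boundReward (M : ℝ) (lo hi : ℕ → ℕ) (l : ℕ) (j : ℤ) : ℝ :=
  M * ((min j (lo l) - max (j - hi l) 0 : ℤ) : ℝ)

/-- The algorithm never evaluates the reward, only its increments. These need two comparisons and a
subtraction, so the missing multiplication of the machine does no harm. -/
theorem boundReward_succ_sub (M : ℝ) (lo hi : ℕ → ℕ) (l : ℕ) (j : ℤ) :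
    boundReward M lo hi l (j + 1) - boundReward M lo hi l j =
      (if j < lo l then M else 0) - (if (hi l : ℤ) ≤ j then M else 0) := by
  unfold boundReward
  rw [← mul_sub, ← Int.cast_sub]
  split_ifs with h1 h2 h2
  · rw [show min (j + 1) (lo l : ℤ) - max (j + 1 - hi l) 0 - (min j (lo l) - max (j - hi l) 0) = 0
      by omega]
    simp
  · rw [show min (j + 1) (lo l : ℤ) - max (j + 1 - hi l) 0 - (min j (lo l) - max (j - hi l) 0) = 1
      by omega]
    simp
  · rw [show min (j + 1) (lo l : ℤ) - max (j + 1 - hi l) 0 - (min j (lo l) - max (j - hi l) 0) = -1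
      by omega]
    simp
  · rw [show min (j + 1) (lo l : ℤ) - max (j + 1 - hi l) 0 - (min j (lo l) - max (j - hi l) 0) = 0
      by omega]
    simp

theorem boundReward_pred_sub (M : ℝ) (lo hi : ℕ → ℕ) (l : ℕ) (j : ℤ) :
    boundReward M lo hi l (j - 1) - boundReward M lo hi l j =
      (if (hi l : ℤ) < j then M else 0) - (if j ≤ lo l then M else 0) := by
  have h := boundReward_succ_sub M lo hi l (j - 1)
  rw [sub_add_cancel] at h
  have e1 : (j - 1 < (lo l : ℤ)) ↔ j ≤ lo l := by omega
  have e2 : ((hi l : ℤ) ≤ j - 1) ↔ (hi l : ℤ) < j := by omega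
  simp only [e1, e2] at h
  linarith

theorem decreasingIncrements_boundReward {M : ℝ} (hM : 0 ≤ M) (lo hi : ℕ → ℕ) :
    DecreasingIncrements (boundReward M lo hi) := by
  intro l i j hij
  simp only [boundReward_succ_sub]
  split_ifs <;> linarith

theorem boundReward_of_mem {M : ℝ} {lo hi : ℕ → ℕ} {l j : ℕ} (h : lo l ≤ j ∧ j ≤ hi l) :
    boundReward M lo hi l j = M * lo l := by
  unfold boundReward
  rw [show min (j : ℤ) (lo l) - max ((j : ℤ) - hi l) 0 = lo l by omega]
  simp

theorem boundReward_le {M : ℝ} (hM : 0 ≤ M) (lo hi : ℕ → ℕ) (l j : ℕ) :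
    boundReward M lo hi l j ≤ M * lo l := by
  unfold boundReward
  refine mul_le_mul_of_nonneg_left ?_ hM
  have : min (j : ℤ) (lo l) - max ((j : ℤ) - hi l) 0 ≤ lo l := by omega
  exact_mod_cast this

/-- The factor of `M` is an integer, so leaving the interval lowers it by at least one and costs a
full `M`. -/
theorem boundReward_le_of_not_mem {M : ℝ} (hM : 0 ≤ M) {lo hi : ℕ → ℕ} {l j : ℕ}
    (h : ¬ (lo l ≤ j ∧ j ≤ hi l)) : boundReward M lo hi l j ≤ M * lo l - M := by
  unfold boundReward
  have : min (j : ℤ) (lo l) - max ((j : ℤ) - hi l) 0 ≤ lo l - 1 := by omega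
  have h2 : ((min (j : ℤ) (lo l) - max ((j : ℤ) - hi l) 0 : ℤ) : ℝ) ≤ lo l - 1 := by
    exact_mod_cast this
  nlinarith

/-- The labels of part `p`. -/
def labelsOfPart (n : ℕ) (part : ℕ → ℕ) (p : ℕ) : Finset ℕ :=
  (Finset.range n).filter fun l => part l = p

theorem sizeValue_parts {g : ℕ → ℤ → ℝ} {S : ℕ → Finset ℕ} {n : ℕ} {part : ℕ → ℕ}
    (hpart : ∀ l < n, part l = 0 ∨ part l = 1) (W : Finset ℕ) :
    sizeValue g S (labelsOfPart n part 0) W + sizeValue g S (labelsOfPart n part 1) W =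
      sizeValue g S (Finset.range n) W := by
  unfold sizeValue labelsOfPart
  rw [Finset.sum_filter, Finset.sum_filter, ← Finset.sum_add_distrib]
  refine Finset.sum_congr rfl fun l hl => ?_
  rcases hpart l (Finset.mem_range.1 hl) with h | h <;> simp [h]

/-- With a large reward, a set of maximum value is diverse and of maximum weight as soon as there
is a diverse set. -/
theorem diverse_of_isSizeOptimal {n : ℕ} {part lo hi : ℕ → ℕ} {S : ℕ → Finset ℕ} {w : ℕ → ℝ}
    {U : Finset ℕ} {M : ℝ} (hM : M = 1 + ∑ v ∈ U, |w v|)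
    (hpart : ∀ l < n, part l = 0 ∨ part l = 1) {p₁ p₂ : ℕ → ℝ}
    (hp : ∀ v ∈ U, p₁ v + p₂ v = w v) {W : Finset ℕ}
    (h₁ : IsSizeOptimal (boundReward M lo hi) S (labelsOfPart n part 0) U p₁ W)
    (h₂ : IsSizeOptimal (boundReward M lo hi) S (labelsOfPart n part 1) U p₂ W)
    {W' : Finset ℕ} (hW' : W' ⊆ U) (hcard : W'.card = W.card)
    (hdiv : ∀ l < n, lo l ≤ (W' ∩ S l).card ∧ (W' ∩ S l).card ≤ hi l) :
    (∀ l < n, lo l ≤ (W ∩ S l).card ∧ (W ∩ S l).card ≤ hi l) ∧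
      ∑ v ∈ W', w v ≤ ∑ v ∈ W, w v := by
  have hM0 : 0 ≤ M := by
    have : 0 ≤ ∑ v ∈ U, |w v| := Finset.sum_nonneg fun _ _ => abs_nonneg _
    linarith
  have e1 := h₁.2 W' hW' hcard
  have e2 := h₂.2 W' hW' hcard
  have hsum : ∀ X ⊆ U, ∑ v ∈ X, p₁ v + ∑ v ∈ X, p₂ v = ∑ v ∈ X, w v := by
    intro X hX
    rw [← Finset.sum_add_distrib]
    exact Finset.sum_congr rfl fun v hv => hp v (hX hv)
  have e3 := hsum W' hW'
  have e4 := hsum W h₁.1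
  have e5 := sizeValue_parts (g := boundReward M lo hi) (S := S) hpart W
  have e6 := sizeValue_parts (g := boundReward M lo hi) (S := S) hpart W'
  have e7 : sizeValue (boundReward M lo hi) S (Finset.range n) W' =
      ∑ l ∈ Finset.range n, M * lo l :=
    Finset.sum_congr rfl fun l hl => boundReward_of_mem (hdiv l (Finset.mem_range.1 hl))
  have e8 : sizeValue (boundReward M lo hi) S (Finset.range n) W ≤
      ∑ l ∈ Finset.range n, M * lo l :=
    Finset.sum_le_sum fun l _ => boundReward_le hM0 lo hi l _
  refine ⟨?_, by linarith⟩
  by_contra hcon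
  push Not at hcon
  obtain ⟨l, hl, hne⟩ := hcon
  have hl' := Finset.mem_range.2 hl
  have e9 : sizeValue (boundReward M lo hi) S (Finset.range n) W ≤
      ∑ l ∈ Finset.range n, M * lo l - M := by
    unfold sizeValue
    rw [← Finset.add_sum_erase _ _ hl', ← Finset.add_sum_erase (Finset.range n) _ hl']
    have f1 := boundReward_le_of_not_mem (lo := lo) (hi := hi) (l := l) (j := (W ∩ S l).card) hM0
      (fun h => absurd h.2 (not_le.2 (hne h.1)))
    have f2 : ∑ x ∈ (Finset.range n).erase l, boundReward M lo hi x ((W ∩ S x).card : ℤ) ≤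
        ∑ x ∈ (Finset.range n).erase l, M * lo x :=
      Finset.sum_le_sum fun l _ => boundReward_le hM0 lo hi l _
    linarith
  -- The weights of two committees differ by at most `M - 1`, which cannot make up for a lost reward
  -- of `M`.
  have e10 : ∑ v ∈ W, w v - ∑ v ∈ W', w v ≤ ∑ v ∈ U, |w v| := by
    rw [← Finset.sum_sdiff_sub_sum_sdiff]
    have f1 : ∑ v ∈ W \ W', w v ≤ ∑ v ∈ W \ W', |w v| :=
      Finset.sum_le_sum fun v _ => le_abs_self _
    have f2 : -∑ v ∈ W' \ W, w v ≤ ∑ v ∈ W' \ W, |w v| := by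
      rw [← Finset.sum_neg_distrib]
      exact Finset.sum_le_sum fun v _ => neg_le_abs _
    have f3 : ∑ v ∈ W \ W', |w v| + ∑ v ∈ W' \ W, |w v| ≤ ∑ v ∈ U, |w v| := by
      rw [← Finset.sum_union disjoint_sdiff_sdiff]
      refine Finset.sum_le_sum_of_subset_of_nonneg ?_ fun _ _ _ => abs_nonneg _
      exact Finset.union_subset (Finset.sdiff_subset.trans h₁.1) (Finset.sdiff_subset.trans hW')
    linarith
  linarith

end Objective

/-! ### Reasoning about programs and their running time -/

section Machine

/-- Started in `s`, the program `p` halts within time `T` in a memory that satisfies `Q`. -/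
def Ensures (p : Program) (s : Memory) (T : ℕ) (Q : Memory → Prop) : Prop :=
  ∃ s' t, Exec p s s' t ∧ t ≤ T ∧ Q s'

namespace Ensures

variable {p q : Program} {s : Memory} {T T₁ T₂ : ℕ} {Q Q' : Memory → Prop} {b : Test}

theorem mono (h : Ensures p s T₁ Q') (hQ : ∀ s', Q' s' → Q s') (hT : T₁ ≤ T) :
    Ensures p s T Q := by
  obtain ⟨s', t, h1, h2, h3⟩ := h
  exact ⟨s', t, h1, h2.trans hT, hQ s' h3⟩

theorem le (h : Ensures p s T₁ Q) (hT : T₁ ≤ T) : Ensures p s T Q := h.mono (fun _ h => h) hT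

theorem seq (h : Ensures p s T₁ fun s₁ => Ensures q s₁ T₂ Q) :
    Ensures (.seq p q) s (T₁ + T₂) Q := by
  obtain ⟨s₁, t₁, h1, h2, s₂, t₂, h3, h4, h5⟩ := h
  exact ⟨s₂, t₁ + t₂, .seq h1 h3, by omega, h5⟩

end Ensures

/-- The largest running time of a program without loops. -/
def Program.straightCost : Program → ℕ
  | .skip => 1
  | .setNat _ i e => i.cost + e.cost + 1
  | .setReal _ i e => i.cost + e.cost + 1
  | .seq p q => p.straightCost + q.straightCost
  | .branch b p q => b.cost + max p.straightCost q.straightCost + 1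
  | .loop _ _ => 0

/-- The weakest precondition of a program without loops. -/
def Program.wp : Program → (Memory → Prop) → Memory → Prop
  | .skip, Q, s => Q s
  | .setNat a i e, Q, s => Q (s.writeNat a (i.eval s) (e.eval s))
  | .setReal a i e, Q, s => Q (s.writeReal a (i.eval s) (e.eval s))
  | .seq p q, Q, s => p.wp (q.wp Q) s
  | .branch b p q, Q, s => (b.Holds s → p.wp Q s) ∧ (¬ b.Holds s → q.wp Q s)
  | .loop _ _, _, _ => False

/-- Code without loops is verified by computing its precondition, and its cost is a closed term. The
value `0` that `straightCost` gives to loops is harmless, since their precondition is `False`. -/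
theorem Ensures.of_wp {p : Program} {s : Memory} {Q : Memory → Prop} {T : ℕ} (h : p.wp Q s)
    (hT : p.straightCost ≤ T) : Ensures p s T Q := by
  refine Ensures.le (T₁ := p.straightCost) ?_ hT
  clear hT
  induction p generalizing s Q with
  | skip => exact ⟨s, 1, .skip s, le_rfl, h⟩
  | setNat a i e => exact ⟨_, _, .setNat s a i e, le_rfl, h⟩
  | setReal a i e => exact ⟨_, _, .setReal s a i e, le_rfl, h⟩
  | seq p q hp hq => exact .seq ((hp h).mono (fun _ h => hq h) le_rfl)
  | branch b p q hp hq =>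
    by_cases hb : b.Holds s
    · obtain ⟨s', t, h3, h4, h5⟩ := hp (h.1 hb)
      exact ⟨s', _, .branchTrue hb h3, by simp only [Program.straightCost]; omega, h5⟩
    · obtain ⟨s', t, h3, h4, h5⟩ := hq (h.2 hb)
      exact ⟨s', _, .branchFalse hb h3, by simp only [Program.straightCost]; omega, h5⟩
  | loop b p => exact h.elim

/-- The scalar variable kept in cell `0` of bank `x`. -/
def scalar (x : ℕ) : NatExpr := .get x (.const 0)

/-- Assignment to a scalar variable. -/
def assign (x : ℕ) (e : NatExpr) : Program := .setNat x (.const 0) e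

/-- The loop in which the variable `x` runs from `0` to the value of `bound`, exclusively. -/
def forLoop (x : ℕ) (bound : NatExpr) (body : Program) : Program :=
  .seq (assign x (.const 0))
    (.loop (.natLe (.plus (scalar x) (.const 1)) bound)
      (.seq body (assign x (.plus (scalar x) (.const 1)))))

@[simp] theorem writeNat_nat_same (s : Memory) (a i v : ℕ) :
    (s.writeNat a i v).nat a = Function.update (s.nat a) i v := by simp [Memory.writeNat]

@[simp] theorem writeNat_nat_ne (s : Memory) {a b : ℕ} (h : b ≠ a) (i v : ℕ) :
    (s.writeNat a i v).nat b = s.nat b := by simp [Memory.writeNat, h]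

@[simp] theorem writeNat_real (s : Memory) (a i v : ℕ) : (s.writeNat a i v).real = s.real := rfl

@[simp] theorem writeReal_real_same (s : Memory) (a i : ℕ) (v : ℝ) :
    (s.writeReal a i v).real a = Function.update (s.real a) i v := by simp [Memory.writeReal]

@[simp] theorem writeReal_real_ne (s : Memory) {a b : ℕ} (h : b ≠ a) (i : ℕ) (v : ℝ) :
    (s.writeReal a i v).real b = s.real b := by simp [Memory.writeReal, h]

@[simp] theorem writeReal_nat (s : Memory) (a i : ℕ) (v : ℝ) :
    (s.writeReal a i v).nat = s.nat := rfl

@[simp] theorem scalar_eval (s : Memory) (x : ℕ) : (scalar x).eval s = s.nat x 0 := rfl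

attribute [simp] NatExpr.eval RealExpr.eval Test.Holds

/-- The invariant has to determine the counter and the bound, and it is required again only after
the increment. The constant `12` pays for the test apart from its bound, the branching and the
increment; `9` pays for the initialization and the last test. -/
theorem Ensures.forLoop {x : ℕ} {bound : NatExpr} {body : Program} {s : Memory} {N T : ℕ}
    (Inv : ℕ → Memory → Prop) (h0 : Inv 0 (s.writeNat x 0 0))
    (hx : ∀ i ≤ N, ∀ s', Inv i s' → s'.nat x 0 = i ∧ bound.eval s' = N)
    (hstep : ∀ i < N, ∀ s', Inv i s' →
      Ensures body s' T fun s'' => s''.nat x 0 = i ∧ Inv (i + 1) (s''.writeNat x 0 (i + 1))) :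
    Ensures (forLoop x bound body) s (N * (T + bound.cost + 12) + bound.cost + 9) (Inv N) := by
  have key : ∀ r i, i + r = N → ∀ s', Inv i s' → Ensures
      (.loop (.natLe (.plus (scalar x) (.const 1)) bound)
      (.seq body (assign x (.plus (scalar x) (.const 1))))) s'
      (r * (T + bound.cost + 12) + bound.cost + 6) (Inv N) := by
    intro r
    induction r with
    | zero =>
      rintro i rfl s' hs'
      obtain ⟨h1, h2⟩ := hx i le_rfl s' hs'
      refine ⟨s', _, .loopDone ?_, ?_, hs'⟩
      · simp [h1, h2]
      · simp only [Test.cost, NatExpr.cost, scalar]; omega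
    | succ r ih =>
      intro i hi s' hs'
      obtain ⟨h1, h2⟩ := hx i (by omega) s' hs'
      obtain ⟨s₁, t₁, h3, h4, h5, h6⟩ := hstep i (by omega) s' hs'
      obtain ⟨s₂, t₂, h7, h8, h9⟩ := ih (i + 1) (by omega) _ h6
      refine ⟨s₂, _, .loopStep ?_ (.seq h3 (.setNat _ _ _ _)) (?_ : Exec _ _ _ t₂), ?_, h9⟩
      · simp [h1, h2]; omega
      · simpa [h5] using h7
      · simp only [Test.cost, NatExpr.cost, scalar]
        rw [add_mul]; omega
  obtain ⟨s', t, h1, h2, h3⟩ := key N 0 (by omega) _ h0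
  refine ⟨s', _, .seq (.setNat _ _ _ _) h1, ?_, h3⟩
  simp only [NatExpr.cost]; omega

/-- `s'` differs from `s` at most in the listed banks. -/
structure SameOutside (X Y : List ℕ) (s s' : Memory) : Prop where
  nat : ∀ a, a ∉ X → s'.nat a = s.nat a
  real : ∀ a, a ∉ Y → s'.real a = s.real a

theorem SameOutside.refl (X Y : List ℕ) (s : Memory) : SameOutside X Y s s :=
  ⟨fun _ _ => rfl, fun _ _ => rfl⟩

theorem SameOutside.trans {X Y X' Y' X'' Y'' : List ℕ} {s s' s'' : Memory}
    (h : SameOutside X Y s s') (h' : SameOutside X' Y' s' s'') (hX : X ⊆ X'')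
    (hY : Y ⊆ Y'') (hX' : X' ⊆ X'') (hY' : Y' ⊆ Y'') : SameOutside X'' Y'' s s'' :=
  ⟨fun a ha => (h'.nat a fun h => ha (hX' h)).trans (h.nat a fun h => ha (hX h)),
    fun a ha => (h'.real a fun h => ha (hY' h)).trans (h.real a fun h => ha (hY h))⟩

theorem SameOutside.writeNat {X Y : List ℕ} {s s' : Memory} (h : SameOutside X Y s s') {a : ℕ}
    (ha : a ∈ X) (i v : ℕ) : SameOutside X Y s (s'.writeNat a i v) :=
  ⟨fun b hb => by
    rw [writeNat_nat_ne _ (by rintro rfl; exact hb ha)]; exact h.nat b hb, h.real⟩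

theorem SameOutside.writeReal {X Y : List ℕ} {s s' : Memory} (h : SameOutside X Y s s') {a : ℕ}
    (ha : a ∈ Y) (i : ℕ) (v : ℝ) : SameOutside X Y s (s'.writeReal a i v) :=
  ⟨h.nat, fun b hb => by
    rw [writeReal_real_ne _ (by rintro rfl; exact hb ha)]; exact h.real b hb⟩

end Machine
-- Instances over natural numbers and their memory layout
/-- An instance whose candidates and labels are natural numbers. -/
structure Model where
  m : ℕ
  n : ℕ
  k : ℕ
  S : ℕ → Finset ℕ
  part : ℕ → ℕ
  lo : ℕ → ℕ
  hi : ℕ → ℕ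
  w : ℕ → ℝ
  S_subset : ∀ l, S l ⊆ Finset.range m
  part_lt : ∀ l < n, part l = 0 ∨ part l = 1
  w_dummy : w m = 0

/-- The memory holds the data of the model; the row `m` of the incidence matrix belongs to a
dummy candidate without labels. -/
structure Loaded (X : Model) (s : Memory) : Prop where
  m : s.nat 0 0 = X.m
  n : s.nat 0 1 = X.n
  k : s.nat 0 2 = X.k
  inc : ∀ c ≤ X.m, ∀ l < X.n, s.nat 1 (c * X.n + l) = if c ∈ X.S l then 1 else 0
  part : ∀ l < X.n, s.nat 2 l = X.part l
  lo : ∀ l < X.n, s.nat 3 l = X.lo l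
  hi : ∀ l < X.n, s.nat 4 l = X.hi l
  w : ∀ c ≤ X.m, s.real 0 c = X.w c

/-- This is the frame rule by which the input survives every subroutine: none lists banks 0 to 4 or
real bank 0 among those it changes. -/
theorem Loaded.same {X : Model} {s s' : Memory} (h : Loaded X s) {A B : List ℕ}
    (hs : SameOutside A B s s') (hA : ∀ a < 5, a ∉ A) (hB : 0 ∉ B) : Loaded X s' := by
  have e0 := hs.nat 0 (hA 0 (by omega))
  have e1 := hs.nat 1 (hA 1 (by omega))
  have e2 := hs.nat 2 (hA 2 (by omega))
  have e3 := hs.nat 3 (hA 3 (by omega))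
  have e4 := hs.nat 4 (hA 4 (by omega))
  have e5 := hs.real 0 hB
  constructor
  · rw [e0]; exact h.m
  · rw [e0]; exact h.n
  · rw [e0]; exact h.k
  · rw [e1]; exact h.inc
  · rw [e2]; exact h.part
  · rw [e3]; exact h.lo
  · rw [e4]; exact h.hi
  · rw [e5]; exact h.w

/-- Bank 6 holds the characteristic vector of `W` together with the dummy candidate. -/
def HoldsSet (X : Model) (W : Finset ℕ) (s : Memory) : Prop :=
  ∀ c, s.nat 6 c = if c ∈ insert X.m W then 1 else 0

def exprM : NatExpr := .get 0 (.const 0)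
def exprN : NatExpr := .get 0 (.const 1)
def exprK : NatExpr := .get 0 (.const 2)

/-- The test for equality of natural numbers. -/
def Test.natEq (e₁ e₂ : NatExpr) : Test := .conj (.natLe e₁ e₂) (.natLe e₂ e₁)

@[simp] theorem Test.natEq_holds (s : Memory) (e₁ e₂ : NatExpr) :
    (Test.natEq e₁ e₂).Holds s ↔ e₁.eval s = e₂.eval s := by
  simp [Test.natEq, le_antisymm_iff]

/-- `x := x + e`. -/
def increase (x : ℕ) (e : NatExpr) : Program := assign x (.plus (scalar x) e)

/-! ### Label counts, reward size and marginal gains -/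

/-- Count the members of the committee with label `l`, for every label `l`. -/
def countProgram : Program :=
  forLoop 10 exprN
    (.seq (.seq (.setNat 7 (scalar 10) (.const 0)) (assign 11 (scalar 10)))
    (forLoop 12 exprM
      (.seq
        (.branch (.conj (.natEq (.get 1 (scalar 11)) (.const 1))
            (.natEq (.get 6 (scalar 12)) (.const 1)))
          (.setNat 7 (scalar 10) (.plus (.get 7 (scalar 10)) (.const 1))) .skip)
        (increase 11 exprN))))

/-- Without multiplication, the matrix address `c * n + l` is maintained as a running sum in bank
11; the inner invariant counts among the candidates already scanned. -/
theorem countProgram_spec {X : Model} {W : Finset ℕ} (hW : W ⊆ Finset.range X.m) {s : Memory}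
    (hs : Loaded X s) (hm : HoldsSet X W s) :
    Ensures countProgram s (100 * ((X.m + 1) * (X.n + 1))) fun s' =>
      SameOutside [7, 10, 11, 12] [] s s' ∧ ∀ l < X.n, s'.nat 7 l = (W ∩ X.S l).card := by
  refine Ensures.mono (Ensures.forLoop (N := X.n) (T := 15 + (X.m * (60 + 2 + 12) + 2 + 9))
    (fun i s' => SameOutside [7, 10, 11, 12] [] s s' ∧
    s'.nat 10 0 = i ∧ ∀ l < i, s'.nat 7 l = (W ∩ X.S l).card) ?_ ?_ ?_) (fun s' h => ⟨h.1, h.2.2⟩)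
    (by simp only [NatExpr.cost, exprN]; nlinarith)
  · exact ⟨(SameOutside.refl _ _ _).writeNat (by simp) _ _, by simp, by simp⟩
  · rintro i - s' ⟨h1, h2, -⟩
    exact ⟨h2, (hs.same h1 (by decide) (by simp)).n⟩
  · rintro l hl s₁ ⟨hs1, h10, hcnt⟩
    refine Ensures.seq (Ensures.of_wp ?_ (by decide))
    simp only [Program.wp, assign]
    refine Ensures.mono (Ensures.forLoop (N := X.m) (T := 60)
      (fun i s' => SameOutside [7, 10, 11, 12] [] s s' ∧ s'.nat 10 0 = l ∧
        s'.nat 12 0 = i ∧ s'.nat 11 0 = i * X.n + l ∧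
        (∀ l' < l, s'.nat 7 l' = (W ∩ X.S l').card) ∧
        s'.nat 7 l = ((Finset.range i).filter fun c => c ∈ W ∩ X.S l).card) ?_ ?_ ?_) ?_ le_rfl
    · refine ⟨(((hs1.writeNat (by simp) _ _).writeNat (by simp) _ _).writeNat (by simp) _ _),
        by simp [h10], by simp, by simp [h10], ?_, by simp [h10]⟩
      intro l' hl'
      simp [h10, hl'.ne, hcnt l' hl']
    · rintro i - s' ⟨h1, -, h2, -⟩
      exact ⟨h2, (hs.same h1 (by decide) (by simp)).m⟩
    · rintro i hi s₂ ⟨hs2, h10', h12, h11, hcnt', hl2⟩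
      have hld := hs.same hs2 (by decide) (by simp)
      have hinc := hld.inc i hi.le l hl
      have hmem : s₂.nat 6 i = if i ∈ W then 1 else 0 := by
        rw [hs2.nat 6 (by simp), hm i]
        simp [hi.ne]
      have hcard : ((Finset.range (i + 1)).filter fun c => c ∈ W ∩ X.S l).card =
          ((Finset.range i).filter fun c => c ∈ W ∩ X.S l).card +
            if i ∈ W ∩ X.S l then 1 else 0 := by
        rw [Finset.range_add_one, Finset.filter_insert]
        split_ifs <;> simp
      refine Ensures.of_wp ?_ (by decide)
      simp only [Program.wp, assign, increase]
      refine ⟨fun hb => ⟨by simp [h12], ((hs2.writeNat (by simp) _ _).writeNat (by simp) _ _).writeNat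
        (by simp) _ _, by simp [h10'], by simp, ?_, fun l' hl' => ?_, ?_⟩, fun hb => ⟨by simp [h12],
        (hs2.writeNat (by simp) _ _).writeNat (by simp) _ _, by simp [h10'], by simp, ?_,
        fun l' hl' => ?_, ?_⟩⟩
      · simp [exprN, hld.n, h11]; ring
      · simp [h10', hl'.ne, hcnt' l' hl']
      · have hb' : i ∈ X.S l ∧ i ∈ W := by simpa [h11, h12, hinc, hmem] using hb
        rw [hcard]
        simp [h10', hb', hl2]
      · simp [exprN, hld.n, h11]; ring
      · simp [hcnt' l' hl']
      · have hb' : i ∈ X.S l → i ∉ W := by simpa [h11, h12, hinc, hmem] using hb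
        rw [hcard]
        simp [hl2]; tauto
    · rintro s₂ ⟨hs2, h10', -, -, hcnt', hl2⟩
      refine ⟨by simp [h10'], hs2.writeNat (by simp) _ _, by simp, ?_⟩
      intro l' hl'
      rcases Nat.lt_succ_iff_lt_or_eq.1 hl' with h | rfl
      · simp [hcnt' l' h]
      · have : ((Finset.range X.m).filter fun c => c ∈ W ∩ X.S l') = W ∩ X.S l' := by
          ext c
          simp only [Finset.mem_filter, Finset.mem_range, Finset.mem_inter]
          exact ⟨fun h => h.2, fun h => ⟨Finset.mem_range.1 (hW h.1), h⟩⟩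
        rw [this] at hl2
        simp [hl2]

/-- The scalar real variable kept in cell `0` of the real bank `x`. -/
def realScalar (x : ℕ) : RealExpr := .get x (.const 0)

@[simp] theorem realScalar_eval (s : Memory) (x : ℕ) : (realScalar x).eval s = s.real x 0 := rfl

/-- Compute the size of the reward. -/
def rewardProgram : Program :=
  .seq (.setReal 1 (.const 0) (.const 1))
    (forLoop 10 exprM
      (.branch (.realLe (.const 0) (.get 0 (scalar 10)))
        (.setReal 1 (.const 0) (.plus (realScalar 1) (.get 0 (scalar 10))))
        (.setReal 1 (.const 0) (.minus (realScalar 1) (.get 0 (scalar 10))))))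

theorem rewardProgram_spec {X : Model} {s : Memory} (hs : Loaded X s) :
    Ensures rewardProgram s (100 * (X.m + 1)) fun s' =>
      SameOutside [10] [1] s s' ∧ s'.real 1 0 = 1 + ∑ v ∈ Finset.range X.m, |X.w v| := by
  refine Ensures.le (T₁ := 3 + (X.m * (60 + 2 + 12) + 2 + 9)) (Ensures.seq (Ensures.of_wp ?_ (by decide))) (by omega)
  simp only [Program.wp]
  refine Ensures.mono (Ensures.forLoop (N := X.m) (T := 60) (fun i s' => SameOutside [10] [1] s s' ∧
    s'.nat 10 0 = i ∧ s'.real 1 0 = 1 + ∑ v ∈ Finset.range i, |X.w v|) ?_ ?_ ?_)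
    (fun s' h => ⟨h.1, h.2.2⟩) le_rfl
  · exact ⟨((SameOutside.refl _ _ _).writeReal (by simp) _ _).writeNat (by simp) _ _, by simp, by simp⟩
  · rintro i - s' ⟨h1, h2, -⟩
    exact ⟨h2, (hs.same h1 (by decide) (by simp)).m⟩
  · rintro i hi s₂ ⟨hs2, h10, hM⟩
    have hw := (hs.same hs2 (by decide) (by simp)).w i hi.le
    refine Ensures.of_wp ?_ (by decide)
    simp only [Program.wp]
    refine ⟨fun hb => ⟨by simp [h10], (hs2.writeReal (by simp) _ _).writeNat (by simp) _ _, by simp, ?_⟩,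
      fun hb => ⟨by simp [h10], (hs2.writeReal (by simp) _ _).writeNat (by simp) _ _, by simp, ?_⟩⟩
    · have hb' : 0 ≤ X.w i := by simpa [h10, hw] using hb
      rw [Finset.sum_range_succ, abs_of_nonneg hb']
      simp [h10, hM, hw]; ring
    · have hb' : X.w i < 0 := by simpa [h10, hw] using hb
      rw [Finset.sum_range_succ, abs_of_neg hb']
      simp [h10, hM, hw]; ring

/-- For every label, store the difference of the reward (if `t₁` holds, else `0`) and the reward
(if `t₂` holds, else `0`) in the real bank `a`. -/
def rewardLoop (a : ℕ) (t₁ t₂ : Test) : Program :=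
  forLoop 10 exprN
    (.branch t₁
      (.branch t₂ (.setReal a (scalar 10) (.const 0)) (.setReal a (scalar 10) (realScalar 1)))
      (.branch t₂ (.setReal a (scalar 10) (.minus (.const 0) (realScalar 1)))
        (.setReal a (scalar 10) (.const 0))))

/-- The tests are left abstract because the gains of entrances and departures differ only in their
comparisons. They need to be understood only in memories that agree with `s` apart from the counter
and the target bank. -/
theorem rewardLoop_spec {X : Model} {s : Memory} (hs : Loaded X s) {a : ℕ} (ha : 1 < a)
    {t₁ t₂ : Test} (hc₁ : t₁.cost ≤ 10) (hc₂ : t₂.cost ≤ 10) {P₁ P₂ : ℕ → Prop}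
    [DecidablePred P₁] [DecidablePred P₂]
    (h₁ : ∀ l < X.n, ∀ s', SameOutside [10] [a] s s' → s'.nat 10 0 = l → (t₁.Holds s' ↔ P₁ l))
    (h₂ : ∀ l < X.n, ∀ s', SameOutside [10] [a] s s' → s'.nat 10 0 = l → (t₂.Holds s' ↔ P₂ l)) :
    Ensures (rewardLoop a t₁ t₂) s (100 * (X.n + 1)) fun s' =>
      SameOutside [10] [a] s s' ∧ ∀ l < X.n, s'.real a l =
        (if P₁ l then s.real 1 0 else 0) - (if P₂ l then s.real 1 0 else 0) := by
  refine Ensures.mono (Ensures.forLoop (N := X.n) (T := 60) (fun i s' => SameOutside [10] [a] s s' ∧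
    s'.nat 10 0 = i ∧ ∀ l < i, s'.real a l =
        (if P₁ l then s.real 1 0 else 0) - (if P₂ l then s.real 1 0 else 0)) ?_ ?_ ?_)
    (fun s' h => ⟨h.1, h.2.2⟩) (by simp only [exprN, NatExpr.cost]; omega)
  · exact ⟨(SameOutside.refl _ _ _).writeNat (by simp) _ _, by simp, by simp⟩
  · rintro i - s' ⟨h1, h2, -⟩
    refine ⟨h2, (hs.same h1 (by decide) ?_).n⟩
    rw [List.mem_singleton]; omega
  · rintro i hi s₂ ⟨hs2, h10, hM⟩
    have hR : s₂.real 1 0 = s.real 1 0 := by rw [hs2.real 1 (by rw [List.mem_singleton]; omega)]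
    have e1 := h₁ i hi s₂ hs2 h10
    have e2 := h₂ i hi s₂ hs2 h10
    refine Ensures.of_wp ?_ ?_
    swap
    · simp only [Program.straightCost, NatExpr.cost, RealExpr.cost, scalar, realScalar]; omega
    simp only [Program.wp]
    have fin : ∀ v, v = ((if P₁ i then s.real 1 0 else 0) - (if P₂ i then s.real 1 0 else 0)) →
        ((s₂.writeReal a ((scalar 10).eval s₂) v).nat 10 0 = i ∧
        SameOutside [10] [a] s ((s₂.writeReal a ((scalar 10).eval s₂) v).writeNat 10 0 (i + 1)) ∧
        ((s₂.writeReal a ((scalar 10).eval s₂) v).writeNat 10 0 (i + 1)).nat 10 0 = i + 1 ∧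
        ∀ l < i + 1, ((s₂.writeReal a ((scalar 10).eval s₂) v).writeNat 10 0 (i + 1)).real a l =
          (if P₁ l then s.real 1 0 else 0) - (if P₂ l then s.real 1 0 else 0)) := by
      intro v hv
      refine ⟨by simp [h10], (hs2.writeReal (by simp) _ _).writeNat (by simp) _ _, by simp, ?_⟩
      intro l hl
      rcases Nat.lt_succ_iff_lt_or_eq.1 hl with h | rfl
      · simp only [writeNat_real, writeReal_real_same, scalar_eval, h10]
        rw [Function.update_of_ne h.ne, hM l h]
      · simp only [writeNat_real, writeReal_real_same, scalar_eval, h10]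
        rw [Function.update_self, hv]
    rw [e1, e2]
    refine ⟨fun p1 => ⟨fun p2 => fin _ ?_, fun p2 => fin _ ?_⟩,
      fun p1 => ⟨fun p2 => fin _ ?_, fun p2 => fin _ ?_⟩⟩ <;> simp [p1, p2, hR]

/-- Compute the gains of an entrance and of a departure for each label. -/
def gainProgram : Program :=
  .seq
    (rewardLoop 2 (.neg (.natLe (.get 3 (scalar 10)) (.get 7 (scalar 10))))
      (.natLe (.get 4 (scalar 10)) (.get 7 (scalar 10))))
    (rewardLoop 3 (.neg (.natLe (.get 7 (scalar 10)) (.get 4 (scalar 10))))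
      (.natLe (.get 7 (scalar 10)) (.get 3 (scalar 10))))

theorem gainProgram_spec {X : Model} {W : Finset ℕ} {s : Memory} (hs : Loaded X s)
    (hcnt : ∀ l < X.n, s.nat 7 l = (W ∩ X.S l).card) {M : ℝ} (hM : s.real 1 0 = M) :
    Ensures gainProgram s (200 * (X.n + 1)) fun s' => SameOutside [10] [2, 3] s s' ∧
      (∀ l < X.n, s'.real 2 l = boundReward M X.lo X.hi l ((W ∩ X.S l).card + 1) -
        boundReward M X.lo X.hi l (W ∩ X.S l).card) ∧
      ∀ l < X.n, s'.real 3 l = boundReward M X.lo X.hi l ((W ∩ X.S l).card - 1) -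
        boundReward M X.lo X.hi l (W ∩ X.S l).card := by
  refine Ensures.le (T₁ := 100 * (X.n + 1) + 100 * (X.n + 1)) (Ensures.seq ?_) (by omega)
  refine Ensures.mono (rewardLoop_spec hs (by omega) (by decide) (by decide)
    (P₁ := fun l => (W ∩ X.S l).card < X.lo l) (P₂ := fun l => X.hi l ≤ (W ∩ X.S l).card) ?_ ?_) ?_
    le_rfl
  · intro l hl s' hs' h10
    have hld := hs.same hs' (by decide) (by simp)
    have h7 : s'.nat 7 = s.nat 7 := hs'.nat 7 (by simp)
    simp [h10, hld.lo l hl, h7, hcnt l hl]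
  · intro l hl s' hs' h10
    have hld := hs.same hs' (by decide) (by simp)
    have h7 : s'.nat 7 = s.nat 7 := hs'.nat 7 (by simp)
    simp [h10, hld.hi l hl, h7, hcnt l hl]
  rintro s₁ ⟨hs1, hup⟩
  have hs1L := hs.same hs1 (by decide) (by simp)
  refine Ensures.mono (rewardLoop_spec hs1L (by omega) (by decide) (by decide)
    (P₁ := fun l => X.hi l < (W ∩ X.S l).card) (P₂ := fun l => (W ∩ X.S l).card ≤ X.lo l) ?_ ?_) ?_
    le_rfl
  · intro l hl s' hs' h10
    have hld := hs1L.same hs' (by decide) (by simp)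
    have h7 : s'.nat 7 = s.nat 7 := (hs'.nat 7 (by simp)).trans (hs1.nat 7 (by simp))
    simp [h10, hld.hi l hl, h7, hcnt l hl]
  · intro l hl s' hs' h10
    have hld := hs1L.same hs' (by decide) (by simp)
    have h7 : s'.nat 7 = s.nat 7 := (hs'.nat 7 (by simp)).trans (hs1.nat 7 (by simp))
    simp [h10, hld.lo l hl, h7, hcnt l hl]
  rintro s₂ ⟨hs2, hdn⟩
  refine ⟨hs1.trans hs2 (by simp) (by simp) (by simp) (by simp), fun l hl => ?_, fun l hl => ?_⟩
  · rw [boundReward_succ_sub, hs2.real 2 (by simp), hup l hl, hM]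
    simp
  · rw [boundReward_pred_sub, hdn l hl, hs1.real 1 (by simp), hM]
    simp

/-! ### Arc lengths of the exchange graph -/

/-- The length of the arc from `u` to `v` of the exchange graph, where one of them belongs to `W`
or is the dummy candidate. -/
def arcLength (X : Model) (M : ℝ) (W : Finset ℕ) (u v : ℕ) : ℝ :=
  if v ∈ insert X.m W then
    swapGain (boundReward M X.lo X.hi) X.S (labelsOfPart X.n X.part 1) W v u + X.w u
  else swapGain (boundReward M X.lo X.hi) X.S (labelsOfPart X.n X.part 0) W u v - X.w u

/-- Compute the matrix of the arc lengths. -/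
def lengthProgram : Program :=
  .seq (.seq (assign 13 (.const 0)) (assign 14 (.const 0)))
  (forLoop 15 (.plus exprM (.const 1))
    (.seq
      (.seq (assign 16 (.const 0))
      (forLoop 17 (.plus exprM (.const 1))
        (.seq
          (.seq (.setReal 6 (.const 0) (.const 0))
          (forLoop 10 exprN
            (.branch (.conj (.natEq (.get 2 (scalar 10)) (.get 6 (scalar 15)))
                (.neg (.natEq (.get 1 (.plus (scalar 16) (scalar 10)))
                  (.get 1 (.plus (scalar 14) (scalar 10))))))
              (.branch (.natEq (.get 1 (.plus (scalar 16) (scalar 10))) (.get 6 (scalar 15)))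
                (.setReal 6 (.const 0) (.plus (realScalar 6) (.get 2 (scalar 10))))
                (.setReal 6 (.const 0) (.plus (realScalar 6) (.get 3 (scalar 10)))))
              .skip)))
          (.seq
            (.branch (.natEq (.get 6 (scalar 15)) (.const 1))
              (.setReal 4 (scalar 13) (.plus (realScalar 6) (.get 0 (scalar 17))))
              (.setReal 4 (scalar 13) (.minus (realScalar 6) (.get 0 (scalar 17)))))
            (.seq (increase 13 (.const 1)) (increase 16 exprN))))))
      (increase 14 exprN)))

/-- The innermost loop of `lengthProgram` computes the gain of an exchange. -/
theorem lengthProgram_inner {X : Model} {W : Finset ℕ} {s : Memory} (hs : Loaded X s)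
    {M : ℝ} (hm : HoldsSet X W s)
    (hup : ∀ l < X.n, s.real 2 l = boundReward M X.lo X.hi l ((W ∩ X.S l).card + 1) -
        boundReward M X.lo X.hi l (W ∩ X.S l).card)
    (hdn : ∀ l < X.n, s.real 3 l = boundReward M X.lo X.hi l ((W ∩ X.S l).card - 1) -
        boundReward M X.lo X.hi l (W ∩ X.S l).card)
    {u v : ℕ} (hu : u ≤ X.m) (hv : v ≤ X.m) (h14 : s.nat 14 0 = v * X.n) (h15 : s.nat 15 0 = v)
    (h16 : s.nat 16 0 = u * X.n) (h6 : s.real 6 0 = 0) :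
    Ensures (forLoop 10 exprN
            (.branch (.conj (.natEq (.get 2 (scalar 10)) (.get 6 (scalar 15)))
                (.neg (.natEq (.get 1 (.plus (scalar 16) (scalar 10)))
                  (.get 1 (.plus (scalar 14) (scalar 10))))))
              (.branch (.natEq (.get 1 (.plus (scalar 16) (scalar 10))) (.get 6 (scalar 15)))
                (.setReal 6 (.const 0) (.plus (realScalar 6) (.get 2 (scalar 10))))
                (.setReal 6 (.const 0) (.plus (realScalar 6) (.get 3 (scalar 10)))))
              .skip)) s (X.n * 114 + 11) fun s' =>
      SameOutside [10] [6] s s' ∧ s'.real 6 0 = if v ∈ insert X.m W then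
        swapGain (boundReward M X.lo X.hi) X.S (labelsOfPart X.n X.part 1) W v u
        else swapGain (boundReward M X.lo X.hi) X.S (labelsOfPart X.n X.part 0) W u v := by
  -- The flag of `v` in bank 6 is also the index of the part whose labels count for arcs into `v`,
  -- so one comparison selects the labels for both kinds of arc.
  have hfin : ∀ i, i ≤ X.n → (if v ∈ insert X.m W then
        swapGain (boundReward M X.lo X.hi) X.S (labelsOfPart i X.part 1) W v u
        else swapGain (boundReward M X.lo X.hi) X.S (labelsOfPart i X.part 0) W u v) =
      ∑ l ∈ Finset.range i, if X.part l = (if v ∈ insert X.m W then 1 else 0) then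
        (if v ∈ insert X.m W then setGain (boundReward M X.lo X.hi) X.S W v u l else
          setGain (boundReward M X.lo X.hi) X.S W u v l) else 0 := by
    intro i _
    unfold swapGain labelsOfPart
    split_ifs with h
    · rw [Finset.sum_filter]
    · rw [Finset.sum_filter]
  rw [hfin X.n le_rfl]
  refine Ensures.mono (Ensures.forLoop (N := X.n) (T := 100) (fun i s' => SameOutside [10] [6] s s' ∧
    s'.nat 10 0 = i ∧ s'.real 6 0 = ∑ l ∈ Finset.range i,
      if X.part l = (if v ∈ insert X.m W then 1 else 0) then
        (if v ∈ insert X.m W then setGain (boundReward M X.lo X.hi) X.S W v u l else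
          setGain (boundReward M X.lo X.hi) X.S W u v l) else 0) ?_ ?_ ?_)
    (fun s' h => ⟨h.1, h.2.2⟩) le_rfl
  · exact ⟨(SameOutside.refl _ _ _).writeNat (by simp) _ _, by simp, by simp [h6]⟩
  · rintro i - s' ⟨h1, h2, -⟩
    exact ⟨h2, (hs.same h1 (by decide) (by simp)).n⟩
  · rintro l hl s₂ ⟨hs2, h10, hacc⟩
    have hld := hs.same hs2 (by decide) (by simp)
    have e1 := hld.inc u hu l hl
    have e2 := hld.inc v hv l hl
    have e3 := hld.part l hl
    have e4 := hm v
    rw [← hs2.nat 6 (by simp)] at e4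
    have e5 : s₂.nat 14 0 = v * X.n := by rw [hs2.nat 14 (by simp), h14]
    have e6 : s₂.nat 15 0 = v := by rw [hs2.nat 15 (by simp), h15]
    have e7 : s₂.nat 16 0 = u * X.n := by rw [hs2.nat 16 (by simp), h16]
    have e8 := hup l hl
    rw [← hs2.real 2 (by simp)] at e8
    have e9 := hdn l hl
    rw [← hs2.real 3 (by simp)] at e9
    refine Ensures.of_wp ?_ (by decide)
    simp only [Program.wp, Finset.sum_range_succ, ← hacc]
    simp only [Test.Holds, Test.natEq_holds, NatExpr.eval, scalar_eval, h10, e6, e7, e5, e1, e2,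
      e3, e4]
    refine ⟨fun hb => ⟨fun hb' => ⟨by simp [h10], (hs2.writeReal (by simp) _ _).writeNat (by simp) _ _,
      by simp, ?_⟩, fun hb' => ⟨by simp [h10], (hs2.writeReal (by simp) _ _).writeNat (by simp) _ _,
      by simp, ?_⟩⟩, fun hb => ⟨by simp [h10], hs2.writeNat (by simp) _ _, by simp, ?_⟩⟩
    -- The incidence of `u` agrees with the flag of `v` and differs from the incidence of `v`. In
    -- both directions this says that the entering candidate has the label and the departing one
    -- does not.
    · rw [if_pos hb.1]
      have hb2 := hb.2
      by_cases a1 : u ∈ X.S l <;> by_cases a2 : v ∈ X.S l <;> by_cases a3 : v ∈ insert X.m W <;>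
        simp only [a1, a2, a3, if_true, if_false, not_true, one_ne_zero, zero_ne_one] at hb' hb2 <;>
        simp [a1, a2, a3, setGain, h10, e8]
    · rw [if_pos hb.1]
      have hb2 := hb.2
      by_cases a1 : u ∈ X.S l <;> by_cases a2 : v ∈ X.S l <;> by_cases a3 : v ∈ insert X.m W <;>
        simp only [a1, a2, a3, if_true, if_false, not_true, one_ne_zero, zero_ne_one] at hb' hb2 <;>
        simp [a1, a2, a3, setGain, h10, e9]
    · by_cases a0 : X.part l = if v ∈ insert X.m W then 1 else 0
      · rw [if_pos a0]
        have hb2 : ¬¬ _ := fun h => hb ⟨a0, h⟩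
        by_cases a1 : u ∈ X.S l <;> by_cases a2 : v ∈ X.S l <;>
          simp [a1, a2] at hb2 <;> simp [a1, a2, setGain]
      · rw [if_neg a0]; simp
theorem cost_exprM_succ : (NatExpr.plus exprM (.const 1)).cost = 4 := rfl

/-- Banks 13, 14 and 16 hold the running addresses `v * (m + 1) + u`, `v * n` and `u * n`. The
matrix is grouped by the target `v`, so that the arcs into one vertex are later read consecutively.
-/
theorem lengthProgram_spec {X : Model} {W : Finset ℕ} {s : Memory} (hs : Loaded X s)
    {M : ℝ} (hm : HoldsSet X W s)
    (hup : ∀ l < X.n, s.real 2 l = boundReward M X.lo X.hi l ((W ∩ X.S l).card + 1) -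
        boundReward M X.lo X.hi l (W ∩ X.S l).card)
    (hdn : ∀ l < X.n, s.real 3 l = boundReward M X.lo X.hi l ((W ∩ X.S l).card - 1) -
        boundReward M X.lo X.hi l (W ∩ X.S l).card) :
    Ensures lengthProgram s (300 * ((X.m + 1) ^ 2 * (X.n + 1))) fun s' =>
      SameOutside [10, 13, 14, 15, 16, 17] [4, 6] s s' ∧
      ∀ v ≤ X.m, ∀ u ≤ X.m, s'.real 4 (v * (X.m + 1) + u) = arcLength X M W u v := by
  refine Ensures.le (T₁ := 6 + ((X.m + 1) * ((3 + ((X.m + 1) * (200 * (X.n + 1) + 4 + 12) + 4 + 9)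
    + 10) + 4 + 12) + 4 + 9)) (Ensures.seq (Ensures.of_wp ?_ (by decide))) (by nlinarith)
  simp only [Program.wp, assign]
  refine Ensures.mono (Ensures.forLoop (N := X.m + 1)
    (T := 3 + ((X.m + 1) * (200 * (X.n + 1) + 4 + 12) + 4 + 9) + 10)
    (fun i s' => SameOutside [10, 13, 14, 15, 16, 17] [4, 6] s s' ∧ s'.nat 15 0 = i ∧
      s'.nat 13 0 = i * (X.m + 1) ∧ s'.nat 14 0 = i * X.n ∧
      ∀ v < i, ∀ u ≤ X.m, s'.real 4 (v * (X.m + 1) + u) = arcLength X M W u v) ?_ ?_ ?_)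
    (fun s' h => ⟨h.1, fun v hv => h.2.2.2.2 v (by omega)⟩) (by rw [cost_exprM_succ])
  · exact ⟨(((SameOutside.refl _ _ _).writeNat (by simp) _ _).writeNat (by simp) _ _).writeNat
      (by simp) _ _, by simp, by simp, by simp, by simp⟩
  · rintro i - s' ⟨h1, h2, -⟩
    have := (hs.same h1 (by decide) (by simp)).m
    exact ⟨h2, by simp [exprM, this]⟩
  rintro v hv s₁ ⟨hs1, h15, h13, h14, hmat⟩
  refine Ensures.seq (Ensures.seq (Ensures.of_wp ?_ (by decide)))
  simp only [Program.wp]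
  refine Ensures.mono (Ensures.forLoop (N := X.m + 1) (T := 200 * (X.n + 1))
    (fun i s' => SameOutside [10, 13, 14, 15, 16, 17] [4, 6] s s' ∧ s'.nat 15 0 = v ∧
      s'.nat 17 0 = i ∧ s'.nat 16 0 = i * X.n ∧
      s'.nat 13 0 = v * (X.m + 1) + i ∧ s'.nat 14 0 = v * X.n ∧
      (∀ v' < v, ∀ u ≤ X.m, s'.real 4 (v' * (X.m + 1) + u) = arcLength X M W u v') ∧
      ∀ u < i, s'.real 4 (v * (X.m + 1) + u) = arcLength X M W u v) ?_ ?_ ?_) ?_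
    (by rw [cost_exprM_succ])
  · exact ⟨(hs1.writeNat (by simp) _ _).writeNat (by simp) _ _, by simp [h15], by simp, by simp,
      by simp [h13], by simp [h14], by simpa using hmat, by simp⟩
  · rintro i - s' ⟨h1, -, h2, -⟩
    have := (hs.same h1 (by decide) (by simp)).m
    exact ⟨h2, by simp [exprM, this]⟩
  · rintro u hu s₂ ⟨hs2, h15, h17, h16, h13, h14, hmat, hrow⟩
    have hs2L := hs.same hs2 (by decide) (by simp)
    have h6 : s₂.nat 6 = s.nat 6 := hs2.nat 6 (by simp)
    have hr2 : s₂.real 2 = s.real 2 := hs2.real 2 (by simp)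
    have hr3 : s₂.real 3 = s.real 3 := hs2.real 3 (by simp)
    refine Ensures.le (T₁ := (3 + (X.n * 114 + 11)) + 60) (Ensures.seq (Ensures.seq
      (Ensures.of_wp ?_ (by decide)))) (by omega)
    simp only [Program.wp]
    have hs2' : SameOutside [10, 13, 14, 15, 16, 17] [4, 6] s (s₂.writeReal 6
        (NatExpr.eval s₂ (.const 0)) (RealExpr.eval s₂ (.const 0))) :=
      hs2.writeReal (by simp) _ _
    refine Ensures.mono (lengthProgram_inner (X := X) (W := W) (M := M) (u := u) (v := v)
      (hs.same hs2' (by decide) (by simp)) (fun c => ?_) (fun l hl => ?_) (fun l hl => ?_)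
      (by omega) (by omega) (by simp [h14]) (by simp [h15]) (by simp [h16]) (by simp)) ?_ le_rfl
    · simpa [h6] using hm c
    · simpa [hr2] using hup l hl
    · simpa [hr3] using hdn l hl
    rintro s₃ ⟨hs3, hacc⟩
    have hs3' : SameOutside [10, 13, 14, 15, 16, 17] [4, 6] s s₃ :=
      hs2'.trans hs3 (by simp) (by simp) (by simp) (by simp)
    have hld := hs.same hs3' (by decide) (by simp)
    have g6 : s₃.nat 6 v = _ := (congrFun (hs3'.nat 6 (by simp)) v).trans (hm v)
    have g4 : s₃.real 4 = s₂.real 4 := by rw [hs3.real 4 (by simp)]; simp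
    have g13 : s₃.nat 13 0 = v * (X.m + 1) + u := by rw [hs3.nat 13 (by simp)]; simpa using h13
    have g14 : s₃.nat 14 0 = v * X.n := by rw [hs3.nat 14 (by simp)]; simpa using h14
    have g15 : s₃.nat 15 0 = v := by rw [hs3.nat 15 (by simp)]; simpa using h15
    have g16 : s₃.nat 16 0 = u * X.n := by rw [hs3.nat 16 (by simp)]; simpa using h16
    have g17 : s₃.nat 17 0 = u := by rw [hs3.nat 17 (by simp)]; simpa using h17
    have gw := hld.w u (by omega)
    have gn := hld.n
    have fin : ∀ x, x = arcLength X M W u v →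
        Program.wp ((increase 13 (.const 1)).seq (increase 16 exprN)) (fun s'' =>
          s''.nat 17 0 = u ∧
          SameOutside [10, 13, 14, 15, 16, 17] [4, 6] s (s''.writeNat 17 0 (u + 1)) ∧
          (s''.writeNat 17 0 (u + 1)).nat 15 0 = v ∧
          (s''.writeNat 17 0 (u + 1)).nat 17 0 = u + 1 ∧
          (s''.writeNat 17 0 (u + 1)).nat 16 0 = (u + 1) * X.n ∧
          (s''.writeNat 17 0 (u + 1)).nat 13 0 = v * (X.m + 1) + (u + 1) ∧
          (s''.writeNat 17 0 (u + 1)).nat 14 0 = v * X.n ∧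
          (∀ v' < v, ∀ u_1 ≤ X.m, (s''.writeNat 17 0 (u + 1)).real 4 (v' * (X.m + 1) + u_1) =
            arcLength X M W u_1 v') ∧
          ∀ u_1 < u + 1, (s''.writeNat 17 0 (u + 1)).real 4 (v * (X.m + 1) + u_1) =
            arcLength X M W u_1 v) (s₃.writeReal 4 ((scalar 13).eval s₃) x) := by
      intro x hx
      simp only [Program.wp, increase, assign]
      refine ⟨by simp [g17], (((hs3'.writeReal (by simp) _ _).writeNat (by simp) _ _).writeNat
        (by simp) _ _).writeNat (by simp) _ _, by simp [g15], by simp, ?_, by simp [g13]; rfl,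
        by simp [g14], fun v' hv' u' hu' => ?_, fun u' hu' => ?_⟩
      · simp [g16, exprN, gn]; ring
      · have : v' * (X.m + 1) + u' ≠ v * (X.m + 1) + u := by nlinarith
        simp only [writeNat_real, writeReal_real_same, scalar_eval, g13]
        rw [Function.update_of_ne this, g4, hmat v' hv' u' hu']
      · simp only [writeNat_real, writeReal_real_same, scalar_eval, g13]
        rcases Nat.lt_succ_iff_lt_or_eq.1 hu' with h | rfl
        · rw [Function.update_of_ne (by omega), g4, hrow u' h]
        · rw [Function.update_self, hx]
    refine Ensures.of_wp ?_ (by decide)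
    rw [Program.wp]
    refine ⟨fun hb => fin _ ?_, fun hb => fin _ ?_⟩
    · have hb' : v ∈ insert X.m W := by
        by_contra h
        simp [g15, g6, h] at hb
      simp [hacc, hb', arcLength, g17, gw]
    · have hb' : v ∉ insert X.m W := by
        intro h
        simp [g15, g6, h] at hb
      simp [hacc, hb', arcLength, g17, gw]
  · rintro s₂ ⟨hs2, h15, h17, h16, h13, h14, hmat, hrow⟩
    have gn := (hs.same hs2 (by decide) (by simp)).n
    refine Ensures.of_wp ?_ (by decide)
    simp only [Program.wp, increase, assign]
    refine ⟨by simp [h15], (hs2.writeNat (by simp) _ _).writeNat (by simp) _ _, by simp, ?_, ?_, ?_⟩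
    · simp [h13]; ring
    · simp [h14, exprN, gn]; ring
    · intro v' hv' u hu
      simp only [writeNat_real]
      rcases Nat.lt_succ_iff_lt_or_eq.1 hv' with h | rfl
      · exact hmat v' h u hu
      · exact hrow u (by omega)

/-! ### The table of best walks -/

/-- Exactly one of `u` and `v` belongs to `W` or is the dummy candidate. -/
def Opposite (X : Model) (W : Finset ℕ) (u v : ℕ) : Prop :=
  ¬ (u ∈ insert X.m W ↔ v ∈ insert X.m W)

/-- `t` is the best length of a walk to `v` whose last arc comes from a candidate below `i`, where
`R` is the table for the walks without the last arc. If there is such an arc, `p` is the successor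
of the start of a best one, and otherwise `p = 0`. -/
structure RowEntry (X : Model) (M : ℝ) (W : Finset ℕ) (R : ℕ → ℝ) (v i : ℕ) (t : ℝ) (p : ℕ) :
    Prop where
  le : ∀ u < i, Opposite X W u v → 1 ≤ p ∧ R u + arcLength X M W u v ≤ t
  eq : ∀ u, p = u + 1 → u < i ∧ Opposite X W u v ∧ t = R u + arcLength X M W u v

/-- Pointer `0` records that no arc has been seen. The stored value is then arbitrary, so no value
for minus infinity is needed. -/
theorem RowEntry.zero (X : Model) (M : ℝ) (W : Finset ℕ) (R : ℕ → ℝ) (v : ℕ) (t : ℝ) :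
    RowEntry X M W R v 0 t 0 :=
  ⟨fun u hu => absurd hu (Nat.not_lt_zero u), fun u hu => absurd hu (Nat.succ_ne_zero u).symm⟩

theorem RowEntry.keep {X : Model} {M : ℝ} {W : Finset ℕ} {R : ℕ → ℝ} {v i : ℕ} {t : ℝ} {p : ℕ}
    (h : RowEntry X M W R v i t p)
    (hi : Opposite X W i v → 1 ≤ p ∧ R i + arcLength X M W i v ≤ t) :
    RowEntry X M W R v (i + 1) t p := by
  refine ⟨fun u hu ho => ?_, fun u hu => ?_⟩
  · rcases Nat.lt_succ_iff_lt_or_eq.1 hu with h' | rfl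
    · exact h.le u h' ho
    · exact hi ho
  · obtain ⟨h1, h2⟩ := h.eq u hu
    exact ⟨by omega, h2⟩

theorem RowEntry.replace {X : Model} {M : ℝ} {W : Finset ℕ} {R : ℕ → ℝ} {v i : ℕ} {t : ℝ} {p : ℕ}
    (h : RowEntry X M W R v i t p) (ho : Opposite X W i v)
    (hi : 1 ≤ p → t < R i + arcLength X M W i v) :
    RowEntry X M W R v (i + 1) (R i + arcLength X M W i v) (i + 1) := by
  refine ⟨fun u hu hou => ⟨by omega, ?_⟩, fun u hu => ?_⟩
  · rcases Nat.lt_succ_iff_lt_or_eq.1 hu with h' | rfl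
    · obtain ⟨h1, h2⟩ := h.le u h' hou
      linarith [hi h1]
    · exact le_rfl
  · obtain rfl : i = u := by omega
    exact ⟨by omega, ho, rfl⟩

def exprAddr : NatExpr := .plus (scalar 19) (scalar 15)
def exprSum : RealExpr := .plus (.get 5 (.plus (scalar 18) (scalar 17))) (.get 4 (scalar 13))

/-- Compute the next row of the table of best walks. -/
def rowProgram : Program :=
  .seq (assign 13 (.const 0))
  (.seq
    (forLoop 15 (.plus exprM (.const 1))
      (.seq (.setNat 8 exprAddr (.const 0))
      (.seq
        (forLoop 17 exprM
          (.seq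
            (.branch (.conj (.neg (.natEq (.get 6 (scalar 17)) (.get 6 (scalar 15))))
                (.neg (.conj (.natLe (.const 1) (.get 8 exprAddr))
                  (.realLe exprSum (.get 5 exprAddr)))))
              (.seq (.setReal 5 exprAddr exprSum)
                (.setNat 8 exprAddr (.plus (scalar 17) (.const 1))))
              .skip)
            (increase 13 (.const 1))))
        (increase 13 (.const 1)))))
    (.seq (assign 18 (scalar 19)) (increase 19 (.plus exprM (.const 1)))))

/-- Every row is filled for both sides. Arcs join opposite sides, so the irrelevant half of a row
never reaches the relevant half of the next. Sources stay below `m`, hence the dummy is never an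
inner vertex of a walk; the extra increment of bank 13 skips its column. The hypothesis `hon` keeps
the previous row from being overwritten. -/
theorem rowProgram_spec {X : Model} {W : Finset ℕ} {s : Memory} (hs : Loaded X s)
    {M : ℝ} (hm : HoldsSet X W s)
    (hlen : ∀ v ≤ X.m, ∀ u ≤ X.m, s.real 4 (v * (X.m + 1) + u) = arcLength X M W u v)
    {o nb : ℕ} (h18 : s.nat 18 0 = o) (h19 : s.nat 19 0 = nb) (hon : o + X.m + 1 ≤ nb) :
    Ensures rowProgram s (300 * (X.m + 1) ^ 2) fun s' =>
      SameOutside [8, 13, 15, 17, 18, 19] [5] s s' ∧ s'.nat 18 0 = nb ∧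
      s'.nat 19 0 = nb + (X.m + 1) ∧ (∀ a < nb, s'.nat 8 a = s.nat 8 a ∧ s'.real 5 a = s.real 5 a) ∧
      ∀ v ≤ X.m, RowEntry X M W (fun u => s.real 5 (o + u)) v X.m (s'.real 5 (nb + v))
        (s'.nat 8 (nb + v)) := by
  refine Ensures.le (T₁ := 3 + (((X.m + 1) * ((7 + ((X.m * (100 + 2 + 12) + 2 + 9) + 10)) + 4 + 12) + 4 + 9)
    + 20)) (Ensures.seq (Ensures.of_wp ?_ (by decide))) (by nlinarith)
  simp only [Program.wp, assign]
  refine Ensures.seq ?_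
  refine Ensures.mono (Ensures.forLoop (N := X.m + 1)
    (T := 7 + ((X.m * (100 + 2 + 12) + 2 + 9) + 10))
    (fun i s' => SameOutside [8, 13, 15, 17] [5] s s' ∧ s'.nat 15 0 = i ∧
      s'.nat 13 0 = i * (X.m + 1) ∧
      (∀ a < nb, s'.nat 8 a = s.nat 8 a ∧ s'.real 5 a = s.real 5 a) ∧
      ∀ v < i, RowEntry X M W (fun u => s.real 5 (o + u)) v X.m (s'.real 5 (nb + v))
        (s'.nat 8 (nb + v))) ?_ ?_ ?_) ?_ (by rw [cost_exprM_succ])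
  · exact ⟨((SameOutside.refl _ _ _).writeNat (by simp) _ _).writeNat
      (by simp) _ _, by simp, by simp, by simp, by simp⟩
  · rintro i - s' ⟨h1, h2, -⟩
    have := (hs.same h1 (by decide) (by simp)).m
    exact ⟨h2, by simp [exprM, this]⟩
  · rintro v hv s₁ ⟨hs1, h15, h13, hold, hent⟩
    have h19' : s₁.nat 19 0 = nb := by rw [hs1.nat 19 (by simp), h19]
    refine Ensures.seq (Ensures.of_wp ?_ (by decide))
    simp only [Program.wp]
    refine Ensures.seq ?_
    refine Ensures.mono (Ensures.forLoop (N := X.m) (T := 100)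
      (fun i s' => SameOutside [8, 13, 15, 17] [5] s s' ∧ s'.nat 15 0 = v ∧ s'.nat 17 0 = i ∧
        s'.nat 13 0 = v * (X.m + 1) + i ∧
        (∀ a < nb, s'.nat 8 a = s.nat 8 a ∧ s'.real 5 a = s.real 5 a) ∧
        (∀ v' < v, RowEntry X M W (fun u => s.real 5 (o + u)) v' X.m (s'.real 5 (nb + v'))
          (s'.nat 8 (nb + v'))) ∧
        RowEntry X M W (fun u => s.real 5 (o + u)) v i (s'.real 5 (nb + v)) (s'.nat 8 (nb + v)))
      ?_ ?_ ?_) ?_ le_rfl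
    · refine ⟨(hs1.writeNat (by simp) _ _).writeNat (by simp) _ _, by simp [h15], by simp,
        by simp [h13], fun a ha => ?_, fun v' hv' => ?_, ?_⟩
      · have : a ≠ nb + v := by omega
        simpa [exprAddr, h19', h15, this] using hold a ha
      · have : nb + v' ≠ nb + v := by omega
        have h := hent v' hv'
        simpa [exprAddr, h19', h15, hv'.ne] using h
      · simpa [exprAddr, h19', h15] using RowEntry.zero X M W _ v _
    · rintro i - s' ⟨h1, -, h2, -⟩
      exact ⟨h2, (hs.same h1 (by decide) (by simp)).m⟩
    · rintro u hu s₂ ⟨hs2, h15, h17, h13, hold, hent, hcur⟩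
      have g6u : s₂.nat 6 u = _ := (congrFun (hs2.nat 6 (by simp)) u).trans (hm u)
      have g6v : s₂.nat 6 v = _ := (congrFun (hs2.nat 6 (by simp)) v).trans (hm v)
      have g18 : s₂.nat 18 0 = o := by rw [hs2.nat 18 (by simp), h18]
      have g19 : s₂.nat 19 0 = nb := by rw [hs2.nat 19 (by simp), h19]
      have g4 : s₂.real 4 (v * (X.m + 1) + u) = arcLength X M W u v := by
        rw [hs2.real 4 (by simp), hlen v (by omega) u (by omega)]
      have g5 : s₂.real 5 (o + u) = s.real 5 (o + u) := (hold (o + u) (by omega)).2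
      have hopp : ¬ ((if u ∈ insert X.m W then 1 else 0) = if v ∈ insert X.m W then 1 else 0) ↔
          Opposite X W u v := by
        unfold Opposite
        by_cases a1 : u ∈ insert X.m W <;> by_cases a2 : v ∈ insert X.m W <;>
          simp only [a1, a2, if_true, if_false] <;> decide
      have haddr : exprAddr.eval s₂ = nb + v := by simp [exprAddr, g19, h15]
      have hsum : exprSum.eval s₂ = s.real 5 (o + u) + arcLength X M W u v := by
        simp [exprSum, g18, h17, g5, h13, g4]
      have haddr' : ∀ x, exprAddr.eval (s₂.writeReal 5 (nb + v) x) = nb + v := fun x => by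
        simp [exprAddr, g19, h15]
      refine Ensures.of_wp ?_ (by decide)
      simp only [Program.wp, assign, increase, haddr, hsum, haddr']
      refine ⟨fun hb => ⟨by simp [h17], (((hs2.writeReal (by simp) _ _).writeNat (by simp) _ _).writeNat
        (by simp) _ _).writeNat (by simp) _ _, by simp [h15], by simp, ?_, fun a ha => ?_,
        fun v' hv' => ?_, ?_⟩, fun hb => ⟨by simp [h17], (hs2.writeNat (by simp) _ _).writeNat
        (by simp) _ _, by simp [h15], by simp, ?_, ?_, ?_, ?_⟩⟩
      · simp [h13]; ring
      · have : a ≠ nb + v := by omega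
        simpa [this] using hold a ha
      · simpa [hv'.ne] using hent v' hv'
      · simp only [Test.Holds, Test.natEq_holds, NatExpr.eval, scalar_eval, h17, h15, g6u, g6v,
          hopp, haddr, hsum, RealExpr.eval, not_and, not_le] at hb
        have := hcur.replace hb.1 hb.2
        simpa [h17] using this
      · simp [h13]; ring
      · simpa using hold
      · simpa using hent
      · simp only [Test.Holds, Test.natEq_holds, NatExpr.eval, scalar_eval, h17, h15, g6u, g6v,
          hopp, haddr, hsum, RealExpr.eval, not_and] at hb
        have := hcur.keep fun ho => by have := hb ho; tauto
        simpa using this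
    · rintro s₂ ⟨hs2, h15, h17, h13, hold, hent, hcur⟩
      refine Ensures.of_wp ?_ (by decide)
      simp only [Program.wp, assign, increase]
      refine ⟨by simp [h15], (hs2.writeNat (by simp) _ _).writeNat (by simp) _ _, by simp, ?_,
        by simpa using hold, fun v' hv' => ?_⟩
      · simp [h13]; ring
      · rcases Nat.lt_succ_iff_lt_or_eq.1 hv' with h | rfl
        · simpa using hent v' h
        · simpa using hcur
  · rintro s₁ ⟨hs1, h15, h13, hold, hent⟩
    have hm' := (hs.same hs1 (by decide) (by simp)).m
    have h19' : s₁.nat 19 0 = nb := by rw [hs1.nat 19 (by simp), h19]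
    have hs1' : SameOutside [8, 13, 15, 17, 18, 19] [5] s s₁ :=
      hs1.trans (SameOutside.refl [] [] _) (by simp) (by simp) (by simp) (by simp)
    refine Ensures.of_wp ?_ (by decide)
    simp only [Program.wp, assign, increase]
    refine ⟨(hs1'.writeNat (by simp) _ _).writeNat (by simp) _ _, by simp [h19'], ?_,
      by simpa using hold, fun v hv => ?_⟩
    · simp [exprM, h19', hm']
    · simpa using hent v (by omega)

/-- Initialize the table of best walks with the arcs from the dummy candidate. -/
def startProgram : Program :=
  .seq (assign 13 exprM)
    (forLoop 15 (.plus exprM (.const 1))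
      (.seq (.setReal 5 (scalar 15) (.get 4 (scalar 13)))
        (increase 13 (.plus exprM (.const 1)))))

/-- The arcs that leave the dummy form column `m` of the matrix. The entries at members are
meaningless and belong to the irrelevant half of row 0. -/
theorem startProgram_spec {X : Model} {W : Finset ℕ} {s : Memory} (hs : Loaded X s) {M : ℝ}
    (hlen : ∀ v ≤ X.m, ∀ u ≤ X.m, s.real 4 (v * (X.m + 1) + u) = arcLength X M W u v) :
    Ensures startProgram s (100 * (X.m + 1)) fun s' => SameOutside [13, 15] [5] s s' ∧
      ∀ v ≤ X.m, s'.real 5 v = arcLength X M W X.m v := by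
  refine Ensures.le (T₁ := 10 + ((X.m + 1) * (20 + 4 + 12) + 4 + 9))
    (Ensures.seq (Ensures.of_wp ?_ (by decide))) (by omega)
  simp only [Program.wp, assign]
  refine Ensures.mono (Ensures.forLoop (N := X.m + 1) (T := 20)
    (fun i s' => SameOutside [13, 15] [5] s s' ∧ s'.nat 15 0 = i ∧
      s'.nat 13 0 = i * (X.m + 1) + X.m ∧ ∀ v < i, s'.real 5 v = arcLength X M W X.m v) ?_ ?_ ?_)
    (fun s' h => ⟨h.1, fun v hv => h.2.2.2 v (by omega)⟩) (by rw [cost_exprM_succ])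
  · exact ⟨((SameOutside.refl _ _ _).writeNat (by simp) _ _).writeNat
      (by simp) _ _, by simp, by simp [exprM, hs.m], by simp⟩
  · rintro i - s' ⟨h1, h2, -⟩
    have := (hs.same h1 (by decide) (by simp)).m
    exact ⟨h2, by simp [exprM, this]⟩
  · rintro v hv s₁ ⟨hs1, h15, h13, hent⟩
    have hm' := (hs.same hs1 (by decide) (by simp)).m
    have g4 : s₁.real 4 (v * (X.m + 1) + X.m) = arcLength X M W X.m v := by
      rw [hs1.real 4 (by simp), hlen v (by omega) X.m le_rfl]
    refine Ensures.of_wp ?_ (by decide)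
    simp only [Program.wp, assign, increase]
    refine ⟨by simp [h15], ((hs1.writeReal (by simp) _ _).writeNat (by simp) _ _).writeNat
      (by simp) _ _, by simp, ?_, fun v' hv' => ?_⟩
    · simp [h13, exprM, hm']; ring
    · rcases Nat.lt_succ_iff_lt_or_eq.1 hv' with h | rfl
      · simp [h15, h.ne, hent v' h]
      · simp [h15, h13, g4]

theorem row_address_lt {r N m v : ℕ} (hr : r < N) (hv : v ≤ m) :
    r * (m + 1) + v < N * (m + 1) :=
  calc r * (m + 1) + v < (r + 1) * (m + 1) := by rw [Nat.succ_mul]; omega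
    _ ≤ N * (m + 1) := Nat.mul_le_mul_right _ hr

/-- The rows `1, …, N` of the table `T` with pointers `P` extend the walks of the previous row. -/
def TableRows (X : Model) (M : ℝ) (W : Finset ℕ) (T : ℕ → ℝ) (P : ℕ → ℕ) (N : ℕ) : Prop :=
  ∀ r < N, ∀ v ≤ X.m, RowEntry X M W (fun u => T (r * (X.m + 1) + u)) v X.m
    (T ((r + 1) * (X.m + 1) + v)) (P ((r + 1) * (X.m + 1) + v))

theorem RowEntry.congr {X : Model} {M : ℝ} {W : Finset ℕ} {R R' : ℕ → ℝ} {v i : ℕ} {t : ℝ} {p : ℕ}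
    (h : RowEntry X M W R v i t p) (hR : ∀ u < i, R' u = R u) : RowEntry X M W R' v i t p := by
  refine ⟨fun u hu ho => ?_, fun u hu => ?_⟩
  · rw [hR u hu]; exact h.le u hu ho
  · rw [hR u (h.eq u hu).1]; exact h.eq u hu

theorem TableRows.congr {X : Model} {M : ℝ} {W : Finset ℕ} {T T' : ℕ → ℝ} {P P' : ℕ → ℕ} {N : ℕ}
    (h : TableRows X M W T P N)
    (he : ∀ a < (N + 1) * (X.m + 1), P' a = P a ∧ T' a = T a) : TableRows X M W T' P' N := by
  intro r hr v hv
  have h1 : (r + 1) * (X.m + 1) + v < (N + 1) * (X.m + 1) := row_address_lt (by omega) hv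
  rw [(he _ h1).1, (he _ h1).2]
  refine (h r hr v hv).congr fun u hu => (he _ ?_).2
  exact row_address_lt (by omega) hu.le

theorem TableRows.succ {X : Model} {M : ℝ} {W : Finset ℕ} {T T' : ℕ → ℝ} {P P' : ℕ → ℕ} {N : ℕ}
    (h : TableRows X M W T P N)
    (he : ∀ a < (N + 1) * (X.m + 1), P' a = P a ∧ T' a = T a)
    (hrow : ∀ v ≤ X.m, RowEntry X M W (fun u => T (N * (X.m + 1) + u)) v X.m
      (T' ((N + 1) * (X.m + 1) + v)) (P' ((N + 1) * (X.m + 1) + v))) :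
    TableRows X M W T' P' (N + 1) := by
  intro r hr v hv
  rcases Nat.lt_succ_iff_lt_or_eq.1 hr with h' | rfl
  · exact h.congr he r h' v hv
  · refine (hrow v hv).congr fun u hu => (he _ ?_).2
    exact row_address_lt (by omega) hu.le

def exprClose : RealExpr := .get 5 (.plus (scalar 18) exprM)

/-- Compute all rows of the table, and the first odd row with the best closed walk. -/
def roundsProgram : Program :=
  .seq (.seq (assign 18 (.const 0)) (assign 19 (.plus exprM (.const 1))))
  (forLoop 20 (.plus (scalar 21) (.const 1))
    (.seq rowProgram
    (.seq
      (.branch (.neg (.conj (.natLe (.const 1) (scalar 20)) (.realLe exprClose (realScalar 7))))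
        (.seq (.setReal 7 (.const 0) exprClose)
          (.seq (assign 22 (scalar 18)) (assign 23 (scalar 20))))
        .skip)
      rowProgram)))

/-- The row `2 * r + 1` is the first odd row below `2 * j` with the best closed walk. -/
structure BestRow (X : Model) (T : ℕ → ℝ) (j r : ℕ) : Prop where
  lt : r < j
  le : ∀ i < j, T ((2 * i + 1) * (X.m + 1) + X.m) ≤ T ((2 * r + 1) * (X.m + 1) + X.m)
  first : ∀ i < r, T ((2 * i + 1) * (X.m + 1) + X.m) < T ((2 * r + 1) * (X.m + 1) + X.m)

theorem BestRow.congr {X : Model} {T T' : ℕ → ℝ} {j r : ℕ} (h : BestRow X T j r)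
    (he : ∀ a < 2 * j * (X.m + 1), T' a = T a) : BestRow X T' j r := by
  have hlt := h.lt
  have h1 : ∀ i < j, T' ((2 * i + 1) * (X.m + 1) + X.m) = T ((2 * i + 1) * (X.m + 1) + X.m) :=
    fun i hi => he _ (row_address_lt (by omega) le_rfl)
  exact ⟨hlt, fun i hi => by rw [h1 i hi, h1 r hlt]; exact h.le i hi,
    fun i hi => by rw [h1 i (by omega), h1 r hlt]; exact h.first i hi⟩

theorem cost_scalar_succ (x : ℕ) : (NatExpr.plus (scalar x) (.const 1)).cost = 4 := rfl

-- Round `i` fills row `2 * i + 1`, whose entry at the dummy values the best closed walk with `i +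
-- 1` entrances, and then row `2 * i + 2`. After round 0 the record changes only on strict
-- improvement, so it marks the first maximum, as uncrossing requires.
set_option maxHeartbeats 800000 in
theorem roundsProgram_spec {X : Model} {W : Finset ℕ} {s : Memory} (hs : Loaded X s)
    {M : ℝ} (hm : HoldsSet X W s)
    (hlen : ∀ v ≤ X.m, ∀ u ≤ X.m, s.real 4 (v * (X.m + 1) + u) = arcLength X M W u v)
    (hstart : ∀ v ≤ X.m, s.real 5 v = arcLength X M W X.m v) {j : ℕ} (hj : s.nat 21 0 = j) :
    Ensures roundsProgram s (800 * ((j + 1) * (X.m + 1) ^ 2)) fun s' =>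
      SameOutside [8, 13, 15, 17, 18, 19, 20, 22, 23] [5, 7] s s' ∧
      (∀ v ≤ X.m, s'.real 5 v = arcLength X M W X.m v) ∧
      TableRows X M W (s'.real 5) (s'.nat 8) (2 * (j + 1)) ∧
      ∃ r, BestRow X (s'.real 5) (j + 1) r ∧ s'.nat 23 0 = r ∧
        s'.nat 22 0 = (2 * r + 1) * (X.m + 1) := by
  refine Ensures.le (T₁ := 10 + ((j + 1) * ((300 * (X.m + 1) ^ 2 + (60 + 300 * (X.m + 1) ^ 2)) + 4 + 12) + 4 + 9))
    (Ensures.seq (Ensures.of_wp ?_ (by decide))) ?_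
  swap
  · have : 1 ≤ (X.m + 1) ^ 2 := Nat.one_le_pow _ _ (by omega)
    nlinarith
  simp only [Program.wp, assign]
  refine Ensures.mono (Ensures.forLoop (N := j + 1)
    (T := 300 * (X.m + 1) ^ 2 + (60 + 300 * (X.m + 1) ^ 2))
    (fun i s' => SameOutside [8, 13, 15, 17, 18, 19, 20, 22, 23] [5, 7] s s' ∧ s'.nat 20 0 = i ∧
      s'.nat 18 0 = 2 * i * (X.m + 1) ∧ s'.nat 19 0 = (2 * i + 1) * (X.m + 1) ∧
      (∀ v ≤ X.m, s'.real 5 v = arcLength X M W X.m v) ∧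
      TableRows X M W (s'.real 5) (s'.nat 8) (2 * i) ∧
      (i = 0 ∨ ∃ r, BestRow X (s'.real 5) i r ∧ s'.nat 23 0 = r ∧
        s'.nat 22 0 = (2 * r + 1) * (X.m + 1) ∧
        s'.real 7 0 = s'.real 5 ((2 * r + 1) * (X.m + 1) + X.m))) ?_ ?_ ?_) ?_
    (by rw [cost_scalar_succ])
  · refine ⟨(((SameOutside.refl _ _ _).writeNat (by simp) _ _).writeNat (by simp) _ _).writeNat
      (by simp) _ _, by simp, by simp, by simp [exprM, hs.m], by simpa using hstart, ?_, by simp⟩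
    intro r hr; omega
  · rintro i - s' ⟨h1, h2, -⟩
    refine ⟨h2, ?_⟩
    simp [h1.nat 21 (by simp), hj]
  · rintro i hi s₁ ⟨hs1, h20, h18, h19, hst, hrows, hbest⟩
    have hs1L := hs.same hs1 (by decide) (by simp)
    have hm1 : HoldsSet X W s₁ := fun c => (congrFun (hs1.nat 6 (by simp)) c).trans (hm c)
    have hlen1 : ∀ v ≤ X.m, ∀ u ≤ X.m, s₁.real 4 (v * (X.m + 1) + u) = arcLength X M W u v := by
      intro v hv u hu
      rw [hs1.real 4 (by simp), hlen v hv u hu]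
    refine Ensures.seq (Ensures.mono (rowProgram_spec hs1L hm1 hlen1 h18 h19 (by nlinarith)) ?_ le_rfl)
    rintro s₂ ⟨hs2, h18', h19', hold, hrow⟩
    have hs2' : SameOutside [8, 13, 15, 17, 18, 19, 20, 22, 23] [5, 7] s s₂ :=
      hs1.trans hs2 (by simp) (by simp) (by simp) (by simp)
    have h20' : s₂.nat 20 0 = i := by rw [hs2.nat 20 (by simp), h20]
    have hrows2 : TableRows X M W (s₂.real 5) (s₂.nat 8) (2 * i + 1) := hrows.succ hold hrow
    have hst2 : ∀ v ≤ X.m, s₂.real 5 v = arcLength X M W X.m v := fun v hv => by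
      rw [(hold v ((row_address_lt (r := 0) (by omega) hv).trans_eq' (by simp))).2, hst v hv]
    have hbest2 : i = 0 ∨ ∃ r, BestRow X (s₂.real 5) i r ∧ s₂.nat 23 0 = r ∧
        s₂.nat 22 0 = (2 * r + 1) * (X.m + 1) ∧
        s₂.real 7 0 = s₂.real 5 ((2 * r + 1) * (X.m + 1) + X.m) := by
      rcases hbest with h | ⟨r, hr, h23, h22, h7⟩
      · exact Or.inl h
      · refine Or.inr ⟨r, hr.congr fun a ha => (hold a (ha.trans_le (Nat.mul_le_mul_right _ (by omega)))).2, ?_, ?_, ?_⟩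
        · rw [hs2.nat 23 (by simp), h23]
        · rw [hs2.nat 22 (by simp), h22]
        · have := hr.lt
          rw [hs2.real 7 (by simp), h7, (hold _ (row_address_lt (by omega) le_rfl)).2]
    have hm' := (hs.same hs2' (by decide) (by simp)).m
    have hclose : exprClose.eval s₂ = s₂.real 5 ((2 * i + 1) * (X.m + 1) + X.m) := by
      simp [exprClose, h18', exprM, hm']
    -- the memory after the comparison
    have tail : ∀ s₃, SameOutside [22, 23] [7] s₂ s₃ →
        (∃ r, BestRow X (s₂.real 5) (i + 1) r ∧ s₃.nat 23 0 = r ∧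
          s₃.nat 22 0 = (2 * r + 1) * (X.m + 1) ∧
          s₃.real 7 0 = s₂.real 5 ((2 * r + 1) * (X.m + 1) + X.m)) →
        Ensures rowProgram s₃ (300 * (X.m + 1) ^ 2) fun s'' => s''.nat 20 0 = i ∧
          SameOutside [8, 13, 15, 17, 18, 19, 20, 22, 23] [5, 7] s (s''.writeNat 20 0 (i + 1)) ∧
          (s''.writeNat 20 0 (i + 1)).nat 20 0 = i + 1 ∧
          (s''.writeNat 20 0 (i + 1)).nat 18 0 = 2 * (i + 1) * (X.m + 1) ∧
          (s''.writeNat 20 0 (i + 1)).nat 19 0 = (2 * (i + 1) + 1) * (X.m + 1) ∧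
          (∀ v ≤ X.m, (s''.writeNat 20 0 (i + 1)).real 5 v = arcLength X M W X.m v) ∧
          TableRows X M W ((s''.writeNat 20 0 (i + 1)).real 5)
            ((s''.writeNat 20 0 (i + 1)).nat 8) (2 * (i + 1)) ∧
          (i + 1 = 0 ∨ ∃ r, BestRow X ((s''.writeNat 20 0 (i + 1)).real 5) (i + 1) r ∧
            (s''.writeNat 20 0 (i + 1)).nat 23 0 = r ∧
            (s''.writeNat 20 0 (i + 1)).nat 22 0 = (2 * r + 1) * (X.m + 1) ∧
            (s''.writeNat 20 0 (i + 1)).real 7 0 =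
              (s''.writeNat 20 0 (i + 1)).real 5 ((2 * r + 1) * (X.m + 1) + X.m)) := by
      rintro s₃ hs3 ⟨r, hr, h23, h22, h7⟩
      have hs3' : SameOutside [8, 13, 15, 17, 18, 19, 20, 22, 23] [5, 7] s s₃ :=
        hs2'.trans hs3 (by simp) (by simp) (by simp) (by simp)
      have hm3 : HoldsSet X W s₃ := fun c => (congrFun (hs3'.nat 6 (by simp)) c).trans (hm c)
      have hlen3 : ∀ v ≤ X.m, ∀ u ≤ X.m, s₃.real 4 (v * (X.m + 1) + u) = arcLength X M W u v := by
        intro v hv u hu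
        rw [hs3'.real 4 (by simp), hlen v hv u hu]
      have g18 : s₃.nat 18 0 = (2 * i + 1) * (X.m + 1) := by rw [hs3.nat 18 (by simp), h18']
      have g19 : s₃.nat 19 0 = (2 * i + 2) * (X.m + 1) := by
        rw [hs3.nat 19 (by simp), h19']; ring
      have g5 : s₃.real 5 = s₂.real 5 := hs3.real 5 (by simp)
      have g8 : s₃.nat 8 = s₂.nat 8 := hs3.nat 8 (by simp)
      refine Ensures.mono (rowProgram_spec (hs.same hs3' (by decide) (by simp)) hm3 hlen3 g18 g19
        (by nlinarith)) ?_ le_rfl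
      rintro s₄ ⟨hs4, f18, f19, hold4, hrow4⟩
      rw [g5, g8] at hold4
      rw [g5] at hrow4
      have hs4' : SameOutside [8, 13, 15, 17, 18, 19, 20, 22, 23] [5, 7] s s₄ :=
        hs3'.trans hs4 (by simp) (by simp) (by simp) (by simp)
      refine ⟨?_, hs4'.writeNat (by simp) _ _, by simp, ?_, ?_, ?_, ?_, Or.inr ⟨r, ?_, ?_, ?_, ?_⟩⟩
      · rw [hs4.nat 20 (by simp), hs3.nat 20 (by simp), h20']
      · simp [f18]; ring
      · simp [f19]; ring
      · intro v hv
        rw [writeNat_real, (hold4 v ((row_address_lt (r := 0) (by omega) hv).trans_eq' (by simp))).2, hst2 v hv]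
      · rw [show 2 * (i + 1) = 2 * i + 1 + 1 by ring]
        simpa using hrows2.succ hold4 hrow4
      · rw [writeNat_real]
        exact hr.congr fun a ha => (hold4 a (ha.trans_le (Nat.mul_le_mul_right _ (by omega)))).2
      · simp [hs4.nat 23 (by simp), h23]
      · simp [hs4.nat 22 (by simp), h22]
      · have := hr.lt
        rw [writeNat_real, hs4.real 7 (by simp), h7, (hold4 _ (row_address_lt (by omega) le_rfl)).2]
    refine Ensures.seq (Ensures.of_wp ?_ (by decide))
    simp only [Program.wp]
    refine ⟨fun hb => tail _ ?_ ⟨i, ⟨by omega, ?_, ?_⟩, ?_, ?_, ?_⟩, fun hb => tail _ ?_ ?_⟩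
    · exact (((SameOutside.refl _ _ _).writeReal (by simp) _ _).writeNat (by simp) _ _).writeNat
        (by simp) _ _
    · intro i' hi'
      rcases Nat.lt_succ_iff_lt_or_eq.1 hi' with h | rfl
      · rcases hbest2 with rfl | ⟨r, hr, h23, h22, h7⟩
        · omega
        · have h1 : 1 ≤ i := by omega
          simp only [Test.Holds, NatExpr.eval, scalar_eval, h20', realScalar_eval, hclose, h7, not_and,
            not_le] at hb
          exact (hr.le i' h).trans (hb h1).le
      · exact le_rfl
    · intro i' h
      rcases hbest2 with rfl | ⟨r, hr, h23, h22, h7⟩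
      · omega
      · have h1 : 1 ≤ i := by omega
        simp only [Test.Holds, NatExpr.eval, scalar_eval, h20', realScalar_eval, hclose, h7, not_and,
          not_le] at hb
        exact (hr.le i' h).trans_lt (hb h1)
    · simp [h20']
    · simp [h18']
    · simp [hclose]
    · exact SameOutside.refl _ _ _
    · simp only [Test.Holds, NatExpr.eval, scalar_eval, h20', realScalar_eval, hclose, not_not] at hb
      rcases hbest2 with rfl | ⟨r, hr, h23, h22, h7⟩
      · omega
      · refine ⟨r, ⟨by have := hr.lt; omega, fun i' hi' => ?_, hr.first⟩, h23, h22, h7⟩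
        rcases Nat.lt_succ_iff_lt_or_eq.1 hi' with h | rfl
        · exact hr.le i' h
        · rw [← h7]; exact hb.2
  · rintro s₁ ⟨hs1, h20, h18, h19, hst, hrows, hbest⟩
    refine ⟨hs1, hst, hrows, ?_⟩
    rcases hbest with h | ⟨r, hr, h23, h22, h7⟩
    · omega
    · exact ⟨r, hr, h23, h22⟩

/-! ### From table and pointers to the walk -/

/-- A nonmember, as an element of the complement of the committee. -/
theorem mem_complement {X : Model} {W : Finset ℕ} {c : ℕ} :
    c ∈ Finset.range X.m \ W ↔ c < X.m ∧ c ∉ insert X.m W := by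
  rw [Finset.mem_sdiff, Finset.mem_range, Finset.mem_insert]
  constructor
  · rintro ⟨h1, h2⟩; exact ⟨h1, by rintro (rfl | h) <;> [omega; exact h2 h]⟩
  · rintro ⟨h1, h2⟩; exact ⟨h1, fun h => h2 (Or.inr h)⟩

theorem arcLength_leave {X : Model} {M : ℝ} {W : Finset ℕ} {d : ℕ} (hd : d ∈ insert X.m W) (c : ℕ) :
    arcLength X M W c d =
      swapGain (boundReward M X.lo X.hi) X.S (labelsOfPart X.n X.part 1) W d c + X.w c := by
  rw [arcLength, if_pos hd]

theorem arcLength_enter {X : Model} {M : ℝ} {W : Finset ℕ} {c : ℕ} (hc : c ∉ insert X.m W) (d : ℕ) :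
    arcLength X M W d c =
      swapGain (boundReward M X.lo X.hi) X.S (labelsOfPart X.n X.part 0) W d c - X.w d := by
  rw [arcLength, if_neg hc]

/-- The pointers of the odd rows. -/
theorem TableRows.leave {X : Model} {M : ℝ} {W : Finset ℕ} (hW : W ⊆ Finset.range X.m)
    (hjm : W.card < X.m) {T : ℕ → ℝ} {P : ℕ → ℕ} {N : ℕ} (hrows : TableRows X M W T P N)
    {i : ℕ} (hi : 2 * i < N) {d : ℕ} (hd : d ∈ insert X.m W) {u : ℕ}
    (hu : u = P ((2 * i + 1) * (X.m + 1) + d) - 1) :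
    u ∈ Finset.range X.m \ W ∧ T ((2 * i + 1) * (X.m + 1) + d) = T (2 * i * (X.m + 1) + u) + X.w u +
      swapGain (boundReward M X.lo X.hi) X.S (labelsOfPart X.n X.part 1) W d u := by
  have hdm : d ≤ X.m := by
    rcases Finset.mem_insert.1 hd with rfl | hd
    · exact le_rfl
    · exact (Finset.mem_range.1 (hW hd)).le
  have hrow := hrows (2 * i) hi d hdm
  -- A nonmember exists as `W` has fewer than `m` elements. It forces the pointer to be positive, so
  -- subtracting one yields a genuine predecessor.
  obtain ⟨c, hc⟩ : ∃ c, c ∈ Finset.range X.m \ W := by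
    apply Finset.card_pos.1
    rw [Finset.card_sdiff_of_subset hW, Finset.card_range]
    omega
  obtain ⟨h1, h2⟩ := mem_complement.1 hc
  have h0 := (hrow.le c h1 (fun h => h2 (h.2 hd))).1
  obtain ⟨h3, h4, h5⟩ := hrow.eq u (by omega)
  refine ⟨mem_complement.2 ⟨h3, fun h => h4 (iff_of_true h hd)⟩, ?_⟩
  rw [arcLength_leave hd] at h5
  linarith

/-- The pointers of the even rows. -/
theorem TableRows.enter {X : Model} {M : ℝ} {W : Finset ℕ} (hW : W ⊆ Finset.range X.m)
    (hWne : W.Nonempty) {T : ℕ → ℝ} {P : ℕ → ℕ} {N : ℕ} (hrows : TableRows X M W T P N)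
    {i : ℕ} (hi : 2 * i + 1 < N) {c : ℕ} (hc : c ∈ Finset.range X.m \ W) {u : ℕ}
    (hu : u = P (2 * (i + 1) * (X.m + 1) + c) - 1) :
    u ∈ W ∧ T (2 * (i + 1) * (X.m + 1) + c) = T ((2 * i + 1) * (X.m + 1) + u) - X.w u +
      swapGain (boundReward M X.lo X.hi) X.S (labelsOfPart X.n X.part 0) W u c := by
  obtain ⟨h1, h2⟩ := mem_complement.1 hc
  rw [show 2 * (i + 1) = 2 * i + 1 + 1 by ring] at hu ⊢
  have hrow := hrows (2 * i + 1) hi c h1.le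
  obtain ⟨d, hd⟩ := hWne
  have hd' := Finset.mem_insert_of_mem (b := X.m) hd
  have h0 := (hrow.le d (Finset.mem_range.1 (hW hd)) (fun h => h2 (h.1 hd'))).1
  obtain ⟨h3, h4, h5⟩ := hrow.eq u (by omega)
  have hu' : u ∈ insert X.m W := by
    by_contra h; exact h4 (iff_of_false h h2)
  refine ⟨(Finset.mem_insert.1 hu').resolve_left h3.ne, ?_⟩
  rw [arcLength_enter h2] at h5
  linarith

/-- The table of best walks, in the form used for the exchange argument. -/
theorem TableRows.isWalkTable {X : Model} {M : ℝ} {W : Finset ℕ} (hW : W ⊆ Finset.range X.m)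
    {j : ℕ} (hj : W.card = j) (hjm : j < X.m) {T : ℕ → ℝ} {P : ℕ → ℕ}
    (hrows : TableRows X M W T P (2 * (j + 1)))
    (hstart : ∀ v ≤ X.m, T v = arcLength X M W X.m v) :
    IsWalkTable (swapGain (boundReward M X.lo X.hi) X.S (labelsOfPart X.n X.part 0) W)
      (swapGain (boundReward M X.lo X.hi) X.S (labelsOfPart X.n X.part 1) W) X.w X.m W
      (Finset.range X.m \ W) j (fun i v => T (2 * i * (X.m + 1) + v))
      (fun i v => T ((2 * i + 1) * (X.m + 1) + v)) := by
  refine ⟨fun c hc => ?_, fun i hi d hd c hc => ?_, fun i hi d hd => ?_, fun i hi c hc d hd => ?_,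
    fun i hi c hc => ?_⟩
  · obtain ⟨h1, h2⟩ := mem_complement.1 hc
    simp only [Nat.mul_zero, Nat.zero_mul, Nat.zero_add]
    rw [hstart c h1.le, arcLength_enter h2, X.w_dummy, sub_zero]
  · obtain ⟨h1, h2⟩ := mem_complement.1 hc
    have hdm : d ≤ X.m := by
      rcases Finset.mem_insert.1 hd with rfl | hd
      · exact le_rfl
      · exact (Finset.mem_range.1 (hW hd)).le
    have := ((hrows (2 * i) (by omega) d hdm).le c h1 (fun h => h2 (h.2 hd))).2
    rw [arcLength_leave hd] at this
    linarith
  · exact ⟨_, hrows.leave hW (by omega) (by omega) hd rfl⟩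
  · obtain ⟨h1, h2⟩ := mem_complement.1 hc
    have hd' := Finset.mem_insert_of_mem (b := X.m) hd
    have := ((hrows (2 * i + 1) (by omega) c h1.le).le d (Finset.mem_range.1 (hW hd))
      (fun h => h2 (h.1 hd'))).2
    rw [arcLength_enter h2] at this
    show _ ≤ T (2 * (i + 1) * (X.m + 1) + c)
    rw [show 2 * (i + 1) = 2 * i + 1 + 1 by ring]
    linarith
  · exact ⟨_, hrows.enter hW (Finset.card_pos.1 (by omega)) (by omega) hc rfl⟩

/-- The departing candidates (beginning with the dummy) on the walk that ends in row `2 * r + 1`,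
traced back along the pointers `P`. -/
def traceLeave (P : ℕ → ℕ) (m r : ℕ) : ℕ → ℕ
  | 0 => m
  | s + 1 => P (2 * (r - s) * (m + 1) +
      (P ((2 * (r - s) + 1) * (m + 1) + traceLeave P m r s) - 1)) - 1

/-- The entering candidates on this walk. -/
def traceEnter (P : ℕ → ℕ) (m r s : ℕ) : ℕ :=
  P ((2 * (r - s) + 1) * (m + 1) + traceLeave P m r s) - 1

theorem traceLeave_succ (P : ℕ → ℕ) (m r s : ℕ) : traceLeave P m r (s + 1) =
    P (2 * (r - s) * (m + 1) + traceEnter P m r s) - 1 := rfl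

/-- The committee, with the dummy candidate, after `i` rounds of the traceback. -/
def traceSet (P : ℕ → ℕ) (m r : ℕ) (W : Finset ℕ) : ℕ → Finset ℕ
  | 0 => insert m W
  | i + 1 => if i < r then
      (insert (traceEnter P m r i) (traceSet P m r W i)).erase (traceLeave P m r (i + 1))
      else insert (traceEnter P m r i) (traceSet P m r W i)

/-- The situation before the traceback from row `2 * r + 1`. -/
structure TraceReady (X : Model) (M : ℝ) (W : Finset ℕ) (j : ℕ) (T : ℕ → ℝ) (P : ℕ → ℕ) (r : ℕ) :
    Prop where
  subset : W ⊆ Finset.range X.m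
  card : W.card = j
  lt : j < X.m
  rows : TableRows X M W T P (2 * (j + 1))
  le : r ≤ j

namespace TraceReady

variable {X : Model} {M : ℝ} {W : Finset ℕ} {j : ℕ} {T : ℕ → ℝ} {P : ℕ → ℕ} {r : ℕ}

theorem enter_of_leave (h : TraceReady X M W j T P r) {s : ℕ} (hs : s ≤ r)
    (hd : traceLeave P X.m r s ∈ insert X.m W) :
    traceEnter P X.m r s ∈ Finset.range X.m \ W ∧
      T ((2 * (r - s) + 1) * (X.m + 1) + traceLeave P X.m r s) =
        T (2 * (r - s) * (X.m + 1) + traceEnter P X.m r s) + X.w (traceEnter P X.m r s) +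
        swapGain (boundReward M X.lo X.hi) X.S (labelsOfPart X.n X.part 1) W
          (traceLeave P X.m r s) (traceEnter P X.m r s) := by
  have := h.card; have := h.lt; have := h.le
  exact h.rows.leave h.subset (by omega) (by omega) hd rfl

theorem leave_of_enter (h : TraceReady X M W j T P r) {s : ℕ} (hs : s < r)
    (hc : traceEnter P X.m r s ∈ Finset.range X.m \ W) :
    traceLeave P X.m r (s + 1) ∈ W ∧
      T (2 * (r - (s + 1) + 1) * (X.m + 1) + traceEnter P X.m r s) =
        T ((2 * (r - (s + 1)) + 1) * (X.m + 1) + traceLeave P X.m r (s + 1)) -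
        X.w (traceLeave P X.m r (s + 1)) +
        swapGain (boundReward M X.lo X.hi) X.S (labelsOfPart X.n X.part 0) W
          (traceLeave P X.m r (s + 1)) (traceEnter P X.m r s) := by
  have := h.card; have := h.lt; have := h.le
  refine h.rows.enter h.subset (Finset.card_pos.1 (by omega)) (by omega) hc ?_
  rw [traceLeave_succ, show r - (s + 1) + 1 = r - s by omega]

theorem leave_mem (h : TraceReady X M W j T P r) {s : ℕ} (hs : s ≤ r) :
    traceLeave P X.m r s ∈ insert X.m W := by
  induction s with
  | zero => simp [traceLeave]
  | succ s ih =>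
    exact Finset.mem_insert_of_mem
      (h.leave_of_enter hs (h.enter_of_leave (by omega) (ih (by omega))).1).1

theorem enter_mem (h : TraceReady X M W j T P r) {s : ℕ} (hs : s ≤ r) :
    traceEnter P X.m r s ∈ Finset.range X.m \ W :=
  (h.enter_of_leave hs (h.leave_mem hs)).1

/-- The trace starts at the end of the walk, so position `i` of the walk is step `r - i` of the
trace. -/
theorem isBestWalk (h : TraceReady X M W j T P r) :
    IsBestWalk (swapGain (boundReward M X.lo X.hi) X.S (labelsOfPart X.n X.part 0) W)
      (swapGain (boundReward M X.lo X.hi) X.S (labelsOfPart X.n X.part 1) W) X.w W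
      (Finset.range X.m \ W) (fun i v => T (2 * i * (X.m + 1) + v))
      (fun i v => T ((2 * i + 1) * (X.m + 1) + v)) r
      (fun i => traceEnter P X.m r (r - i)) (fun i => traceLeave P X.m r (r - i)) := by
  refine ⟨fun i _ => h.enter_mem (by omega), fun i hi => ?_, fun i hi => ?_, fun i hi => ?_⟩
  · have := (h.leave_of_enter (s := r - i - 1) (by omega) (h.enter_mem (by omega))).1
    rwa [show r - i - 1 + 1 = r - i by omega] at this
  · have := (h.enter_of_leave (s := r - i) (by omega) (h.leave_mem (by omega))).2
    rwa [show r - (r - i) = i by omega] at this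
  · have := (h.leave_of_enter (s := r - (i + 1)) (by omega) (h.enter_mem (by omega))).2
    rwa [show r - (i + 1) + 1 = r - i by omega, show r - (r - i) = i by omega] at this

/-- Departing candidates lie in `W` and entering ones outside it, so the single updates do not
interfere and their order is irrelevant. -/
theorem mem_traceSet (h : TraceReady X M W j T P r) {i : ℕ} (hi : i ≤ r + 1) (v : ℕ) :
    v ∈ traceSet P X.m r W i ↔ v = X.m ∨ (v ∈ W ∧ ∀ s < i, s < r → v ≠ traceLeave P X.m r (s + 1)) ∨
      ∃ s < i, v = traceEnter P X.m r s := by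
  induction i with
  | zero => simp [traceSet]
  | succ i ih =>
    have hc := mem_complement.1 (h.enter_mem (s := i) (by omega))
    have ih := ih (by omega)
    have hex : (∃ s < i + 1, v = traceEnter P X.m r s) ↔
        v = traceEnter P X.m r i ∨ ∃ s < i, v = traceEnter P X.m r s := by
      constructor
      · rintro ⟨s, hs, rfl⟩
        rcases Nat.lt_succ_iff_lt_or_eq.1 hs with h | rfl
        · exact Or.inr ⟨s, h, rfl⟩
        · exact Or.inl rfl
      · rintro (h | ⟨s, hs, h⟩)
        · exact ⟨i, by omega, h⟩
        · exact ⟨s, by omega, h⟩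
    have hall : (∀ s < i + 1, s < r → v ≠ traceLeave P X.m r (s + 1)) ↔
        (∀ s < i, s < r → v ≠ traceLeave P X.m r (s + 1)) ∧
          (i < r → v ≠ traceLeave P X.m r (i + 1)) := by
      constructor
      · exact fun h => ⟨fun s hs => h s (by omega), h i (by omega)⟩
      · rintro ⟨h1, h2⟩ s hs
        rcases Nat.lt_succ_iff_lt_or_eq.1 hs with h | rfl
        · exact h1 s h
        · exact h2
    rw [hex, hall, traceSet]
    split_ifs with hir
    · have hd := (h.leave_of_enter hir (h.enter_mem (by omega))).1
      have hdm : traceLeave P X.m r (i + 1) ≠ X.m := fun he => by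
        have := Finset.mem_range.1 (h.subset hd)
        omega
      have hne : ∀ s, s ≤ r → traceLeave P X.m r (i + 1) ≠ traceEnter P X.m r s := fun s hs he =>
        (mem_complement.1 (h.enter_mem hs)).2 (Finset.mem_insert_of_mem (he ▸ hd))
      have hne' : v = traceLeave P X.m r (i + 1) → ¬ ∃ s < i, v = traceEnter P X.m r s := by
        rintro rfl ⟨s, hs, he⟩
        exact hne s (by omega) he
      have hnei := hne i (by omega)
      rw [Finset.mem_erase, Finset.mem_insert, ih]
      by_cases hv : v = traceLeave P X.m r (i + 1)
      · subst hv
        simp only [ne_eq, not_true, false_and, hdm, hnei, hne' rfl, hir, forall_true_left, and_false,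
          or_self]
      · simp only [ne_eq, hv, not_false_iff, true_and, implies_true, and_true]
        rw [or_left_comm, or_left_comm (a := v ∈ W ∧ _)]
    · simp only [hir, false_imp_iff, and_true]
      rw [Finset.mem_insert, ih, or_left_comm, or_left_comm (a := v ∈ W ∧ _)]

theorem traceSet_last (h : TraceReady X M W j T P r) :
    traceSet P X.m r W (r + 1) = insert X.m
      ((W \ (Finset.range r).image fun i => traceLeave P X.m r (r - i)) ∪
        (Finset.range (r + 1)).image fun i => traceEnter P X.m r (r - i)) := by
  ext v
  rw [h.mem_traceSet le_rfl, Finset.mem_insert, Finset.mem_union, Finset.mem_sdiff,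
    Finset.mem_image, Finset.mem_image]
  have h1 : (∀ s < r + 1, s < r → v ≠ traceLeave P X.m r (s + 1)) ↔
      ¬ ∃ a ∈ Finset.range r, traceLeave P X.m r (r - a) = v := by
    constructor
    · rintro h ⟨a, ha, rfl⟩
      rw [Finset.mem_range] at ha
      refine h (r - a - 1) (by omega) (by omega) ?_
      rw [show r - a - 1 + 1 = r - a by omega]
    · rintro h s - hs rfl
      refine h ⟨r - (s + 1), Finset.mem_range.2 (by omega), ?_⟩
      rw [show r - (r - (s + 1)) = s + 1 by omega]
  have h2 : (∃ s < r + 1, v = traceEnter P X.m r s) ↔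
      ∃ a ∈ Finset.range (r + 1), traceEnter P X.m r (r - a) = v := by
    constructor
    · rintro ⟨s, hs, rfl⟩
      exact ⟨r - s, Finset.mem_range.2 (by omega), by rw [show r - (r - s) = s by omega]⟩
    · rintro ⟨a, ha, rfl⟩
      exact ⟨r - a, by omega, rfl⟩
  rw [h1, h2]

end TraceReady

/-- Trace the best closed walk back, and let its candidates enter and leave the committee. -/
def traceProgram : Program :=
  .seq (.seq (assign 15 exprM) (assign 18 (scalar 22)))
  (forLoop 10 (.plus (scalar 23) (.const 1))
    (.seq
      (.seq (assign 17 (.minus (.get 8 (.plus (scalar 18) (scalar 15))) (.const 1)))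
      (.seq (.setNat 6 (scalar 17) (.const 1))
        (assign 18 (.minus (scalar 18) (.plus exprM (.const 1))))))
      (.branch (.natLe (.plus (scalar 10) (.const 1)) (scalar 23))
        (.seq (assign 15 (.minus (.get 8 (.plus (scalar 18) (scalar 17))) (.const 1)))
        (.seq (.setNat 6 (scalar 15) (.const 0))
          (assign 18 (.minus (scalar 18) (.plus exprM (.const 1))))))
        .skip)))

/-- Bank 18 descends one row per step. In the last round the entering candidate is the first of the
walk and its predecessor is the dummy, so nothing is removed; the dummy stays in the set throughout.
-/
theorem traceProgram_spec {X : Model} {W : Finset ℕ} {s : Memory} (hs : Loaded X s)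
    (hm : HoldsSet X W s) {r : ℕ} (h23 : s.nat 23 0 = r)
    (h22 : s.nat 22 0 = (2 * r + 1) * (X.m + 1)) :
    Ensures traceProgram s (200 * (r + 1)) fun s' => SameOutside [6, 10, 15, 17, 18] [] s s' ∧
      ∀ v, s'.nat 6 v = if v ∈ traceSet (s.nat 8) X.m r W (r + 1) then 1 else 0 := by
  refine Ensures.le (T₁ := 10 + ((r + 1) * (150 + 4 + 12) + 4 + 9))
    (Ensures.seq (Ensures.of_wp ?_ (by decide))) (by omega)
  simp only [Program.wp, assign]
  refine Ensures.mono (Ensures.forLoop (N := r + 1) (T := 150)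
    (fun i s' => SameOutside [6, 10, 15, 17, 18] [] s s' ∧ s'.nat 10 0 = i ∧
      (i ≤ r → s'.nat 18 0 = (2 * (r - i) + 1) * (X.m + 1) ∧
        s'.nat 15 0 = traceLeave (s.nat 8) X.m r i) ∧
      ∀ v, s'.nat 6 v = if v ∈ traceSet (s.nat 8) X.m r W i then 1 else 0) ?_ ?_ ?_)
    (fun s' h => ⟨h.1, h.2.2.2⟩) (by rw [cost_scalar_succ])
  · refine ⟨(((SameOutside.refl _ _ _).writeNat (by simp) _ _).writeNat (by simp) _ _).writeNat
      (by simp) _ _, by simp, ?_, ?_⟩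
    · simp [h22, exprM, hs.m, traceLeave]
    · simpa [traceSet, HoldsSet] using hm
  · rintro i - s' ⟨h1, h2, -⟩
    refine ⟨h2, ?_⟩
    simp [h1.nat 23 (by simp), h23]
  · rintro i hi s₁ ⟨hs1, h10, hcur, hset⟩
    obtain ⟨h18, h15⟩ := hcur (by omega)
    have hm' := (hs.same hs1 (by decide) (by simp)).m
    have g8 : s₁.nat 8 = s.nat 8 := hs1.nat 8 (by simp)
    have g23 : s₁.nat 23 0 = r := by rw [hs1.nat 23 (by simp), h23]
    have henter : s.nat 8 ((2 * (r - i) + 1) * (X.m + 1) + traceLeave (s.nat 8) X.m r i) - 1 =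
      traceEnter (s.nat 8) X.m r i := rfl
    have hbase : (2 * (r - i) + 1) * (X.m + 1) - (X.m + 1) = 2 * (r - i) * (X.m + 1) := by
      rw [Nat.succ_mul, Nat.add_sub_cancel]
    refine Ensures.of_wp ?_ (by decide)
    simp only [Program.wp]
    refine ⟨fun hb => ⟨by simp [h10], ((((((hs1.writeNat (by simp) _ _).writeNat (by simp) _ _).writeNat
      (by simp) _ _).writeNat (by simp) _ _).writeNat (by simp) _ _).writeNat (by simp) _ _).writeNat
      (by simp) _ _, by simp, fun hi' => ⟨?_, ?_⟩, fun v => ?_⟩,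
      fun hb => ⟨by simp [h10], (((hs1.writeNat (by simp) _ _).writeNat (by simp) _ _).writeNat
      (by simp) _ _).writeNat (by simp) _ _, by simp, fun hi' => ?_, fun v => ?_⟩⟩
    · simp [h18, exprM, hm', hbase]
      obtain ⟨q, hq⟩ : ∃ q, r - i = q + 1 := ⟨r - i - 1, by omega⟩
      rw [hq, show r - (i + 1) = q by omega, show 2 * (q + 1) = 2 * q + 1 + 1 by ring, Nat.succ_mul,
        Nat.add_sub_cancel]
    · simp [h18, h15, g8, exprM, hm', hbase, henter, traceLeave_succ]
    · have hir : i < r := by simpa [h10, g23, Nat.succ_le_iff] using hb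
      have e1 : s.nat 8 (2 * (r - i) * (X.m + 1) + traceEnter (s.nat 8) X.m r i) - 1 =
        traceLeave (s.nat 8) X.m r (i + 1) := rfl
      simp only [traceSet, hir, if_true, Finset.mem_erase, Finset.mem_insert]
      simp [h18, h15, g8, exprM, hm', hbase, henter, e1, Function.update_apply, hset]
      by_cases a1 : v = traceLeave (s.nat 8) X.m r (i + 1) <;>
        by_cases a2 : v = traceEnter (s.nat 8) X.m r i <;> simp [a1, a2]
    · have hir : ¬ i < r := by simpa [h10, g23, Nat.succ_le_iff] using hb
      omega
    · have hir : ¬ i < r := by simpa [h10, g23, Nat.succ_le_iff] using hb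
      simp only [traceSet, hir, if_false, Finset.mem_insert]
      simp [h18, h15, g8, henter, Function.update_apply, hset]
      by_cases a2 : v = traceEnter (s.nat 8) X.m r i <;> simp [a2]

/-! ### One augmentation and the complete algorithm -/

/-- The committee `W` of size `j` is optimal for the objective function with large rewards, as
certified by a splitting of the weights. -/
def SplitOptimal (X : Model) (M : ℝ) (j : ℕ) (W : Finset ℕ) : Prop :=
  W.card = j ∧ ∃ q₁ q₂ : ℕ → ℝ, (∀ v ∈ Finset.range X.m, q₁ v + q₂ v = X.w v) ∧
    IsSizeOptimal (boundReward M X.lo X.hi) X.S (labelsOfPart X.n X.part 0) (Finset.range X.m) q₁ W ∧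
    IsSizeOptimal (boundReward M X.lo X.hi) X.S (labelsOfPart X.n X.part 1) (Finset.range X.m) q₂ W

/-- Enlarge an optimal committee by one. -/
def augmentProgram : Program :=
  .seq countProgram (.seq gainProgram (.seq lengthProgram (.seq startProgram
    (.seq roundsProgram traceProgram))))

/-- The table in memory is a walk table with dummy `X.m`, so the exchange theorem supplies the next
certificate. The splitting is never computed; it exists only in the proof. Since `j < m`, the rounds
cost a multiple of `(m + 1) ^ 3`. -/
theorem augmentProgram_spec {X : Model}
    (hlam₁ : LaminarFamily X.S (labelsOfPart X.n X.part 0))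
    (hlam₂ : LaminarFamily X.S (labelsOfPart X.n X.part 1)) {W : Finset ℕ} {s : Memory}
    (hs : Loaded X s) (hm : HoldsSet X W s) {M : ℝ} (hM : 0 ≤ M) (hMs : s.real 1 0 = M) {j : ℕ}
    (hopt : SplitOptimal X M j W) (hjm : j < X.m) (hj : s.nat 21 0 = j) :
    Ensures augmentProgram s (2000 * ((X.m + 1) ^ 2 * (X.n + 1) + (X.m + 1) ^ 3)) fun s' =>
      SameOutside [6, 7, 8, 10, 11, 12, 13, 14, 15, 16, 17, 18, 19, 20, 22, 23] [2, 3, 4, 5, 6, 7]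
        s s' ∧ ∃ W', SplitOptimal X M (j + 1) W' ∧ HoldsSet X W' s' := by
  obtain ⟨hcard, q₁, q₂, hq, h₁, h₂⟩ := hopt
  have hW := h₁.1
  refine Ensures.le (T₁ := 100 * ((X.m + 1) * (X.n + 1)) + (200 * (X.n + 1) +
    (300 * ((X.m + 1) ^ 2 * (X.n + 1)) + (100 * (X.m + 1) + (800 * ((j + 1) * (X.m + 1) ^ 2) +
    200 * (j + 1)))))) ?_ ?_
  swap
  · have e1 : (X.m + 1) * (X.n + 1) ≤ (X.m + 1) ^ 2 * (X.n + 1) :=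
      Nat.mul_le_mul_right _ (Nat.le_self_pow (by omega) _)
    have e2 : (X.n + 1) ≤ (X.m + 1) ^ 2 * (X.n + 1) :=
      Nat.le_mul_of_pos_left _ (by positivity)
    have e3 : X.m + 1 ≤ (X.m + 1) ^ 3 := Nat.le_self_pow (by omega) _
    have e4 : (j + 1) * (X.m + 1) ^ 2 ≤ (X.m + 1) ^ 3 := by
      rw [pow_succ' (X.m + 1) 2]
      exact Nat.mul_le_mul_right _ (by omega)
    omega
  refine Ensures.seq (Ensures.mono (countProgram_spec hW hs hm) ?_ le_rfl)
  rintro s₁ ⟨hs1, hcnt⟩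
  refine Ensures.seq (Ensures.mono (gainProgram_spec (hs.same hs1 (by decide) (by simp)) hcnt
    ((congrFun (hs1.real 1 (by simp)) 0).trans hMs)) ?_ le_rfl)
  rintro s₂ ⟨hs2, hup, hdn⟩
  have hs2' : SameOutside [7, 10, 11, 12] [2, 3] s s₂ :=
    hs1.trans hs2 (by simp) (by simp) (by simp) (by simp)
  refine Ensures.seq (Ensures.mono (lengthProgram_spec (W := W) (hs.same hs2' (by decide) (by simp))
    (fun c => (congrFun (hs2'.nat 6 (by simp)) c).trans (hm c)) hup hdn) ?_ le_rfl)
  rintro s₃ ⟨hs3, hlen⟩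
  have hs3' : SameOutside [7, 10, 11, 12, 13, 14, 15, 16, 17] [2, 3, 4, 6] s s₃ :=
    hs2'.trans hs3 (by simp) (by simp) (by simp) (by simp)
  refine Ensures.seq (Ensures.mono (startProgram_spec (hs.same hs3' (by decide) (by simp)) hlen)
    ?_ le_rfl)
  rintro s₄ ⟨hs4, hst⟩
  have hs4' : SameOutside [7, 10, 11, 12, 13, 14, 15, 16, 17] [2, 3, 4, 5, 6] s s₄ :=
    hs3'.trans hs4 (by simp) (by simp) (by simp) (by simp)
  have hlen4 : ∀ v ≤ X.m, ∀ u ≤ X.m, s₄.real 4 (v * (X.m + 1) + u) = arcLength X M W u v := by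
    intro v hv u hu
    rw [hs4.real 4 (by simp), hlen v hv u hu]
  refine Ensures.seq (Ensures.mono (roundsProgram_spec (hs.same hs4' (by decide) (by simp))
    (fun c => (congrFun (hs4'.nat 6 (by simp)) c).trans (hm c)) hlen4 hst
    ((congrFun (hs4'.nat 21 (by simp)) 0).trans hj)) ?_ le_rfl)
  rintro s₅ ⟨hs5, hst5, hrows, r, hbest, h23, h22⟩
  have hs5' : SameOutside [7, 8, 10, 11, 12, 13, 14, 15, 16, 17, 18, 19, 20, 22, 23]
      [2, 3, 4, 5, 6, 7] s s₅ := hs4'.trans hs5 (by simp) (by simp) (by simp) (by simp)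
  have hrj := hbest.lt
  refine Ensures.mono (traceProgram_spec (W := W) (hs.same hs5' (by decide) (by simp))
    (fun c => (congrFun (hs5'.nat 6 (by simp)) c).trans (hm c)) h23 h22) ?_ (by omega)
  rintro s₆ ⟨hs6, hset⟩
  refine ⟨hs5'.trans hs6 (by simp) (by simp) (by simp) (by simp), ?_⟩
  have htr : TraceReady X M W j (s₅.real 5) (s₅.nat 8) r := ⟨hW, hcard, hjm, hrows, by omega⟩
  obtain ⟨hc', p₁, p₂, hp, ho₁, ho₂⟩ := isSizeOptimal_of_bestWalk
    (decreasingIncrements_boundReward hM X.lo X.hi) hlam₁ hlam₂ (b := X.m)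
    (fun l hl => by have := Finset.mem_range.1 (X.S_subset l hl); omega) (by simp) hq h₁ h₂ hcard
    (hrows.isWalkTable hW hcard hjm hst5) (r := r) (by omega) (fun i hi => hbest.le i (by omega))
    (fun i hi => hbest.first i hi) (by simp [traceLeave]) htr.isBestWalk rfl
  refine ⟨_, ⟨hc', p₁, p₂, hp, ho₁, ho₂⟩, fun c => ?_⟩
  rw [hset c, htr.traceSet_last]

/-- Check whether all counts are within the bounds. -/
def checkProgram : Program :=
  .seq (.setNat 5 (.const 0) (.const 1))
    (forLoop 10 exprN
      (.branch (.conj (.natLe (.get 3 (scalar 10)) (.get 7 (scalar 10)))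
          (.natLe (.get 7 (scalar 10)) (.get 4 (scalar 10))))
        .skip (.setNat 5 (.const 0) (.const 0))))

theorem checkProgram_spec {X : Model} {W : Finset ℕ} {s : Memory} (hs : Loaded X s)
    (hcnt : ∀ l < X.n, s.nat 7 l = (W ∩ X.S l).card) :
    Ensures checkProgram s (100 * (X.n + 1)) fun s' => SameOutside [5, 10] [] s s' ∧
      ((∀ l < X.n, X.lo l ≤ (W ∩ X.S l).card ∧ (W ∩ X.S l).card ≤ X.hi l) → s'.nat 5 0 = 1) ∧
      (¬ (∀ l < X.n, X.lo l ≤ (W ∩ X.S l).card ∧ (W ∩ X.S l).card ≤ X.hi l) →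
        s'.nat 5 0 = 0) := by
  refine Ensures.le (T₁ := 3 + (X.n * (50 + 2 + 12) + 2 + 9))
    (Ensures.seq (Ensures.of_wp ?_ (by decide))) (by omega)
  simp only [Program.wp]
  refine Ensures.mono (Ensures.forLoop (N := X.n) (T := 50)
    (fun i s' => SameOutside [5, 10] [] s s' ∧ s'.nat 10 0 = i ∧
      ((∀ l < i, X.lo l ≤ (W ∩ X.S l).card ∧ (W ∩ X.S l).card ≤ X.hi l) → s'.nat 5 0 = 1) ∧
      (¬ (∀ l < i, X.lo l ≤ (W ∩ X.S l).card ∧ (W ∩ X.S l).card ≤ X.hi l) →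
        s'.nat 5 0 = 0)) ?_ ?_ ?_) (fun s' h => ⟨h.1, h.2.2⟩) le_rfl
  · exact ⟨((SameOutside.refl _ _ _).writeNat (by simp) _ _).writeNat (by simp) _ _, by simp,
      by simp, by simp⟩
  · rintro i - s' ⟨h1, h2, -⟩
    exact ⟨h2, (hs.same h1 (by decide) (by simp)).n⟩
  · rintro l hl s₁ ⟨hs1, h10, hyes, hno⟩
    have hld := hs.same hs1 (by decide) (by simp)
    have g7 : s₁.nat 7 l = (W ∩ X.S l).card := by rw [hs1.nat 7 (by simp), hcnt l hl]
    have hsucc : (∀ l' < l + 1, X.lo l' ≤ (W ∩ X.S l').card ∧ (W ∩ X.S l').card ≤ X.hi l') ↔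
        (∀ l' < l, X.lo l' ≤ (W ∩ X.S l').card ∧ (W ∩ X.S l').card ≤ X.hi l') ∧
          X.lo l ≤ (W ∩ X.S l).card ∧ (W ∩ X.S l).card ≤ X.hi l := Nat.forall_lt_succ_right
    refine Ensures.of_wp ?_ (by decide)
    simp only [Program.wp, Test.Holds, NatExpr.eval, scalar_eval, h10, hld.lo l hl, hld.hi l hl, g7,
      hsucc]
    refine ⟨fun hb => ⟨trivial, hs1.writeNat (by simp) _ _, by simp, fun h => ?_, fun h => ?_⟩,
      fun hb => ⟨by simp [h10], (hs1.writeNat (by simp) _ _).writeNat (by simp) _ _, by simp,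
        fun h => absurd h.2 hb, fun _ => by simp⟩⟩
    · simpa using hyes h.1
    · simpa using hno fun h' => h ⟨h', hb⟩

/-- The algorithm for both problems. -/
def solveProgram : Program :=
  .branch (.natLe exprK exprM)
    (.seq rewardProgram (.seq (.setNat 6 exprM (.const 1))
      (.seq (forLoop 21 exprK augmentProgram) (.seq countProgram checkProgram))))
    .skip

/-- The empty set has no competitor of its size, so any splitting certifies it. -/
theorem splitOptimal_empty (X : Model) (M : ℝ) : SplitOptimal X M 0 ∅ := by
  have h : ∀ Λ p, IsSizeOptimal (boundReward M X.lo X.hi) X.S Λ (Finset.range X.m) p ∅ := by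
    refine fun Λ p => ⟨Finset.empty_subset _, fun W' _ hW' => ?_⟩
    rw [Finset.card_empty, Finset.card_eq_zero] at hW'
    rw [hW']
  exact ⟨rfl, X.w, fun _ => 0, fun v _ => add_zero _, h _ _, h _ _⟩

/-- The loop maintains a committee optimal for its size under the modified objective, whether or not
the constraints can be met. Diversity is examined only once, at size `k`. -/
theorem solveProgram_spec {X : Model}
    (hlam₁ : LaminarFamily X.S (labelsOfPart X.n X.part 0))
    (hlam₂ : LaminarFamily X.S (labelsOfPart X.n X.part 1)) {s : Memory}
    (hs : Loaded X s) (h6 : ∀ c, s.nat 6 c = 0) (hk : X.k ≤ X.m) :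
    Ensures solveProgram s (5000 * ((X.k + 1) * ((X.m + 1) ^ 2 * (X.n + 1) + (X.m + 1) ^ 3)))
      fun s' => ∃ W, SplitOptimal X (1 + ∑ v ∈ Finset.range X.m, |X.w v|) X.k W ∧
        HoldsSet X W s' ∧
        ((∀ l < X.n, X.lo l ≤ (W ∩ X.S l).card ∧ (W ∩ X.S l).card ≤ X.hi l) → s'.nat 5 0 = 1) ∧
        (¬ (∀ l < X.n, X.lo l ≤ (W ∩ X.S l).card ∧ (W ∩ X.S l).card ≤ X.hi l) →
          s'.nat 5 0 = 0) := by
  set M := 1 + ∑ v ∈ Finset.range X.m, |X.w v| with hMdef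
  have hM : 0 ≤ M := add_nonneg zero_le_one (Finset.sum_nonneg fun _ _ => abs_nonneg _)
  set B := (X.m + 1) ^ 2 * (X.n + 1) + (X.m + 1) ^ 3 with hB
  have hmain : Ensures (.seq rewardProgram (.seq (.setNat 6 exprM (.const 1))
      (.seq (forLoop 21 exprK augmentProgram) (.seq countProgram checkProgram)))) s
      (100 * (X.m + 1) + (10 + ((X.k * (2000 * B + 2 + 12) + 2 + 9) +
        (100 * ((X.m + 1) * (X.n + 1)) + 100 * (X.n + 1)))))
      fun s' => ∃ W, SplitOptimal X M X.k W ∧ HoldsSet X W s' ∧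
        ((∀ l < X.n, X.lo l ≤ (W ∩ X.S l).card ∧ (W ∩ X.S l).card ≤ X.hi l) → s'.nat 5 0 = 1) ∧
        (¬ (∀ l < X.n, X.lo l ≤ (W ∩ X.S l).card ∧ (W ∩ X.S l).card ≤ X.hi l) →
          s'.nat 5 0 = 0) := by
    refine Ensures.seq (Ensures.mono (rewardProgram_spec hs) ?_ le_rfl)
    rintro s₁ ⟨hs1, hMs⟩
    have hs1L := hs.same hs1 (by decide) (by simp)
    refine Ensures.seq (Ensures.of_wp ?_ (by decide))
    simp only [Program.wp]
    have hs2 : SameOutside [6, 10] [1] s (s₁.writeNat 6 (exprM.eval s₁) ((NatExpr.const 1).eval s₁)) :=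
      (hs1.trans (SameOutside.refl [] [] _) (by simp) (by simp) (by simp) (by simp)).writeNat
        (by simp) _ _
    refine Ensures.seq (Ensures.mono (Ensures.forLoop (N := X.k) (T := 2000 * B)
      (fun i s' => Loaded X s' ∧ s'.real 1 0 = M ∧ s'.nat 21 0 = i ∧
        ∃ W, SplitOptimal X M i W ∧ HoldsSet X W s') ?_ ?_ ?_) ?_ le_rfl)
    · refine ⟨hs.same (A := [6, 10, 21]) (B := [1]) ((hs2.trans (SameOutside.refl [] [] _) (by simp)
        (by simp) (by simp) (by simp)).writeNat (by simp) _ _) (by decide) (by simp), by simpa using hMs,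
        by simp, ∅, splitOptimal_empty X M, fun c => ?_⟩
      have : s₁.nat 6 c = 0 := by rw [hs1.nat 6 (by simp), h6 c]
      simp [exprM, hs1L.m, Function.update_apply, this]
    · rintro i - s' ⟨h1, -, h2, -⟩
      exact ⟨h2, h1.k⟩
    · rintro i hi s₂ ⟨hld, hMs, h21, W, hopt, hW⟩
      refine Ensures.mono (augmentProgram_spec hlam₁ hlam₂ hld hW hM hMs hopt (by omega) h21) ?_ le_rfl
      rintro s₃ ⟨hs3, W', hopt', hW'⟩
      have hw21 : SameOutside [21] [] s₃ (s₃.writeNat 21 0 (i + 1)) :=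
        (SameOutside.refl _ _ _).writeNat (by simp) _ _
      refine ⟨by rw [hs3.nat 21 (by simp), h21], (hld.same hs3 (by decide) (by simp)).same hw21
        (by decide) (by simp), by simpa [hs3.real 1 (by simp)] using hMs, by simp, W', hopt', fun c => ?_⟩
      simpa using hW' c
    · rintro s₂ ⟨hld, -, -, W, hopt, hW⟩
      obtain ⟨hcard, q₁, q₂, hq, h₁, h₂⟩ := id hopt
      refine Ensures.seq (Ensures.mono (countProgram_spec h₁.1 hld hW) ?_ le_rfl)
      rintro s₃ ⟨hs3, hcnt⟩
      refine Ensures.mono (checkProgram_spec (hld.same hs3 (by decide) (by simp)) hcnt) ?_ le_rfl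
      rintro s₄ ⟨hs4, hyes, hno⟩
      refine ⟨W, hopt, fun c => ?_, hyes, hno⟩
      rw [hs4.nat 6 (by simp), hs3.nat 6 (by simp), hW c]
  obtain ⟨s', t, h1, h2, h3⟩ := hmain
  refine ⟨s', _, .branchTrue ?_ h1, ?_, h3⟩
  · simp [exprK, exprM, hs.k, hs.m, hk]
  · have e1 : X.m + 1 ≤ B := (Nat.le_self_pow (by omega) _).trans (Nat.le_add_left _ _)
    have e2 : (X.m + 1) * (X.n + 1) ≤ B :=
      (Nat.mul_le_mul_right _ (Nat.le_self_pow (by omega) _)).trans (Nat.le_add_right _ _)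
    have e3 : (X.n + 1) ≤ (X.m + 1) * (X.n + 1) := Nat.le_mul_of_pos_left _ (by positivity)
    have e4 : 5000 * ((X.k + 1) * B) = 5000 * (X.k * B) + 5000 * B := by ring
    have e5 : X.k ≤ X.k * B := Nat.le_mul_of_pos_right _ (by omega)
    have e6 : X.k * (2000 * B + 2 + 12) = 2000 * (X.k * B) + 14 * X.k := by ring
    simp only [Test.cost, NatExpr.cost, exprK, exprM]
    omega

theorem solveProgram_spec_of_lt {X : Model} {s : Memory} (hs : Loaded X s) (hk : X.m < X.k) :
    Ensures solveProgram s 20 fun s' => s' = s := by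
  refine ⟨s, _, .branchFalse ?_ (.skip s), ?_, rfl⟩
  · simp [exprK, exprM, hs.k, hs.m, hk]
  · simp [Test.cost, NatExpr.cost, exprK, exprM]

/-! ### Translation of the given instance -/

namespace Instance

variable (I : Instance)

/-- The candidates with label `l`, as natural numbers. -/
def natClass (l : ℕ) : Finset ℕ :=
  if h : l < I.n then (labelClass I.lab ⟨l, h⟩).map Fin.valEmbedding else ∅

/-- The instance with natural numbers for candidates and labels. -/
noncomputable def toModel : Model where
  m := I.m
  n := I.n
  k := I.k
  S := I.natClass
  part := I.inputNat 2
  lo := I.inputNat 3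
  hi := I.inputNat 4
  w := I.inputReal 0
  S_subset := by
    intro l c hc
    unfold natClass at hc
    split_ifs at hc with h
    · obtain ⟨c, -, rfl⟩ := Finset.mem_map.1 hc
      exact Finset.mem_range.2 c.2
    · simp at hc
  part_lt := by
    intro l hl
    simp only [inputNat, hl, dif_pos]
    have := (I.part ⟨l, hl⟩).2
    omega
  w_dummy := by simp [inputReal]

theorem mem_natClass {c l : ℕ} (hc : c < I.m) (hl : l < I.n) :
    c ∈ I.natClass l ↔ (⟨l, hl⟩ : Fin I.n) ∈ I.lab ⟨c, hc⟩ := by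
  simp only [natClass, hl, dif_pos, Finset.mem_map, labelClass, Finset.mem_filter, Finset.mem_univ,
    true_and, Fin.valEmbedding_apply]
  constructor
  · rintro ⟨d, hd, rfl⟩; exact hd
  · intro h; exact ⟨⟨c, hc⟩, h, rfl⟩

/-- The matrix row of the dummy begins at cell `m * n`, just behind the input, where the memory is
zero; this is why the dummy costs no preparation. -/
theorem loaded_input : Loaded I.toModel I.input := by
  refine ⟨rfl, rfl, rfl, fun c hc l hl => ?_, fun _ _ => rfl, fun _ _ => rfl, fun _ _ => rfl,
    fun _ _ => rfl⟩
  change c ≤ I.m at hc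
  change l < I.n at hl
  show (if h : c * I.n + l < I.m * I.n then
      (if Fin.modNat ⟨c * I.n + l, h⟩ ∈ I.lab (Fin.divNat ⟨c * I.n + l, h⟩) then 1 else 0) else 0) =
    if c ∈ I.natClass l then 1 else 0
  rcases hc.lt_or_eq with hc | rfl
  · have h : c * I.n + l < I.m * I.n := by nlinarith
    have e1 : Fin.modNat (⟨c * I.n + l, h⟩ : Fin (I.m * I.n)) = ⟨l, hl⟩ := by
      ext
      simp [Fin.modNat, Nat.mod_eq_of_lt hl]
    have e2 : Fin.divNat (⟨c * I.n + l, h⟩ : Fin (I.m * I.n)) = ⟨c, hc⟩ := by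
      ext
      simp only [Fin.divNat]
      rw [Nat.mul_comm, Nat.mul_add_div (by omega), Nat.div_eq_of_lt hl, add_zero]
    rw [dif_pos h, e1, e2]
    simp only [I.mem_natClass hc hl]
  · rw [dif_neg (by omega), if_neg]
    intro h
    have := Finset.mem_range.1 (I.toModel.S_subset l h)
    exact absurd this (lt_irrefl _)

theorem laminarFamily_natClass (h : I.TwoLaminar) (p : Fin 2) :
    LaminarFamily I.natClass (labelsOfPart I.n (I.inputNat 2) p) := by
  intro x hx y hy
  simp only [labelsOfPart, Finset.mem_filter, Finset.mem_range] at hx hy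
  obtain ⟨hx, hpx⟩ := hx
  obtain ⟨hy, hpy⟩ := hy
  simp only [inputNat, hx, hy, dif_pos] at hpx hpy
  by_cases hxy : x = y
  · subst hxy; exact Or.inr (Or.inl subset_rfl)
  simp only [natClass, hx, hy, dif_pos, Finset.disjoint_map, Finset.map_subset_map]
  rw [Finset.disjoint_iff_inter_eq_empty]
  exact h p ⟨x, hx⟩ (Fin.ext hpx) ⟨y, hy⟩ (Fin.ext hpy) fun he => hxy (congrArg Fin.val he)

theorem diverse_iff (W : Finset (Fin I.m)) : I.Diverse W ↔ ∀ l < I.n,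
    I.inputNat 3 l ≤ (W.map Fin.valEmbedding ∩ I.natClass l).card ∧
      (W.map Fin.valEmbedding ∩ I.natClass l).card ≤ I.inputNat 4 l := by
  have key : ∀ l (hl : l < I.n), (W.map Fin.valEmbedding ∩ I.natClass l).card =
      (W ∩ labelClass I.lab ⟨l, hl⟩).card := by
    intro l hl
    simp only [natClass, hl, dif_pos]
    rw [← Finset.map_inter, Finset.card_map]
  unfold Diverse IntervalDiverse
  constructor
  · intro h l hl
    rw [key l hl]
    simpa only [inputNat, hl, dif_pos] using h ⟨l, hl⟩
  · intro h l
    have := h l l.2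
    rw [key l l.2] at this
    simpa only [inputNat, l.2, dif_pos] using this

theorem objective_eq (W : Finset (Fin I.m)) :
    I.objective W = ∑ v ∈ W.map Fin.valEmbedding, I.inputReal 0 v := by
  rw [Finset.sum_map]
  exact Finset.sum_congr rfl fun c _ => by simp [inputReal]

theorem map_subset_range (W : Finset (Fin I.m)) :
    W.map Fin.valEmbedding ⊆ Finset.range I.m := by
  intro c hc
  obtain ⟨c, -, rfl⟩ := Finset.mem_map.1 hc
  exact Finset.mem_range.2 c.2

/-- If a diverse committee exists, the optimal one found is diverse and of maximum weight. If none
exists, the one found cannot be diverse and the check writes `0`. -/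
theorem solveProgram_correct (h : I.TwoLaminar) : ∃ s t, Exec solveProgram I.input s t ∧
    I.AnswersDCWD s ∧
    (I.m < I.k → t ≤ 20) ∧
    (I.k ≤ I.m → t ≤ 5000 * ((I.k + 1) * ((I.m + 1) ^ 2 * (I.n + 1) + (I.m + 1) ^ 3))) := by
  rcases le_or_gt I.k I.m with hk | hk
  · obtain ⟨s, t, h1, h2, W, hopt, hW, hyes, hno⟩ := solveProgram_spec
      (I.laminarFamily_natClass h 0) (I.laminarFamily_natClass h 1) I.loaded_input (fun _ => rfl) hk
    refine ⟨s, t, h1, ?_, fun hk' => by omega, fun _ => h2⟩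
    obtain ⟨hcard, q₁, q₂, hq, h₁, h₂⟩ := hopt
    have hbest : ∀ W' : Finset (Fin I.m), W'.card = I.k → I.Diverse W' → _ := fun W' hW' hdiv =>
      diverse_of_isSizeOptimal (W' := W'.map Fin.valEmbedding) rfl I.toModel.part_lt hq h₁ h₂
        (I.map_subset_range W') (by rw [Finset.card_map, hW', hcard]; rfl) ((I.diverse_iff W').1 hdiv)
    let V : Finset (Fin I.m) := Finset.univ.filter fun c => (c : ℕ) ∈ W
    have hV : V.map Fin.valEmbedding = W := by
      ext c
      simp only [V, Finset.mem_map, Finset.mem_filter, Finset.mem_univ, true_and,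
        Fin.valEmbedding_apply]
      constructor
      · rintro ⟨d, hd, rfl⟩; exact hd
      · intro hc; exact ⟨⟨c, Finset.mem_range.1 (h₁.1 hc)⟩, hc, rfl⟩
    constructor
    · rintro ⟨W₀, hW₀, hdiv₀⟩
      have hWdiv := (hbest W₀ hW₀ hdiv₀).1
      refine ⟨hyes hWdiv, V, ⟨?_, ?_, fun W' hW' hdiv' => ?_⟩, fun c => ?_⟩
      · rw [← Finset.card_map Fin.valEmbedding, hV, hcard]; rfl
      · rw [diverse_iff, hV]; exact hWdiv
      · rw [objective_eq, objective_eq, hV]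
        exact (hbest W' hW' hdiv').2
      · rw [hW c]
        have hcm : (c : ℕ) ≠ I.toModel.m := c.2.ne
        simp [V, hcm]
    · intro hinf
      refine hno fun hWdiv => hinf ⟨V, ?_, ?_⟩
      · rw [← Finset.card_map Fin.valEmbedding, hV, hcard]; rfl
      · rw [diverse_iff, hV]; exact hWdiv
  · obtain ⟨s, t, h1, h2, rfl⟩ := solveProgram_spec_of_lt I.loaded_input hk
    -- The answer cell still has its initial value `0`, which is correct because no committee has
    -- more than `m` members.
    refine ⟨_, t, h1, ⟨?_, fun _ => rfl⟩, fun _ => h2, fun hk' => by omega⟩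
    rintro ⟨W, hW, -⟩
    have := Finset.card_le_univ W
    rw [Fintype.card_fin] at this
    omega

theorem AnswersDCWD.answersDCF {I : Instance} {s : Memory} (h : I.AnswersDCWD s) :
    I.AnswersDCF s := ⟨fun hf => (h.1 hf).1, h.2⟩

end Instance

/-! ### The claimed running times -/

/-- Successors are at most doubles since `k` and `m` are positive, and the stray `m ^ 2` is absorbed
by `m ^ 3`, so `n = 0` is allowed. For `m < k` the constant time is absorbed by `k * m ^ 3`. -/
theorem time_bound {k m n t : ℕ} (hk : 1 ≤ k) (hm : 1 ≤ m) (h₁ : m < k → t ≤ 20)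
    (h₂ : k ≤ m → t ≤ 5000 * ((k + 1) * ((m + 1) ^ 2 * (n + 1) + (m + 1) ^ 3))) :
    t ≤ 120000 * (k * m ^ 3 + k * m ^ 2 * n) := by
  rcases le_or_gt k m with h | h
  · have e1 : (m + 1) ^ 2 ≤ 4 * m ^ 2 := by nlinarith
    have e2 : (m + 1) ^ 3 ≤ 8 * m ^ 3 :=
      calc (m + 1) ^ 3 ≤ (2 * m) ^ 3 := Nat.pow_le_pow_left (by omega) 3
        _ = 8 * m ^ 3 := by ring
    have e3 : m ^ 2 ≤ m ^ 3 := Nat.pow_le_pow_right hm (by omega)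
    calc t ≤ 5000 * ((k + 1) * ((m + 1) ^ 2 * (n + 1) + (m + 1) ^ 3)) := h₂ h
      _ ≤ 5000 * ((2 * k) * (4 * m ^ 2 * (n + 1) + 8 * m ^ 3)) := by gcongr; omega
      _ = 10000 * (k * (4 * (m ^ 2 * n) + 4 * m ^ 2 + 8 * m ^ 3)) := by ring
      _ ≤ 10000 * (k * (12 * (m ^ 2 * n) + 12 * m ^ 3)) :=
        Nat.mul_le_mul_left _ (Nat.mul_le_mul_left _ (by omega))
      _ = 120000 * (k * m ^ 3 + k * m ^ 2 * n) := by ring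
  · have : 1 ≤ k * m ^ 3 := Nat.mul_pos hk (pow_pos hm 3)
    have := h₁ h
    omega

end DiverseCommittee

theorem mainTheorem2 :
    (∃ (P : DiverseCommittee.Program) (A : ℕ),
      ∀ I : DiverseCommittee.Instance, I.TwoLaminar →
        ∃ (s : DiverseCommittee.Memory) (t : ℕ),
          DiverseCommittee.Exec P I.input s t ∧ I.AnswersDCF s ∧
          (1 ≤ I.k → 1 ≤ I.m → 1 ≤ I.n → t ≤ A * (I.k ^ 2 * I.m ^ 3 * I.n))) ∧
    (∃ (P : DiverseCommittee.Program) (A : ℕ),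
      ∀ I : DiverseCommittee.Instance, I.TwoLaminar →
        ∃ (s : DiverseCommittee.Memory) (t : ℕ),
          DiverseCommittee.Exec P I.input s t ∧ I.AnswersDCWD s ∧
          (1 ≤ I.k → 1 ≤ I.m →
            t ≤ A * (I.k * I.m ^ 3 + I.k ^ 3 * I.m ^ 2 * I.n))) := by
  -- For feasibility each of the two terms is bounded separately by `k ^ 2 * m ^ 3 * n`, which
  -- doubles the constant.
  refine ⟨⟨DiverseCommittee.solveProgram, 240000, fun I hI => ?_⟩,
    ⟨DiverseCommittee.solveProgram, 120000, fun I hI => ?_⟩⟩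
  · obtain ⟨s, t, h1, h2, h3, h4⟩ := I.solveProgram_correct hI
    refine ⟨s, t, h1, h2.answersDCF, fun hk hm hn => ?_⟩
    have hk2 : I.k ≤ I.k ^ 2 := Nat.le_self_pow (by omega) _
    calc t ≤ 120000 * (I.k * I.m ^ 3 + I.k * I.m ^ 2 * I.n) :=
          DiverseCommittee.time_bound hk hm h3 h4
      _ ≤ 120000 * (I.k ^ 2 * I.m ^ 3 * I.n + I.k ^ 2 * I.m ^ 3 * I.n) :=
        Nat.mul_le_mul_left _ (Nat.add_le_add
          ((Nat.mul_le_mul_right _ hk2).trans (Nat.le_mul_of_pos_right _ hn))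
          (Nat.mul_le_mul_right _ (Nat.mul_le_mul hk2 (Nat.pow_le_pow_right hm (by omega)))))
      _ = 240000 * (I.k ^ 2 * I.m ^ 3 * I.n) := by ring
  · obtain ⟨s, t, h1, h2, h3, h4⟩ := I.solveProgram_correct hI
    refine ⟨s, t, h1, h2, fun hk hm => ?_⟩
    have hk3 : I.k ≤ I.k ^ 3 := Nat.le_self_pow (by omega) _
    calc t ≤ 120000 * (I.k * I.m ^ 3 + I.k * I.m ^ 2 * I.n) :=
          DiverseCommittee.time_bound hk hm h3 h4
      _ ≤ 120000 * (I.k * I.m ^ 3 + I.k ^ 3 * I.m ^ 2 * I.n) := by gcongr
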